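/- Let $k$ be a field, let $H$ be a Hopf algebra over $k$ with bijective antipode, and let $A$ be a nonzero right $H$-comodule algebra with coaction $\delta\colon A\to A\otimes H$, and put $A^{co\,H}=\{a\in A:\delta(a)=a\otimes 1\}$. Assume that $A/A^{co\,H}$ is a faithfully flat $H$-Hopf–Galois extension; that is, the canonical map $A\otimes_{A^{co\,H}}A\to A\otimes H$, $a\otimes b\mapsto (a\otimes 1)\delta(b)$, is bijective and $A$ is faithfully flat over $A^{co\,H}$ as a left or as a right module. Let $\mathsf{Quot}_{gen}(H)$ be the set of generalised quotients $Q=H/I$ of $H$, where $I$ is a coideal and a right ideal of $H$, with projection $\pi\colon H\to Q$, and put $$A^{co\,Q}=\{a\in A:(\mathrm{id}\otimes\pi)\delta(a)=a\otimes\pi(1)\},$$ a subalgebra of $A$ that contains $A^{co\,H}$. Call $Q$ *right (left) admissible* if it is flat over $k$ and $H$ is faithfully coflat as a right (left) $Q$-comodule, that is, the cotensor product functor $H\,\square_Q-$ (respectively $-\,\square_Q H$) preserves and reflects exact sequences of left (respectively right) $Q$-comodules. Call a subalgebra $B\subseteq A$ *right (left) admissible* if $A$ is faithfully flat as a right (left)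 $B$-module. In both cases *admissible* means left and right admissible. Then the map $$\phi\colon\mathsf{Quot}_{gen}(H)\to\{B : A^{co\,H}\subseteq B\subseteq A \text{ a subalgebra}\},\qquad Q\mapsto A^{co\,Q},$$ has the following properties: 1. $\phi$ is injective on the set of right admissible generalised quotients of $H$ and maps it into the set of right admissible subalgebras of $A$; 2. $\phi$ is injective on the set of left admissible generalised quotients of $H$ and maps it into the set of left admissible subalgebras of $A$; 3. $\phi$ is injective on the set of admissible generalised quotients of $H$ and maps it into the set of admissible subalgebras of $A$. -/

import Mathlib

open scoped TensorProduct

universe u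

namespace HopfGal

/-! ### Comodules over a coalgebra, cotensor products, faithful coflatness -/

section Comodules

variable {k C : Type u} [Field k] [AddCommGroup C] [Module k C] [Coalgebra k C]

/-- `ρ : M → M ⊗ C` is a (coassociative, counital) right `C`-coaction on `M`. -/
structure IsRightCoaction {M : Type u} [AddCommGroup M] [Module k M]
    (ρ : M →ₗ[k] M ⊗[k] C) : Prop where
  coassoc : (TensorProduct.assoc k M C C).toLinearMap ∘ₗ ρ.rTensor C ∘ₗ ρ =
    (Coalgebra.comul (R := k) (A := C)).lTensor M ∘ₗ ρ
  counit : (TensorProduct.rid k M).toLinearMap ∘ₗ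
    (Coalgebra.counit (R := k) (A := C)).lTensor M ∘ₗ ρ = LinearMap.id

/-- `l : N → C ⊗ N` is a (coassociative, counital) left `C`-coaction on `N`. -/
structure IsLeftCoaction {N : Type u} [AddCommGroup N] [Module k N]
    (l : N →ₗ[k] C ⊗[k] N) : Prop where
  coassoc : l.lTensor C ∘ₗ l = (TensorProduct.assoc k C C N).toLinearMap ∘ₗ
    (Coalgebra.comul (R := k) (A := C)).rTensor N ∘ₗ l
  counit : (TensorProduct.lid k N).toLinearMap ∘ₗ
    (Coalgebra.counit (R := k) (A := C)).rTensor N ∘ₗ l = LinearMap.id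

/-- `f` is a morphism of right `C`-comodules `(M, ρ) → (M', ρ')`. -/
def IsRightColinear {M M' : Type u} [AddCommGroup M] [Module k M] [AddCommGroup M'] [Module k M']
    (ρ : M →ₗ[k] M ⊗[k] C) (ρ' : M' →ₗ[k] M' ⊗[k] C) (f : M →ₗ[k] M') : Prop :=
  ρ' ∘ₗ f = f.rTensor C ∘ₗ ρ

/-- `f` is a morphism of left `C`-comodules `(N, l) → (N', l')`. -/
def IsLeftColinear {N N' : Type u} [AddCommGroup N] [Module k N] [AddCommGroup N'] [Module k N']
    (l : N →ₗ[k] C ⊗[k] N) (l' : N' →ₗ[k] C ⊗[k] N') (f : N →ₗ[k] N') : Prop :=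
  l' ∘ₗ f = f.lTensor C ∘ₗ l

/-- The cotensor product `M □_C N`, the equalizer of
`ρ ⊗ id, id ⊗ l : M ⊗ N → M ⊗ C ⊗ N`. -/
def cotensor {M N : Type u} [AddCommGroup M] [Module k M] [AddCommGroup N] [Module k N]
    (ρ : M →ₗ[k] M ⊗[k] C) (l : N →ₗ[k] C ⊗[k] N) : Submodule k (M ⊗[k] N) :=
  LinearMap.eqLocus ((TensorProduct.assoc k M C N).toLinearMap ∘ₗ ρ.rTensor N) (l.lTensor M)

/-- The map `M □_C f : M □_C N → M □_C N'` induced by a morphism `f` of left comodules. -/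
def cotensorMapRight {M N N' : Type u} [AddCommGroup M] [Module k M]
    [AddCommGroup N] [Module k N] [AddCommGroup N'] [Module k N']
    (ρ : M →ₗ[k] M ⊗[k] C) {l : N →ₗ[k] C ⊗[k] N} {l' : N' →ₗ[k] C ⊗[k] N'}
    (f : N →ₗ[k] N') (hf : IsLeftColinear l l' f) : cotensor ρ l →ₗ[k] cotensor ρ l' :=
  (f.lTensor M).restrict (fun t ht => by
    have h1 : ((TensorProduct.assoc k M C N').toLinearMap ∘ₗ ρ.rTensor N') ∘ₗ f.lTensor M =
        (f.lTensor C).lTensor M ∘ₗ ((TensorProduct.assoc k M C N).toLinearMap ∘ₗ ρ.rTensor N) := by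
      apply TensorProduct.ext'
      intro m n
      simp only [LinearMap.comp_apply, LinearMap.lTensor_tmul, LinearMap.rTensor_tmul]
      induction ρ m using TensorProduct.induction_on with
      | zero => simp
      | tmul a b => simp
      | add a b ha hb => simp only [TensorProduct.add_tmul, map_add, ha, hb]
    have h2 : l'.lTensor M ∘ₗ f.lTensor M = (f.lTensor C).lTensor M ∘ₗ l.lTensor M := by
      rw [← LinearMap.lTensor_comp, ← LinearMap.lTensor_comp, hf]
    have ht' : ((TensorProduct.assoc k M C N).toLinearMap ∘ₗ ρ.rTensor N) t = l.lTensor M t := ht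
    change (((TensorProduct.assoc k M C N').toLinearMap ∘ₗ ρ.rTensor N') ∘ₗ f.lTensor M) t =
      (l'.lTensor M ∘ₗ f.lTensor M) t
    rw [h1, h2]
    exact congrArg _ ht')

/-- The map `f □_C N : M □_C N → M' □_C N` induced by a morphism `f` of right comodules. -/
def cotensorMapLeft {M M' N : Type u} [AddCommGroup M] [Module k M]
    [AddCommGroup M'] [Module k M'] [AddCommGroup N] [Module k N]
    {ρ : M →ₗ[k] M ⊗[k] C} {ρ' : M' →ₗ[k] M' ⊗[k] C} (l : N →ₗ[k] C ⊗[k] N)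
    (f : M →ₗ[k] M') (hf : IsRightColinear ρ ρ' f) : cotensor ρ l →ₗ[k] cotensor ρ' l :=
  (f.rTensor N).restrict (fun t ht => by
    have h1 : ((TensorProduct.assoc k M' C N).toLinearMap ∘ₗ ρ'.rTensor N) ∘ₗ f.rTensor N =
        f.rTensor (C ⊗[k] N) ∘ₗ ((TensorProduct.assoc k M C N).toLinearMap ∘ₗ ρ.rTensor N) := by
      rw [LinearMap.comp_assoc, ← LinearMap.rTensor_comp, hf]
      apply TensorProduct.ext'
      intro m n
      simp only [LinearMap.comp_apply, LinearMap.rTensor_tmul]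
      induction ρ m using TensorProduct.induction_on with
      | zero => simp
      | tmul a b => simp
      | add a b ha hb => simp only [TensorProduct.add_tmul, map_add, ha, hb]
    have h2 : l.lTensor M' ∘ₗ f.rTensor N = f.rTensor (C ⊗[k] N) ∘ₗ l.lTensor M := by
      rw [LinearMap.lTensor_comp_rTensor, LinearMap.rTensor_comp_lTensor]
    have ht' : ((TensorProduct.assoc k M C N).toLinearMap ∘ₗ ρ.rTensor N) t = l.lTensor M t := ht
    change (((TensorProduct.assoc k M' C N).toLinearMap ∘ₗ ρ'.rTensor N) ∘ₗ f.rTensor N) t =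
      (l.lTensor M' ∘ₗ f.rTensor N) t
    rw [h1, h2]
    exact congrArg _ ht')

/-- The right comodule `(M, ρ)` is faithfully coflat: `M □_C -` preserves and reflects exact
sequences of left `C`-comodules. -/
def IsRightFaithfullyCoflat {M : Type u} [AddCommGroup M] [Module k M]
    (ρ : M →ₗ[k] M ⊗[k] C) : Prop :=
  ∀ (X Y Z : Type u) [AddCommGroup X] [Module k X] [AddCommGroup Y] [Module k Y]
    [AddCommGroup Z] [Module k Z]
    (lX : X →ₗ[k] C ⊗[k] X) (lY : Y →ₗ[k] C ⊗[k] Y) (lZ : Z →ₗ[k] C ⊗[k] Z),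
    IsLeftCoaction lX → IsLeftCoaction lY → IsLeftCoaction lZ →
    ∀ (f : X →ₗ[k] Y) (g : Y →ₗ[k] Z) (hf : IsLeftColinear lX lY f) (hg : IsLeftColinear lY lZ g),
      Function.Exact f g ↔
        Function.Exact (cotensorMapRight ρ f hf) (cotensorMapRight ρ g hg)

/-- The left comodule `(N, l)` is faithfully coflat: `- □_C N` preserves and reflects exact
sequences of right `C`-comodules. -/
def IsLeftFaithfullyCoflat {N : Type u} [AddCommGroup N] [Module k N]
    (l : N →ₗ[k] C ⊗[k] N) : Prop :=
  ∀ (X Y Z : Type u) [AddCommGroup X] [Module k X] [AddCommGroup Y] [Module k Y]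
    [AddCommGroup Z] [Module k Z]
    (ρX : X →ₗ[k] X ⊗[k] C) (ρY : Y →ₗ[k] Y ⊗[k] C) (ρZ : Z →ₗ[k] Z ⊗[k] C),
    IsRightCoaction ρX → IsRightCoaction ρY → IsRightCoaction ρZ →
    ∀ (f : X →ₗ[k] Y) (g : Y →ₗ[k] Z)
      (hf : IsRightColinear ρX ρY f) (hg : IsRightColinear ρY ρZ g),
      Function.Exact f g ↔
        Function.Exact (cotensorMapLeft l f hf) (cotensorMapLeft l g hg)

end Comodules

/-! ### Tensor products and faithful flatness over a noncommutative algebra -/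

section Flatness

/-- The relations `x b ⊗ y = x ⊗ b y` in `X ⊗ Y`, for a right `B`-module `X` and a left
`B`-module `Y`. -/
def balancedRel (k B X Y : Type u) [Field k] [Ring B] [AddCommGroup X] [Module k X]
    [Module Bᵐᵒᵖ X] [AddCommGroup Y] [Module k Y] [Module B Y] : Submodule k (X ⊗[k] Y) :=
  Submodule.span k {t | ∃ (x : X) (b : B) (y : Y),
    t = (MulOpposite.op b • x) ⊗ₜ[k] y - x ⊗ₜ[k] (b • y)}

/-- The tensor product `X ⊗_B Y` of a right `B`-module `X` and a left `B`-module `Y`, for an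
algebra `B` over `k`. -/
abbrev BalancedTensor (k B X Y : Type u) [Field k] [Ring B] [AddCommGroup X] [Module k X]
    [Module Bᵐᵒᵖ X] [AddCommGroup Y] [Module k Y] [Module B Y] : Type u :=
  (X ⊗[k] Y) ⧸ balancedRel k B X Y

variable {k B : Type u} [Field k] [Ring B] [Algebra k B]

/-- The map `f ⊗_B Y : X ⊗_B Y → X' ⊗_B Y`. -/
def balancedMapLeft {X X' : Type u} (Y : Type u)
    [AddCommGroup X] [Module k X] [Module Bᵐᵒᵖ X] [IsScalarTower k Bᵐᵒᵖ X]
    [AddCommGroup X'] [Module k X'] [Module Bᵐᵒᵖ X'] [IsScalarTower k Bᵐᵒᵖ X']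
    [AddCommGroup Y] [Module k Y] [Module B Y]
    (f : X →ₗ[Bᵐᵒᵖ] X') : BalancedTensor k B X Y →ₗ[k] BalancedTensor k B X' Y :=
  (balancedRel k B X Y).mapQ (balancedRel k B X' Y) ((f.restrictScalars k).rTensor Y) (by
    unfold balancedRel
    rw [Submodule.span_le]
    rintro _ ⟨x, b, y, rfl⟩
    apply Submodule.subset_span
    exact ⟨f x, b, y, by simp⟩)

/-- The map `X ⊗_B f : X ⊗_B Y → X ⊗_B Y'`. -/
def balancedMapRight (X : Type u) {Y Y' : Type u}
    [AddCommGroup X] [Module k X] [Module Bᵐᵒᵖ X]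
    [AddCommGroup Y] [Module k Y] [Module B Y] [IsScalarTower k B Y]
    [AddCommGroup Y'] [Module k Y'] [Module B Y'] [IsScalarTower k B Y']
    (f : Y →ₗ[B] Y') : BalancedTensor k B X Y →ₗ[k] BalancedTensor k B X Y' :=
  (balancedRel k B X Y).mapQ (balancedRel k B X Y') ((f.restrictScalars k).lTensor X) (by
    unfold balancedRel
    rw [Submodule.span_le]
    rintro _ ⟨x, b, y, rfl⟩
    apply Submodule.subset_span
    exact ⟨x, b, f y, by simp⟩)

variable (k B)

/-- `M` is faithfully flat as a left `B`-module: `- ⊗_B M` preserves and reflects exact sequences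
of right `B`-modules. -/
def IsLeftFaithfullyFlat (M : Type u) [AddCommGroup M] [Module k M] [Module B M] : Prop :=
  ∀ (X Y Z : Type u)
    [AddCommGroup X] [Module k X] [Module Bᵐᵒᵖ X] [IsScalarTower k Bᵐᵒᵖ X]
    [AddCommGroup Y] [Module k Y] [Module Bᵐᵒᵖ Y] [IsScalarTower k Bᵐᵒᵖ Y]
    [AddCommGroup Z] [Module k Z] [Module Bᵐᵒᵖ Z] [IsScalarTower k Bᵐᵒᵖ Z]
    (f : X →ₗ[Bᵐᵒᵖ] Y) (g : Y →ₗ[Bᵐᵒᵖ] Z),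
    Function.Exact f g ↔
      Function.Exact (balancedMapLeft (k := k) M f) (balancedMapLeft (k := k) M g)

/-- `M` is faithfully flat as a right `B`-module: `M ⊗_B -` preserves and reflects exact sequences
of left `B`-modules. -/
def IsRightFaithfullyFlat (M : Type u) [AddCommGroup M] [Module k M] [Module Bᵐᵒᵖ M] : Prop :=
  ∀ (X Y Z : Type u)
    [AddCommGroup X] [Module k X] [Module B X] [IsScalarTower k B X]
    [AddCommGroup Y] [Module k Y] [Module B Y] [IsScalarTower k B Y]
    [AddCommGroup Z] [Module k Z] [Module B Z] [IsScalarTower k B Z]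
    (f : X →ₗ[B] Y) (g : Y →ₗ[B] Z),
    Function.Exact f g ↔
      Function.Exact (balancedMapRight (k := k) M f) (balancedMapRight (k := k) M g)

end Flatness

section Subalgebras

variable {k A : Type u} [Field k] [Ring A] [Algebra k A]

/-- Right multiplication makes `A` a right module over each subalgebra `B`. -/
instance subalgebraRightModule (B : Subalgebra k A) : Module (↥B)ᵐᵒᵖ A where
  smul b a := a * (b.unop : A)
  one_smul a := mul_one a
  mul_smul b c a := (mul_assoc a (c.unop : A) (b.unop : A)).symm
  smul_zero _ := zero_mul _
  smul_add _ _ _ := add_mul _ _ _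
  add_smul _ _ _ := mul_add _ _ _
  zero_smul a := mul_zero a

theorem op_smul_def (B : Subalgebra k A) (b : B) (a : A) :
    MulOpposite.op b • a = a * (b : A) := rfl

/-- The subalgebra `B` of `A` is left admissible: `A` is faithfully flat as a left `B`-module. -/
def IsLeftAdmissibleSubalgebra (B : Subalgebra k A) : Prop :=
  IsLeftFaithfullyFlat k B A

/-- The subalgebra `B` of `A` is right admissible: `A` is faithfully flat as a right
`B`-module. -/
def IsRightAdmissibleSubalgebra (B : Subalgebra k A) : Prop :=
  IsRightFaithfullyFlat k B A

end Subalgebras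

/-! ### Generalised quotients of a Hopf algebra -/

section Quotients

variable (k H : Type u) [Field k] [Ring H] [HopfAlgebra k H]

/-- A generalised quotient `Q = H / I` of `H`, given by the coideal right ideal `I`. -/
@[ext]
structure GenQuot where
  /-- The kernel `I` of `H → Q`. -/
  I : Submodule k H
  isCoideal : I.IsCoideal
  mul_mem : ∀ x ∈ I, ∀ h : H, x * h ∈ I

variable {k H}

namespace GenQuot

instance (Q : GenQuot k H) : Q.I.IsCoideal := Q.isCoideal

/-- The quotient coalgebra `H / I`. -/
abbrev carrier (Q : GenQuot k H) : Type u := H ⧸ Q.I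

/-- The projection `H → Q`. -/
abbrev proj (Q : GenQuot k H) : H →ₗ[k] Q.carrier := Q.I.mkQ

/-- `H` as a right `Q`-comodule, `h ↦ h₁ ⊗ π(h₂)`. -/
def rightCoaction (Q : GenQuot k H) : H →ₗ[k] H ⊗[k] Q.carrier :=
  Q.proj.lTensor H ∘ₗ Coalgebra.comul

/-- `H` as a left `Q`-comodule, `h ↦ π(h₁) ⊗ h₂`. -/
def leftCoaction (Q : GenQuot k H) : H →ₗ[k] Q.carrier ⊗[k] H :=
  Q.proj.rTensor H ∘ₗ Coalgebra.comul

/-- `Q` is right admissible: it is flat over `k` and `H` is faithfully coflat as a right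
`Q`-comodule. -/
def IsRightAdmissible (Q : GenQuot k H) : Prop :=
  Module.Flat k Q.carrier ∧ IsRightFaithfullyCoflat Q.rightCoaction

/-- `Q` is left admissible: it is flat over `k` and `H` is faithfully coflat as a left
`Q`-comodule. -/
def IsLeftAdmissible (Q : GenQuot k H) : Prop :=
  Module.Flat k Q.carrier ∧ IsLeftFaithfullyCoflat Q.leftCoaction

end GenQuot

end Quotients

/-! ### Comodule algebras, coinvariants and Hopf–Galois extensions -/

section Galois

variable {k H A : Type u} [Field k] [Ring H] [HopfAlgebra k H] [Ring A] [Algebra k A]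

/-- The subalgebra `A^{co H} = {a | δ(a) = a ⊗ 1}` of coinvariants. -/
def coinvariants (δ : A →ₐ[k] A ⊗[k] H) : Subalgebra k A :=
  AlgHom.equalizer δ Algebra.TensorProduct.includeLeft

theorem mem_coinvariants {δ : A →ₐ[k] A ⊗[k] H} {a : A} :
    a ∈ coinvariants δ ↔ δ a = a ⊗ₜ[k] (1 : H) := Iff.rfl

theorem lTensor_proj_mul_eq_zero (Q : GenQuot k H) (t s : A ⊗[k] H)
    (ht : Q.proj.lTensor A t = 0) : Q.proj.lTensor A (t * s) = 0 := by
  induction s using TensorProduct.induction_on with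
  | zero => simp
  | add x y hx hy => rw [mul_add, map_add, hx, hy, add_zero]
  | tmul a h =>
    let r : Q.carrier →ₗ[k] Q.carrier :=
      Q.I.mapQ Q.I (LinearMap.mulRight k h) (fun x hx => Q.mul_mem x hx h)
    have key : Q.proj.lTensor A ∘ₗ LinearMap.mulRight k (a ⊗ₜ[k] h) =
        TensorProduct.map (LinearMap.mulRight k a) r ∘ₗ Q.proj.lTensor A := by
      apply TensorProduct.ext'
      intro b g
      simp only [LinearMap.comp_apply, LinearMap.mulRight_apply, LinearMap.lTensor_tmul,
        TensorProduct.map_tmul, Algebra.TensorProduct.tmul_mul_tmul]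
      rfl
    have := LinearMap.congr_fun key t
    rw [LinearMap.comp_apply, LinearMap.comp_apply, ht, map_zero] at this
    exact this

/-- The subalgebra `A^{co Q} = {a | a₀ ⊗ π(a₁) = a ⊗ π(1)}` of `Q`-coinvariants. -/
def quotCoinvariants (δ : A →ₐ[k] A ⊗[k] H) (Q : GenQuot k H) : Subalgebra k A where
  carrier := {a | Q.proj.lTensor A (δ a) = a ⊗ₜ[k] Q.proj 1}
  mul_mem' := by
    intro a b ha hb
    have ha' : Q.proj.lTensor A (δ a) = a ⊗ₜ[k] Q.proj 1 := ha
    have hb' : Q.proj.lTensor A (δ b) = b ⊗ₜ[k] Q.proj 1 := hb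
    change Q.proj.lTensor A (δ (a * b)) = (a * b) ⊗ₜ[k] Q.proj 1
    have h0 : Q.proj.lTensor A ((δ a - a ⊗ₜ[k] (1 : H)) * δ b) = 0 := by
      apply lTensor_proj_mul_eq_zero
      rw [map_sub, ha', LinearMap.lTensor_tmul, sub_self]
    rw [sub_mul, map_sub, sub_eq_zero, ← map_mul] at h0
    rw [h0]
    have key : Q.proj.lTensor A ∘ₗ LinearMap.mulLeft k (a ⊗ₜ[k] (1 : H)) =
        (LinearMap.mulLeft k a).rTensor Q.carrier ∘ₗ Q.proj.lTensor A := by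
      apply TensorProduct.ext'
      intro c g
      simp
    have := LinearMap.congr_fun key (δ b)
    simp only [LinearMap.comp_apply, LinearMap.mulLeft_apply, hb', LinearMap.rTensor_tmul] at this
    exact this
  add_mem' := by
    intro a b ha hb
    have ha' : Q.proj.lTensor A (δ a) = a ⊗ₜ[k] Q.proj 1 := ha
    have hb' : Q.proj.lTensor A (δ b) = b ⊗ₜ[k] Q.proj 1 := hb
    change Q.proj.lTensor A (δ (a + b)) = (a + b) ⊗ₜ[k] Q.proj 1
    rw [map_add, map_add, ha', hb', TensorProduct.add_tmul]
  algebraMap_mem' := by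
    intro r
    change Q.proj.lTensor A (δ (algebraMap k A r)) = (algebraMap k A r) ⊗ₜ[k] Q.proj 1
    rw [AlgHom.commutes, Algebra.TensorProduct.algebraMap_apply, LinearMap.lTensor_tmul]

theorem coinvariants_le_quotCoinvariants (δ : A →ₐ[k] A ⊗[k] H) (Q : GenQuot k H) :
    coinvariants δ ≤ quotCoinvariants δ Q := by
  intro a ha
  change Q.proj.lTensor A (δ a) = a ⊗ₜ[k] Q.proj 1
  rw [mem_coinvariants.1 ha, LinearMap.lTensor_tmul]

/-- The map `Q ↦ A^{co Q}` from the generalised quotients of `H` to the subalgebras of `A` that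
contain `A^{co H}`. -/
def quotToSub (δ : A →ₐ[k] A ⊗[k] H) (Q : GenQuot k H) : Set.Ici (coinvariants δ) :=
  ⟨quotCoinvariants δ Q, coinvariants_le_quotCoinvariants δ Q⟩

/-- The canonical map `A ⊗_{A^{co H}} A → A ⊗ H`, `a ⊗ b ↦ (a ⊗ 1) δ(b)`. -/
def can (δ : A →ₐ[k] A ⊗[k] H) :
    BalancedTensor k (coinvariants δ) A A →ₗ[k] A ⊗[k] H :=
  (balancedRel k (coinvariants δ) A A).liftQ
    (LinearMap.mul' k (A ⊗[k] H) ∘ₗ TensorProduct.map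
      (Algebra.TensorProduct.includeLeft : A →ₐ[k] A ⊗[k] H).toLinearMap δ.toLinearMap) (by
    unfold balancedRel
    rw [Submodule.span_le]
    rintro _ ⟨x, b, y, rfl⟩
    have hb : δ (b : A) = (b : A) ⊗ₜ[k] (1 : H) := mem_coinvariants.1 b.2
    simp [op_smul_def, Subalgebra.smul_def, hb, ← mul_assoc])

/-- `δ` makes `A` a right `H`-comodule algebra such that `A / A^{co H}` is an `H`-Hopf–Galois
extension. -/
structure IsHopfGalois (δ : A →ₐ[k] A ⊗[k] H) : Prop where
  isCoaction : IsRightCoaction δ.toLinearMap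
  bijective_can : Function.Bijective (can δ)

end Galois

end HopfGal

/-! Let Q = H/I with projection π, let S be the antipode, T its inverse, and B = A^{co Q}. The
algebra A carries the left Q-coaction a ↦ π(T(a₁)) ⊗ a₀, whose coinvariants are again B
(`quotCoact_eq_iff`). The relevant Hopf modules are the left A-modules M with a left Q-coaction
satisfying ρ(am) = m₋₁T(a₁) ⊗ a₀m₀; for a B-module X, both A ⊗ X and A ⊗_B X are of this kind.

Everything rests on two properties of coinvariants of Hopf modules, collected in `IsDescentDatum`:
they lift along surjections, and only the zero module has none but 0. Then X embeds in A ⊗_B X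
through x ↦ 1 ⊗ x and exhausts its coinvariants, so inclusions between Hopf submodules can be tested
on elements 1 ⊗ x. This yields faithful flatness of A over B
(`IsDescentDatum.isRightFaithfullyFlat`). It also shows that the kernel of A ⊗ A → Q ⊗ A, x ⊗ y ↦
x₋₁ ⊗ x₀y, is exactly the space of relations of A ⊗_B A (`IsDescentDatum.mem_balancedRel_iff`). That
map factors through the surjection x ⊗ y ↦ δ(x)(y ⊗ 1) onto A ⊗ H. If z lies over 1 ⊗ S(h), then
π(h) = 0 exactly when z is a relation over B. Hence B determines I, which is injectivity
(`apply_eq_zero_of_coinvariants`).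

Faithful coflatness gives the two properties with H □_Q M in place of the coinvariants of M. The
passage between them uses colinear maps φ : H → A with φ(1) = 1, since h ⊗ m ↦ φ(h)m sends H □_Q M
to coinvariants. Such φ, colinear on any prescribed finite set, come from faithful flatness of the
Galois extension (`exists_integral`). Finite sets suffice because a tensor involves finitely many
elements of H, and a filter keeps track of this. Detection of zero also uses the maps h ↦ aφ(S(g)h)
and surjectivity of the Galois map.

The left-handed statements are the right-handed ones for the opposite algebra and the co-opposite
coalgebras, with S and T exchanged; this also allows either one-sided flatness assumption to produce
φ. -/

namespace HopfGal

/-! ### Hopf modules over a ring with a twisted coaction -/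

section HopfModules

variable {k R C : Type u} [Field k] [Ring R] [Algebra k R] [AddCommGroup C] [Module k C]

/-- The action of `R ⊗ End C` on `C ⊗ M`, for an `R`-module `M`. -/
def tensorAct (M : Type u) [AddCommGroup M] [Module k M] [Module R M] [IsScalarTower k R M] :
    R ⊗[k] Module.End k C →ₗ[k] Module.End k (C ⊗[k] M) :=
  TensorProduct.lift (LinearMap.mk₂ k
    (fun r f => TensorProduct.map f (Algebra.lsmul k k M r))
    (fun r s f => by rw [map_add, TensorProduct.map_add_right])
    (fun c r f => by rw [map_smul, TensorProduct.map_smul_right])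
    (fun r f g => by rw [TensorProduct.map_add_left])
    (fun c r f => by rw [TensorProduct.map_smul_left]))

theorem tensorAct_tmul_apply {M : Type u} [AddCommGroup M] [Module k M] [Module R M]
    [IsScalarTower k R M] (r : R) (f : Module.End k C) (x : C ⊗[k] M) :
    tensorAct M (r ⊗ₜ[k] f) x = TensorProduct.map f (Algebra.lsmul k k M r) x := rfl

theorem tensorAct_lTensor {M M' : Type u} [AddCommGroup M] [Module k M] [Module R M]
    [IsScalarTower k R M] [AddCommGroup M'] [Module k M'] [Module R M']
    [IsScalarTower k R M'] (f : M →ₗ[R] M') (t : R ⊗[k] Module.End k C) (x : C ⊗[k] M) :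
    (f.restrictScalars k).lTensor C (tensorAct M t x) =
      tensorAct M' t ((f.restrictScalars k).lTensor C x) := by
  induction t using TensorProduct.induction_on with
  | zero => simp
  | add a b ha hb => simp only [map_add, LinearMap.add_apply, ha, hb]
  | tmul r g =>
    induction x using TensorProduct.induction_on with
    | zero => simp
    | add a b ha hb => simp only [map_add, ha, hb]
    | tmul c m => simp [tensorAct_tmul_apply]

theorem IsLeftColinear.comp {M M' M'' : Type u} [AddCommGroup M] [Module k M] [AddCommGroup M']
    [Module k M'] [AddCommGroup M''] [Module k M''] {ρ : M →ₗ[k] C ⊗[k] M}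
    {ρ' : M' →ₗ[k] C ⊗[k] M'} {ρ'' : M'' →ₗ[k] C ⊗[k] M''} {f : M →ₗ[k] M'} {g : M' →ₗ[k] M''}
    (hf : IsLeftColinear ρ ρ' f) (hg : IsLeftColinear ρ' ρ'' g) :
    IsLeftColinear ρ ρ'' (g ∘ₗ f) := by
  unfold IsLeftColinear at *
  rw [← LinearMap.comp_assoc, hg, LinearMap.lTensor_comp, LinearMap.comp_assoc,
    LinearMap.comp_assoc, hf]

theorem IsLeftColinear.lTensor_lTensor_apply {M M' : Type u} [AddCommGroup M] [Module k M]
    [AddCommGroup M'] [Module k M'] {ρ : M →ₗ[k] C ⊗[k] M} {ρ' : M' →ₗ[k] C ⊗[k] M'}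
    {f : M →ₗ[k] M'} (hρ : IsLeftColinear ρ ρ' f) (m : M) :
    (f.lTensor C).lTensor C (ρ.lTensor C (ρ m)) = ρ'.lTensor C (ρ' (f m)) := by
  have h1 := LinearMap.congr_fun hρ m
  rw [LinearMap.comp_apply, LinearMap.comp_apply] at h1
  rw [h1, ← LinearMap.comp_apply (ρ'.lTensor C), ← LinearMap.lTensor_comp,
    ← LinearMap.comp_apply (f.lTensor C |>.lTensor C), ← LinearMap.lTensor_comp, hρ]

section Costable

variable {M M' : Type u} [AddCommGroup M] [Module k M] [Module R M] [IsScalarTower k R M]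
  [AddCommGroup M'] [Module k M'] [Module R M'] [IsScalarTower k R M']
  {ρ : M →ₗ[k] C ⊗[k] M} {ρ' : M' →ₗ[k] C ⊗[k] M'}

/-- The submodule `L` of the Hopf module `(M, ρ)` is stable under the coaction. -/
def IsCostable (ρ : M →ₗ[k] C ⊗[k] M) (L : Submodule R M) : Prop :=
  ∀ x ∈ L, ρ x ∈ LinearMap.range ((L.subtype.restrictScalars k).lTensor C)

/-- Tensoring over a field is exact, so the kernel of C ⊗ f is the image of C ⊗ ker f. -/
theorem isCostable_ker_of_colinear (f : M →ₗ[R] M')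
    (hf : IsLeftColinear ρ ρ' (f.restrictScalars k)) :
    IsCostable ρ (LinearMap.ker f) := by
  intro x hx
  have h1 := Module.Flat.lTensor_exact C (LinearMap.exact_subtype_ker_map (f.restrictScalars k))
  have h2 : (f.restrictScalars k).lTensor C (ρ x) = 0 := by
    rw [← LinearMap.comp_apply, ← hf, LinearMap.comp_apply]
    rw [LinearMap.mem_ker] at hx
    simp [hx]
  exact (h1 _).1 h2

theorem isCostable_range_of_colinear (f : M →ₗ[R] M')
    (hf : IsLeftColinear ρ ρ' (f.restrictScalars k)) :
    IsCostable ρ' (LinearMap.range f) := by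
  rintro _ ⟨x, rfl⟩
  have h2 := LinearMap.congr_fun hf x
  refine ⟨(f.rangeRestrict.restrictScalars k).lTensor C (ρ x), ?_⟩
  rw [← LinearMap.comp_apply, ← LinearMap.lTensor_comp]
  exact h2.symm

theorem IsCostable.sup {L L' : Submodule R M} (hL : IsCostable ρ L) (hL' : IsCostable ρ L') :
    IsCostable ρ (L ⊔ L') := by
  have mono : ∀ {N : Submodule R M}, N ≤ L ⊔ L' →
      LinearMap.range ((N.subtype.restrictScalars k).lTensor C) ≤
        LinearMap.range (((L ⊔ L').subtype.restrictScalars k).lTensor C) := by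
    rintro N hN _ ⟨t, rfl⟩
    refine ⟨((Submodule.inclusion hN).restrictScalars k).lTensor C t, ?_⟩
    rw [← LinearMap.comp_apply, ← LinearMap.lTensor_comp]
    rfl
  intro x hx
  obtain ⟨y, hy, z, hz, rfl⟩ := Submodule.mem_sup.1 hx
  rw [map_add]
  exact add_mem (mono le_sup_left (hL y hy)) (mono le_sup_right (hL' z hz))

end Costable

variable [Coalgebra k C]

/-- `ρ` makes the `R`-module `M` a left `C`-comodule compatibly with the twisting `τ` of `R`. -/
structure IsHopfModule (τ : R →ₗ[k] R ⊗[k] Module.End k C) {M : Type u} [AddCommGroup M]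
    [Module k M] [Module R M] [IsScalarTower k R M] (ρ : M →ₗ[k] C ⊗[k] M) : Prop where
  isLeftCoaction : IsLeftCoaction ρ
  map_smul : ∀ (r : R) (m : M), ρ (r • m) = tensorAct M (τ r) (ρ m)

/-- Coinvariants lift along surjections of Hopf modules. -/
def LiftsCoinvariants (τ : R →ₗ[k] R ⊗[k] Module.End k C) (e : C) : Prop :=
  ∀ (M M' : Type u) [AddCommGroup M] [Module k M] [Module R M] [IsScalarTower k R M]
    [AddCommGroup M'] [Module k M'] [Module R M'] [IsScalarTower k R M']
    (ρ : M →ₗ[k] C ⊗[k] M) (ρ' : M' →ₗ[k] C ⊗[k] M'),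
    IsHopfModule τ ρ → IsHopfModule τ ρ' → ∀ f : M →ₗ[R] M',
    IsLeftColinear ρ ρ' (f.restrictScalars k) → Function.Surjective f →
    ∀ m' : M', ρ' m' = e ⊗ₜ[k] m' → ∃ m : M, ρ m = e ⊗ₜ[k] m ∧ f m = m'

/-- A Hopf module without nonzero coinvariants vanishes. -/
def DetectsZero (τ : R →ₗ[k] R ⊗[k] Module.End k C) (e : C) : Prop :=
  ∀ (M : Type u) [AddCommGroup M] [Module k M] [Module R M] [IsScalarTower k R M]
    (ρ : M →ₗ[k] C ⊗[k] M), IsHopfModule τ ρ →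
    (∀ m : M, ρ m = e ⊗ₜ[k] m → m = 0) → ∀ m : M, m = 0

variable {τ : R →ₗ[k] R ⊗[k] Module.End k C} {e : C}

theorem lTensor_lTensor_assoc_rTensor_comul {M M' : Type u} [AddCommGroup M] [Module k M]
    [AddCommGroup M'] [Module k M'] (f : M →ₗ[k] M') (t : C ⊗[k] M) :
    (f.lTensor C).lTensor C (TensorProduct.assoc k C C M
      ((Coalgebra.comul (R := k) (A := C)).rTensor M t)) =
    TensorProduct.assoc k C C M'
      ((Coalgebra.comul (R := k) (A := C)).rTensor M' (f.lTensor C t)) := by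
  induction t using TensorProduct.induction_on with
  | zero => simp
  | add a b ha hb => simp only [map_add, ha, hb]
  | tmul c m =>
    simp only [LinearMap.rTensor_tmul, LinearMap.lTensor_tmul]
    induction Coalgebra.comul (R := k) c using TensorProduct.induction_on with
    | zero => simp
    | tmul a b => simp
    | add a b ha hb => simp only [TensorProduct.add_tmul, map_add, ha, hb]

theorem lid_rTensor_counit_lTensor {M M' : Type u} [AddCommGroup M] [Module k M]
    [AddCommGroup M'] [Module k M'] (f : M →ₗ[k] M') (t : C ⊗[k] M) :
    f (TensorProduct.lid k M ((Coalgebra.counit (R := k) (A := C)).rTensor M t)) =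
    TensorProduct.lid k M' ((Coalgebra.counit (R := k) (A := C)).rTensor M' (f.lTensor C t)) := by
  induction t using TensorProduct.induction_on with
  | zero => simp
  | add a b ha hb => simp only [map_add, ha, hb]
  | tmul c m => simp

theorem IsLeftCoaction.of_injective {M M' : Type u} [AddCommGroup M] [Module k M]
    [AddCommGroup M'] [Module k M'] {ρ : M →ₗ[k] C ⊗[k] M} {ρ' : M' →ₗ[k] C ⊗[k] M'}
    (h : IsLeftCoaction ρ') (f : M →ₗ[k] M') (hf : Function.Injective f)
    (hρ : IsLeftColinear ρ ρ' f) : IsLeftCoaction ρ where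
  coassoc := by
    have h1 : Function.Injective ((f.lTensor C).lTensor C) :=
      Module.Flat.lTensor_preserves_injective_linearMap _
        (Module.Flat.lTensor_preserves_injective_linearMap _ hf)
    ext m
    apply h1
    have h2 := LinearMap.congr_fun hρ m
    have h3 := LinearMap.congr_fun h.coassoc (f m)
    simp only [LinearMap.comp_apply, LinearEquiv.coe_coe] at h2 h3 ⊢
    rw [hρ.lTensor_lTensor_apply, lTensor_lTensor_assoc_rTensor_comul, h3, h2]
  counit := by
    ext m
    apply hf
    have h2 := LinearMap.congr_fun hρ m
    have h3 := LinearMap.congr_fun h.counit (f m)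
    simp only [LinearMap.comp_apply, LinearEquiv.coe_coe] at h2 h3 ⊢
    rw [lid_rTensor_counit_lTensor, ← h2, h3]
    rfl

theorem IsLeftColinear.coassoc_apply {M M' : Type u} [AddCommGroup M] [Module k M]
    [AddCommGroup M'] [Module k M'] {ρ : M →ₗ[k] C ⊗[k] M} {ρ' : M' →ₗ[k] C ⊗[k] M'}
    {f : M →ₗ[k] M'} (hρ : IsLeftColinear ρ ρ' f) (h : IsLeftCoaction ρ) (m : M) :
    ρ'.lTensor C (ρ' (f m)) = TensorProduct.assoc k C C M'
      ((Coalgebra.comul (R := k) (A := C)).rTensor M' (ρ' (f m))) := by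
  have h2 := LinearMap.congr_fun hρ m
  have h3 := LinearMap.congr_fun h.coassoc m
  simp only [LinearMap.comp_apply, LinearEquiv.coe_coe] at h2 h3
  rw [← hρ.lTensor_lTensor_apply, h3, lTensor_lTensor_assoc_rTensor_comul, h2]

theorem IsLeftColinear.counit_apply {M M' : Type u} [AddCommGroup M] [Module k M]
    [AddCommGroup M'] [Module k M'] {ρ : M →ₗ[k] C ⊗[k] M} {ρ' : M' →ₗ[k] C ⊗[k] M'}
    {f : M →ₗ[k] M'} (hρ : IsLeftColinear ρ ρ' f) (h : IsLeftCoaction ρ) (m : M) :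
    TensorProduct.lid k M' ((Coalgebra.counit (R := k) (A := C)).rTensor M' (ρ' (f m))) =
      f m := by
  have h2 := LinearMap.congr_fun hρ m
  have h3 := LinearMap.congr_fun h.counit m
  simp only [LinearMap.comp_apply, LinearEquiv.coe_coe] at h2 h3
  rw [h2, ← lid_rTensor_counit_lTensor, h3]
  rfl

theorem IsLeftCoaction.of_surjective {M M' : Type u} [AddCommGroup M] [Module k M]
    [AddCommGroup M'] [Module k M'] {ρ : M →ₗ[k] C ⊗[k] M} {ρ' : M' →ₗ[k] C ⊗[k] M'}
    (h : IsLeftCoaction ρ) (f : M →ₗ[k] M') (hf : Function.Surjective f)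
    (hρ : IsLeftColinear ρ ρ' f) : IsLeftCoaction ρ' where
  coassoc := by
    ext m
    obtain ⟨m, rfl⟩ := hf m
    exact hρ.coassoc_apply h m
  counit := by
    ext m
    obtain ⟨m, rfl⟩ := hf m
    exact hρ.counit_apply h m

section Modules

variable {M M' : Type u} [AddCommGroup M] [Module k M] [Module R M] [IsScalarTower k R M]
  [AddCommGroup M'] [Module k M'] [Module R M'] [IsScalarTower k R M']
  {ρ : M →ₗ[k] C ⊗[k] M} {ρ' : M' →ₗ[k] C ⊗[k] M'}

theorem IsHopfModule.of_injective (h : IsHopfModule τ ρ') (f : M →ₗ[R] M')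
    (hf : Function.Injective f)
    (hρ : IsLeftColinear ρ ρ' (f.restrictScalars k)) :
    IsHopfModule τ ρ where
  isLeftCoaction := h.isLeftCoaction.of_injective (f.restrictScalars k) hf hρ
  map_smul r m := by
    have h1 : Function.Injective ((f.restrictScalars k).lTensor C) :=
      Module.Flat.lTensor_preserves_injective_linearMap _ hf
    apply h1
    have h2 := fun x => (LinearMap.congr_fun hρ x).symm
    simp only [LinearMap.comp_apply] at h2
    rw [tensorAct_lTensor, h2, h2]
    simp [h.map_smul]

theorem IsHopfModule.of_surjective (h : IsHopfModule τ ρ) (f : M →ₗ[R] M')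
    (hf : Function.Surjective f)
    (hρ : IsLeftColinear ρ ρ' (f.restrictScalars k)) :
    IsHopfModule τ ρ' where
  isLeftCoaction := h.isLeftCoaction.of_surjective (f.restrictScalars k) hf hρ
  map_smul r m := by
    obtain ⟨m, rfl⟩ := hf m
    have h2 := LinearMap.congr_fun hρ
    simp only [LinearMap.comp_apply, LinearMap.restrictScalars_apply] at h2
    rw [← LinearMap.map_smul, h2, h2, h.map_smul, tensorAct_lTensor]

/-- A k-linear retraction M → L turns the containment of ρ(L) in the image of C ⊗ L into an actual
map L → C ⊗ L. The axioms are inherited because C ⊗ L → C ⊗ M is injective. -/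
theorem IsCostable.exists_coaction {L : Submodule R M} (hL : IsCostable ρ L)
    (h : IsHopfModule τ ρ) : ∃ ρL : L →ₗ[k] C ⊗[k] L, IsHopfModule τ ρL ∧
      ρ ∘ₗ L.subtype.restrictScalars k = (L.subtype.restrictScalars k).lTensor C ∘ₗ ρL := by
  obtain ⟨p, hp⟩ := (L.subtype.restrictScalars k).exists_leftInverse_of_injective
    (LinearMap.ker_eq_bot.2 L.injective_subtype)
  have key : ρ ∘ₗ L.subtype.restrictScalars k = (L.subtype.restrictScalars k).lTensor C ∘ₗ
      (p.lTensor C ∘ₗ ρ ∘ₗ L.subtype.restrictScalars k) := by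
    ext x
    obtain ⟨t, ht⟩ := hL x x.2
    change ρ x = (L.subtype.restrictScalars k).lTensor C (p.lTensor C (ρ x))
    rw [← ht, ← LinearMap.comp_apply (p.lTensor C), ← LinearMap.lTensor_comp, hp]
    simp
  exact ⟨_, h.of_injective L.subtype L.injective_subtype key, key⟩

/-- The quotient coaction is defined through a k-linear section s of f. It is compatible with f
because s(f(x)) − x lies in the costable kernel, whose coaction dies under C ⊗ f. -/
theorem IsCostable.exists_coaction_of_surjective (h : IsHopfModule τ ρ) (f : M →ₗ[R] M')
    (hf : Function.Surjective f) (hK : IsCostable ρ (LinearMap.ker f)) :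
    ∃ ρ' : M' →ₗ[k] C ⊗[k] M', IsHopfModule τ ρ' ∧
      IsLeftColinear ρ ρ' (f.restrictScalars k) := by
  obtain ⟨s, hs⟩ := (f.restrictScalars k).exists_rightInverse_of_surjective
    (LinearMap.range_eq_top.2 hf)
  have key : ((f.restrictScalars k).lTensor C ∘ₗ ρ ∘ₗ s) ∘ₗ f.restrictScalars k =
      (f.restrictScalars k).lTensor C ∘ₗ ρ := by
    ext x
    have h1 : s (f x) - x ∈ LinearMap.ker f := by
      rw [LinearMap.mem_ker, map_sub, sub_eq_zero]
      exact LinearMap.congr_fun hs (f x)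
    obtain ⟨t, ht⟩ := hK _ h1
    rw [map_sub] at ht
    have h2 : (f.restrictScalars k).lTensor C (ρ (s (f x)) - ρ x) = 0 := by
      rw [← ht, ← LinearMap.comp_apply, ← LinearMap.lTensor_comp]
      have : f.restrictScalars k ∘ₗ (LinearMap.ker f).subtype.restrictScalars k = 0 := by
        ext y; exact y.2
      rw [this]; simp
    rw [map_sub, sub_eq_zero] at h2
    exact h2
  exact ⟨_, h.of_surjective f hf key, key⟩

/-- The range of f is a Hopf submodule, so the lifting property applies to M → range f. -/
theorem LiftsCoinvariants.of_mem_range (F1 : LiftsCoinvariants τ e) (h : IsHopfModule τ ρ)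
    (h' : IsHopfModule τ ρ') (f : M →ₗ[R] M')
    (hf : IsLeftColinear ρ ρ' (f.restrictScalars k)) (m' : M')
    (hm' : m' ∈ LinearMap.range f) (hc : ρ' m' = e ⊗ₜ[k] m') :
    ∃ m : M, ρ m = e ⊗ₜ[k] m ∧ f m = m' := by
  obtain ⟨ρL, hL, hρL⟩ := (isCostable_range_of_colinear f hf).exists_coaction h'
  have inj : Function.Injective (((LinearMap.range f).subtype.restrictScalars k).lTensor C) :=
    Module.Flat.lTensor_preserves_injective_linearMap _ (LinearMap.range f).injective_subtype
  have hcol : ρL ∘ₗ f.rangeRestrict.restrictScalars k =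
      (f.rangeRestrict.restrictScalars k).lTensor C ∘ₗ ρ := by
    apply (LinearMap.cancel_left inj).1
    rw [← LinearMap.comp_assoc, ← hρL, ← LinearMap.comp_assoc, ← LinearMap.lTensor_comp]
    exact hf
  obtain ⟨m, hm, hfm⟩ := F1 M _ ρ ρL h hL f.rangeRestrict hcol f.surjective_rangeRestrict
    ⟨m', hm'⟩ (inj (by
      have := LinearMap.congr_fun hρL ⟨m', hm'⟩
      rw [LinearMap.comp_apply, LinearMap.comp_apply] at this
      rw [← this]
      simpa using hc))
  exact ⟨m, hm, congrArg Subtype.val hfm⟩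

/-- Coinvariants modulo a costable submodule `N` lift. -/
theorem LiftsCoinvariants.exists_sub_mem (F1 : LiftsCoinvariants τ e) (h : IsHopfModule τ ρ)
    (h' : IsHopfModule τ ρ') (f : M →ₗ[R] M')
    (hf : IsLeftColinear ρ ρ' (f.restrictScalars k))
    {N : Submodule R M'} (hN : IsCostable ρ' N) (m' : M')
    (hm' : m' ∈ LinearMap.range f ⊔ N)
    (hc : ((N.mkQ).restrictScalars k).lTensor C (ρ' m') = e ⊗ₜ[k] N.mkQ m') :
    ∃ m : M, ρ m = e ⊗ₜ[k] m ∧ f m - m' ∈ N := by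
  obtain ⟨ρQ, hQ, hρQ⟩ := IsCostable.exists_coaction_of_surjective h' N.mkQ N.mkQ_surjective
    (by rwa [Submodule.ker_mkQ])
  obtain ⟨m, hm, hfm⟩ := F1.of_mem_range h hQ (N.mkQ ∘ₗ f) (by
    exact IsLeftColinear.comp (g := N.mkQ.restrictScalars k) hf hρQ) (N.mkQ m') (by
    obtain ⟨_, ⟨x, rfl⟩, z, hz, rfl⟩ := Submodule.mem_sup.1 hm'
    refine ⟨x, ?_⟩
    rw [map_add, show N.mkQ z = 0 from (Submodule.Quotient.mk_eq_zero N).2 hz, add_zero]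
    rfl) (by
    rw [← hc]
    exact LinearMap.congr_fun hρQ m')
  exact ⟨m, hm, (Submodule.Quotient.eq N).1 hfm⟩

/-- A costable submodule whose coinvariants lie in the costable submodule `N` lies in `N`. -/
theorem DetectsZero.le_of_coinvariants (F2 : DetectsZero τ e) (F1 : LiftsCoinvariants τ e)
    (h : IsHopfModule τ ρ) {N L : Submodule R M} (hN : IsCostable ρ N) (hL : IsCostable ρ L)
    (hNL : ∀ p ∈ L, ρ p = e ⊗ₜ[k] p → p ∈ N) : L ≤ N := by
  obtain ⟨ρL, hρL, hcL⟩ := hL.exists_coaction h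
  obtain ⟨ρQ, hQ, hρQ⟩ := IsCostable.exists_coaction_of_surjective h N.mkQ N.mkQ_surjective
    (by rwa [Submodule.ker_mkQ])
  have hg : IsLeftColinear ρL ρQ ((N.mkQ ∘ₗ L.subtype).restrictScalars k) :=
    IsLeftColinear.comp (f := L.subtype.restrictScalars k) (g := N.mkQ.restrictScalars k) hcL hρQ
  obtain ⟨ρW, hW, hρW⟩ := (isCostable_range_of_colinear _ hg).exists_coaction hQ
  have inj : Function.Injective
      (((LinearMap.range (N.mkQ ∘ₗ L.subtype)).subtype.restrictScalars k).lTensor C) :=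
    Module.Flat.lTensor_preserves_injective_linearMap _
      (LinearMap.range (N.mkQ ∘ₗ L.subtype)).injective_subtype
  -- The image of L in M/N is a Hopf module. Its coinvariants lift to coinvariants of L, which lie
  -- in N by assumption, so they vanish, and with them the whole image.
  have zero := F2 _ ρW hW (by
    rintro ⟨w, hw⟩ hcw
    have hcw' : ρQ w = e ⊗ₜ[k] w := by
      have h1 := LinearMap.congr_fun hρW ⟨w, hw⟩
      rw [LinearMap.comp_apply, LinearMap.comp_apply, hcw] at h1
      simpa using h1
    obtain ⟨p, hp, hpw⟩ := F1.of_mem_range hρL hQ _ hg w hw hcw'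
    have hp' : ρ p = e ⊗ₜ[k] (p : M) := by
      have h1 := LinearMap.congr_fun hcL p
      rw [LinearMap.comp_apply, LinearMap.comp_apply, hp] at h1
      simpa using h1
    have h2 := hNL p p.2 hp'
    exact Subtype.ext (hpw.symm.trans ((Submodule.Quotient.mk_eq_zero N).2 h2)))
  intro x hx
  have := zero ⟨N.mkQ x, ⟨⟨x, hx⟩, rfl⟩⟩
  exact (Submodule.Quotient.mk_eq_zero N).1 (congrArg Subtype.val this)

end Modules

end HopfModules

/-! ### Free Hopf modules R ⊗ X -/

section FreeHopfModules

variable {k R C : Type u} [Field k] [Ring R] [Algebra k R] [AddCommGroup C] [Module k C]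

/-- The map `r ↦ r ⊗ x`. -/
def tmulRight (k R : Type u) [Field k] [Ring R] [Algebra k R] {X : Type u} [AddCommGroup X]
    [Module k X] (x : X) : R →ₗ[R] R ⊗[k] X where
  toFun r := r ⊗ₜ[k] x
  map_add' r s := TensorProduct.add_tmul r s x
  map_smul' _ _ := rfl

/-- The coaction on `R ⊗ X` induced by a coaction on `R`. -/
def tensorCoaction (ρ : R →ₗ[k] C ⊗[k] R) (X : Type u) [AddCommGroup X] [Module k X] :
    R ⊗[k] X →ₗ[k] C ⊗[k] (R ⊗[k] X) :=
  (TensorProduct.assoc k C R X).toLinearMap ∘ₗ ρ.rTensor X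

variable {ρ : R →ₗ[k] C ⊗[k] R}

theorem tensorCoaction_tmul {X : Type u} [AddCommGroup X] [Module k X] (r : R) (x : X) :
    tensorCoaction ρ X (r ⊗ₜ[k] x) =
      ((tmulRight k R x).restrictScalars k).lTensor C (ρ r) := by
  change TensorProduct.assoc k C R X (ρ r ⊗ₜ[k] x) = _
  induction ρ r using TensorProduct.induction_on with
  | zero => simp
  | add a b ha hb => rw [TensorProduct.add_tmul, map_add, ha, hb, map_add]
  | tmul c s => rfl

theorem isLeftColinear_tmulRight {X : Type u} [AddCommGroup X] [Module k X] (x : X) :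
    IsLeftColinear ρ (tensorCoaction ρ X) ((tmulRight k R x).restrictScalars k) :=
  LinearMap.ext fun r => tensorCoaction_tmul r x

/-- R ⊗ X is spanned by the copies r ↦ r ⊗ x of R, and its coaction restricts to that of R on each
of them. -/
theorem isLeftColinear_of_tmulRight {X M : Type u} [AddCommGroup X] [Module k X]
    [AddCommGroup M] [Module k M] {ρ' : M →ₗ[k] C ⊗[k] M} {f : R ⊗[k] X →ₗ[k] M}
    (h : ∀ x : X, IsLeftColinear ρ ρ' (f ∘ₗ (tmulRight k R x).restrictScalars k)) :
    IsLeftColinear (tensorCoaction ρ X) ρ' f := by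
  apply TensorProduct.ext'
  intro r x
  rw [LinearMap.comp_apply, LinearMap.comp_apply, tensorCoaction_tmul, ← LinearMap.comp_apply,
    ← LinearMap.comp_apply, ← LinearMap.lTensor_comp]
  exact LinearMap.congr_fun (h x) r

variable [Coalgebra k C] {τ : R →ₗ[k] R ⊗[k] Module.End k C} {e : C}

theorem IsHopfModule.tensor (h : IsHopfModule τ ρ) (X : Type u) [AddCommGroup X] [Module k X] :
    IsHopfModule τ (tensorCoaction ρ X) where
  isLeftCoaction := {
    coassoc := TensorProduct.ext' fun r x =>
      (isLeftColinear_tmulRight x).coassoc_apply h.isLeftCoaction r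
    counit := TensorProduct.ext' fun r x =>
      (isLeftColinear_tmulRight x).counit_apply h.isLeftCoaction r }
  map_smul r m := by
    induction m using TensorProduct.induction_on with
    | zero => simp
    | add a b ha hb => rw [smul_add, map_add, ha, hb, map_add, map_add]
    | tmul s x =>
      rw [tensorCoaction_tmul, ← tensorAct_lTensor, ← h.map_smul, ← tensorCoaction_tmul]
      rfl

end FreeHopfModules

section CanonicalMap

variable {k R C : Type u} [Field k] [Ring R] [Algebra k R] [AddCommGroup C] [Module k C]
  {ρ : R →ₗ[k] C ⊗[k] R}

/-- The map `R ⊗ R → C ⊗ R`, `r ⊗ x ↦ r₋₁ ⊗ r₀ x`. -/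
def canonicalMap (ρ : R →ₗ[k] C ⊗[k] R) : R ⊗[k] R →ₗ[k] C ⊗[k] R :=
  (LinearMap.mul' k R).lTensor C ∘ₗ tensorCoaction ρ R

theorem canonicalMap_tmul (r x : R) : canonicalMap ρ (r ⊗ₜ[k] x) =
    (LinearMap.mulRight k x).lTensor C (ρ r) := by
  rw [canonicalMap, LinearMap.comp_apply, tensorCoaction_tmul, ← LinearMap.comp_apply,
    ← LinearMap.lTensor_comp]
  rfl

end CanonicalMap

/-! ### Relations of R ⊗_B X as an R-submodule of R ⊗ X -/

section Balanced

variable {k R C : Type u} [Field k] [Ring R] [Algebra k R] [AddCommGroup C] [Module k C]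
  {B : Subalgebra k R}

/-- The action `B ⊗ X → X`. -/
def actMap (B : Subalgebra k R) (X : Type u) [AddCommGroup X] [Module k X] [Module B X]
    [IsScalarTower k B X] : B ⊗[k] X →ₗ[k] X :=
  TensorProduct.lift (Algebra.lsmul k k X : B →ₐ[k] Module.End k X).toLinearMap

theorem actMap_tmul {X : Type u} [AddCommGroup X] [Module k X] [Module B X]
    [IsScalarTower k B X] (b : B) (x : X) : actMap B X (b ⊗ₜ[k] x) = b • x := rfl

/-- The map `r ⊗ b ⊗ x ↦ r b ⊗ x - r ⊗ b x`, whose range consists of the relations of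
`R ⊗_B X`. -/
def relMap (B : Subalgebra k R) (X : Type u) [AddCommGroup X] [Module k X] [Module B X]
    [IsScalarTower k B X] : R ⊗[k] (B ⊗[k] X) →ₗ[R] R ⊗[k] X where
  __ := (LinearMap.mul' k R ∘ₗ B.val.toLinearMap.lTensor R).rTensor X ∘ₗ
      (TensorProduct.assoc k R B X).symm.toLinearMap - (actMap B X).lTensor R
  map_smul' r p := by
    change ((LinearMap.mul' k R ∘ₗ B.val.toLinearMap.lTensor R).rTensor X ∘ₗ
      (TensorProduct.assoc k R B X).symm.toLinearMap - (actMap B X).lTensor R) (r • p) =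
      r • ((LinearMap.mul' k R ∘ₗ B.val.toLinearMap.lTensor R).rTensor X ∘ₗ
      (TensorProduct.assoc k R B X).symm.toLinearMap - (actMap B X).lTensor R) p
    induction p using TensorProduct.induction_on with
    | zero => simp
    | add a b ha hb => rw [smul_add, map_add, ha, hb, map_add, smul_add]
    | tmul s t =>
      induction t using TensorProduct.induction_on with
      | zero => simp
      | add a b ha hb => rw [TensorProduct.tmul_add, smul_add, map_add, ha, hb, map_add, smul_add]
      | tmul b x => simp [TensorProduct.smul_tmul', smul_sub, mul_assoc]

theorem relMap_tmul {X : Type u} [AddCommGroup X] [Module k X] [Module B X]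
    [IsScalarTower k B X] (r : R) (b : B) (x : X) :
    relMap B X (r ⊗ₜ[k] (b ⊗ₜ[k] x)) = (r * b) ⊗ₜ[k] x - r ⊗ₜ[k] (b • x) := rfl

/-- The relations of `R ⊗_B X`, as an `R`-submodule. -/
def relSub (B : Subalgebra k R) (X : Type u) [AddCommGroup X] [Module k X] [Module B X]
    [IsScalarTower k B X] : Submodule R (R ⊗[k] X) := LinearMap.range (relMap B X)

/-- Writing the relations as the range of an R-linear map gives them an R-module structure and, once
that map is colinear, costability. -/
theorem mem_relSub {X : Type u} [AddCommGroup X] [Module k X] [Module B X]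
    [IsScalarTower k B X] {p : R ⊗[k] X} : p ∈ relSub B X ↔ p ∈ balancedRel k B R X := by
  constructor
  · rintro ⟨q, rfl⟩
    induction q using TensorProduct.induction_on with
    | zero => rw [map_zero]; exact zero_mem _
    | add a b ha hb => rw [map_add]; exact add_mem ha hb
    | tmul s t =>
      induction t using TensorProduct.induction_on with
      | zero => rw [TensorProduct.tmul_zero, map_zero]; exact zero_mem _
      | add a b ha hb => rw [TensorProduct.tmul_add, map_add]; exact add_mem ha hb
      | tmul b x => exact Submodule.subset_span ⟨s, b, x, rfl⟩
  · intro hp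
    have : balancedRel k B R X ≤ (relSub B X).restrictScalars k := by
      unfold balancedRel
      rw [Submodule.span_le]
      rintro _ ⟨r, b, x, rfl⟩
      exact ⟨r ⊗ₜ[k] (b ⊗ₜ[k] x), rfl⟩
    exact this hp

/-- The coinvariants of R ⊗ X will turn out to be B ⊗ X; modulo the relations such elements reduce
to 1 ⊗ x. -/
theorem tmul_sub_one_tmul_mem_relSub {X : Type u} [AddCommGroup X] [Module k X] [Module B X]
    [IsScalarTower k B X] (t : B ⊗[k] X) :
    B.val.toLinearMap.rTensor X t - 1 ⊗ₜ[k] actMap B X t ∈ relSub B X := by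
  induction t using TensorProduct.induction_on with
  | zero => simp
  | add a b ha hb =>
    rw [map_add, map_add, TensorProduct.tmul_add, add_sub_add_comm]
    exact add_mem ha hb
  | tmul b x =>
    refine ⟨1 ⊗ₜ[k] (b ⊗ₜ[k] x), ?_⟩
    rw [relMap_tmul, one_mul]
    rfl

section Map

variable {X Y Z : Type u} [AddCommGroup X] [Module k X] [Module B X] [IsScalarTower k B X]
  [AddCommGroup Y] [Module k Y] [Module B Y] [IsScalarTower k B Y]
  [AddCommGroup Z] [Module k Z] [Module B Z] [IsScalarTower k B Z]

/-- The map `R ⊗ f : R ⊗ X → R ⊗ Y`. -/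
def freeMap (f : X →ₗ[B] Y) : R ⊗[k] X →ₗ[R] R ⊗[k] Y :=
  TensorProduct.AlgebraTensorModule.lTensor R R (f.restrictScalars k)

theorem freeMap_tmul (f : X →ₗ[B] Y) (r : R) (x : X) :
    freeMap f (r ⊗ₜ[k] x) = r ⊗ₜ[k] f x := rfl

theorem isLeftColinear_freeMap (f : X →ₗ[B] Y) {ρ : R →ₗ[k] C ⊗[k] R} :
    IsLeftColinear (tensorCoaction ρ X) (tensorCoaction ρ Y) ((freeMap f).restrictScalars k) :=
  isLeftColinear_of_tmulRight fun x => isLeftColinear_tmulRight (f x)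

theorem freeMap_mem_relSub (f : X →ₗ[B] Y) {p : R ⊗[k] X} (hp : p ∈ relSub B X) :
    freeMap f p ∈ relSub B Y := by
  rw [mem_relSub] at hp
  induction hp using Submodule.span_induction with
  | zero => rw [map_zero]; exact zero_mem _
  | add a b _ _ ha hb => rw [map_add]; exact add_mem ha hb
  | smul c a _ ha =>
    rw [← algebraMap_smul R c a, map_smul]
    exact Submodule.smul_mem _ _ ha
  | mem t ht =>
    obtain ⟨r, b, x, rfl⟩ := ht
    refine ⟨r ⊗ₜ[k] (b ⊗ₜ[k] f x), ?_⟩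
    rw [relMap_tmul, map_sub, freeMap_tmul, freeMap_tmul, map_smul]
    rfl

/-- Exactness over B becomes an equality of submodules of R ⊗ Y, which can be compared through their
coinvariants. -/
theorem exact_balancedMapRight_iff (f : X →ₗ[B] Y) (g : Y →ₗ[B] Z) :
    Function.Exact (balancedMapRight (k := k) R f) (balancedMapRight (k := k) R g) ↔
      (relSub B Z).comap (freeMap g) = LinearMap.range (freeMap f) ⊔ relSub B Y := by
  have h1 : ∀ p : R ⊗[k] Y, balancedMapRight (k := k) R g (Submodule.Quotient.mk p) = 0 ↔
      p ∈ (relSub B Z).comap (freeMap g) := fun p => by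
    rw [Submodule.mem_comap, mem_relSub, ← Submodule.Quotient.mk_eq_zero]
    rfl
  have h2 : ∀ p : R ⊗[k] Y, (Submodule.Quotient.mk p : BalancedTensor k B R Y) ∈
      Set.range (balancedMapRight (k := k) R f) ↔
      p ∈ LinearMap.range (freeMap f) ⊔ relSub B Y := fun p => by
    constructor
    · rintro ⟨q, hq⟩
      obtain ⟨q, rfl⟩ := Submodule.Quotient.mk_surjective _ q
      have hq' : (Submodule.Quotient.mk (freeMap f q) : BalancedTensor k B R Y) =
        Submodule.Quotient.mk p := hq
      rw [eq_comm, Submodule.Quotient.eq, ← mem_relSub] at hq'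
      rw [← add_sub_cancel (freeMap f q) p]
      exact Submodule.add_mem_sup ⟨q, rfl⟩ hq'
    · intro hp
      obtain ⟨_, ⟨q, rfl⟩, z, hz, rfl⟩ := Submodule.mem_sup.1 hp
      refine ⟨Submodule.Quotient.mk q, ?_⟩
      change (Submodule.Quotient.mk (freeMap f q) : BalancedTensor k B R Y) = _
      rw [eq_comm, Submodule.Quotient.eq, ← mem_relSub, add_sub_cancel_left]
      exact hz
  constructor
  · intro h
    ext p
    rw [← h1, ← h2]
    exact h _
  · intro h q
    obtain ⟨p, rfl⟩ := Submodule.Quotient.mk_surjective _ q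
    rw [h1, h2, h]

end Map

end Balanced

/-- The data for a Galois type descent: `R` is a Hopf module over itself with coinvariants `B`,
and Hopf modules are controlled by their coinvariants. -/
structure IsDescentDatum {k R C : Type u} [Field k] [Ring R] [Algebra k R] [AddCommGroup C]
    [Module k C] [Coalgebra k C] (τ : R →ₗ[k] R ⊗[k] Module.End k C) (e : C)
    (ρ : R →ₗ[k] C ⊗[k] R) (B : Subalgebra k R) : Prop where
  isHopfModule : IsHopfModule τ ρ
  mem_iff : ∀ r : R, r ∈ B ↔ ρ r = e ⊗ₜ[k] r
  counit_eq_one : Coalgebra.counit (R := k) e = 1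
  lifts : LiftsCoinvariants τ e
  detects : DetectsZero τ e

/-! ### Faithful flatness and the canonical map from a descent datum -/

namespace IsDescentDatum

variable {k R C : Type u} [Field k] [Ring R] [Algebra k R] [AddCommGroup C] [Module k C]
  [Coalgebra k C] {τ : R →ₗ[k] R ⊗[k] Module.End k C} {e : C} {ρ : R →ₗ[k] C ⊗[k] R}
  {B : Subalgebra k R}

/-- Right multiplication by `b`, as a left `R`-linear map. -/
def mulRightLin (b : R) : R →ₗ[R] R := LinearMap.toSpanSingleton R R b

/-- As ρ(c) = e ⊗ c for c in B, both ρ(rb) and ρ(r) are τ(r) applied to e ⊗ b and e ⊗ 1, and the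
action of τ(r) commutes with C ⊗ g for every R-linear g. -/
theorem isLeftColinear_mulRight (D : IsDescentDatum τ e ρ B) (b : B) :
    IsLeftColinear ρ ρ ((mulRightLin (b : R)).restrictScalars k) := by
  ext r
  have h1 : ρ (1 : R) = e ⊗ₜ[k] 1 := (D.mem_iff 1).1 B.one_mem
  have h2 : ∀ c : B, ρ (r * c) = tensorAct R (τ r) (e ⊗ₜ[k] (c : R)) := fun c => by
    rw [← (D.mem_iff c).1 c.2, ← D.isHopfModule.map_smul, smul_eq_mul]
  have h3 : ρ r = tensorAct R (τ r) (e ⊗ₜ[k] (1 : R)) := by simpa using h2 1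
  change ρ (r * b) = ((mulRightLin (b : R)).restrictScalars k).lTensor C (ρ r)
  rw [h2, h3, tensorAct_lTensor, LinearMap.lTensor_tmul]
  simp [mulRightLin]

section Coinvariants

variable {X : Type u} [AddCommGroup X] [Module k X]

/-- B is the kernel of r ↦ ρ(r) − e ⊗ r, and − ⊗ X is exact over a field. -/
theorem exists_of_coinvariant (D : IsDescentDatum τ e ρ B) {p : R ⊗[k] X}
    (hp : tensorCoaction ρ X p = e ⊗ₜ[k] p) :
    ∃ t : B ⊗[k] X, B.val.toLinearMap.rTensor X t = p := by
  have h1 : Function.Exact B.val.toLinearMap (ρ - TensorProduct.mk k C R e) := fun r => by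
    rw [LinearMap.sub_apply, sub_eq_zero]
    change ρ r = e ⊗ₜ[k] r ↔ _
    rw [← D.mem_iff]
    simp
  apply (Module.Flat.rTensor_exact X h1 p).1
  apply (TensorProduct.assoc k C R X).injective
  rw [map_zero, LinearMap.rTensor_sub, LinearMap.sub_apply, map_sub, sub_eq_zero]
  refine hp.trans ?_
  clear hp
  induction p using TensorProduct.induction_on with
  | zero => simp
  | add a b ha hb => rw [TensorProduct.tmul_add, ha, hb, map_add, map_add]
  | tmul s x => rfl

theorem coaction_one_tmul (D : IsDescentDatum τ e ρ B) (x : X) :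
    tensorCoaction ρ X (1 ⊗ₜ[k] x) = e ⊗ₜ[k] (1 ⊗ₜ[k] x) := by
  rw [tensorCoaction_tmul, (D.mem_iff 1).1 B.one_mem]
  rfl

end Coinvariants

section Modules

variable {X Y Z : Type u} [AddCommGroup X] [Module k X] [Module B X] [IsScalarTower k B X]
  [AddCommGroup Y] [Module k Y] [Module B Y] [IsScalarTower k B Y]
  [AddCommGroup Z] [Module k Z] [Module B Z] [IsScalarTower k B Z]

/-- On R ⊗ b ⊗ x the map is right multiplication by b followed by r ↦ r ⊗ x, minus r ↦ r ⊗ bx; all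
of these are colinear. -/
theorem isLeftColinear_relMap (D : IsDescentDatum τ e ρ B) :
    IsLeftColinear (tensorCoaction ρ (B ⊗[k] X)) (tensorCoaction ρ X)
      ((relMap B X).restrictScalars k) := by
  apply isLeftColinear_of_tmulRight
  intro t
  induction t using TensorProduct.induction_on with
  | zero =>
    have : (relMap B X).restrictScalars k ∘ₗ
        (tmulRight k R (0 : B ⊗[k] X)).restrictScalars k = 0 := by
      ext; simp [tmulRight]
    rw [this]; simp [IsLeftColinear]
  | add a b ha hb =>
    have : (relMap B X).restrictScalars k ∘ₗ (tmulRight k R (a + b)).restrictScalars k =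
        (relMap B X).restrictScalars k ∘ₗ (tmulRight k R a).restrictScalars k +
        (relMap B X).restrictScalars k ∘ₗ (tmulRight k R b).restrictScalars k := by
      ext r; exact congrArg (relMap B X) (TensorProduct.tmul_add r a b) |>.trans (map_add _ _ _)
    unfold IsLeftColinear at *
    rw [this, LinearMap.comp_add, ha, hb, LinearMap.lTensor_add, LinearMap.add_comp]
  | tmul b x =>
    have : (relMap B X).restrictScalars k ∘ₗ (tmulRight k R (b ⊗ₜ[k] x)).restrictScalars k =
        (tmulRight k R x).restrictScalars k ∘ₗ (mulRightLin (b : R)).restrictScalars k -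
        (tmulRight k R (b • x)).restrictScalars k := by
      ext r; exact relMap_tmul r b x
    have h1 := (D.isLeftColinear_mulRight b).comp (isLeftColinear_tmulRight (ρ := ρ) x)
    have h2 := isLeftColinear_tmulRight (ρ := ρ) (b • x)
    unfold IsLeftColinear at *
    rw [this, LinearMap.comp_sub, h1, h2, LinearMap.lTensor_sub, LinearMap.sub_comp]

theorem isCostable_relSub (D : IsDescentDatum τ e ρ B) :
    IsCostable (tensorCoaction ρ X) (relSub B X) :=
  isCostable_range_of_colinear _ D.isLeftColinear_relMap

theorem exists_sub_one_tmul_mem (D : IsDescentDatum τ e ρ B) {p : R ⊗[k] X}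
    (hp : tensorCoaction ρ X p = e ⊗ₜ[k] p) : ∃ x : X, p - 1 ⊗ₜ[k] x ∈ relSub B X := by
  obtain ⟨t, rfl⟩ := D.exists_of_coinvariant hp
  exact ⟨_, tmul_sub_one_tmul_mem_relSub t⟩

/-- The coinvariant 1 ⊗ x lifts along the relation map to a coinvariant of R ⊗ (B ⊗ X), hence to an
element of B ⊗ B ⊗ X. The image of that space lies in B ⊗ X and is killed by the action B ⊗ X → X,
which sends 1 ⊗ x to x. -/
theorem eq_zero_of_one_tmul_mem (D : IsDescentDatum τ e ρ B) {x : X}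
    (hx : 1 ⊗ₜ[k] x ∈ relSub B X) : x = 0 := by
  obtain ⟨q, hq, hqx⟩ := D.lifts.of_mem_range (D.isHopfModule.tensor (B ⊗[k] X))
    (D.isHopfModule.tensor X) (relMap B X) D.isLeftColinear_relMap _ hx (D.coaction_one_tmul x)
  obtain ⟨t, rfl⟩ := D.exists_of_coinvariant hq
  have inj : Function.Injective (B.val.toLinearMap.rTensor X) :=
    Module.Flat.rTensor_preserves_injective_linearMap _ Subtype.val_injective
  have key : ∀ t : B ⊗[k] (B ⊗[k] X), ∃ s : B ⊗[k] X, B.val.toLinearMap.rTensor X s =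
      relMap B X (B.val.toLinearMap.rTensor _ t) ∧ actMap B X s = 0 := fun t => by
    induction t using TensorProduct.induction_on with
    | zero => exact ⟨0, by simp⟩
    | add a b ha hb =>
      obtain ⟨s, hs, hs'⟩ := ha
      obtain ⟨s', hs1, hs1'⟩ := hb
      exact ⟨s + s', by rw [map_add, hs, hs1, map_add, map_add], by rw [map_add, hs', hs1', add_zero]⟩
    | tmul b u =>
      induction u using TensorProduct.induction_on with
      | zero => exact ⟨0, by simp⟩
      | add a c ha hb =>
        obtain ⟨s, hs, hs'⟩ := ha
        obtain ⟨s', hs1, hs1'⟩ := hb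
        exact ⟨s + s', by rw [map_add, hs, hs1, TensorProduct.tmul_add, map_add, map_add],
          by rw [map_add, hs', hs1', add_zero]⟩
      | tmul c y =>
        refine ⟨(b * c) ⊗ₜ[k] y - b ⊗ₜ[k] (c • y), ?_, ?_⟩
        · rw [map_sub]; rfl
        · rw [map_sub, actMap_tmul, actMap_tmul, mul_smul, sub_self]
  obtain ⟨s, hs, hs'⟩ := key t
  have h1 : s = 1 ⊗ₜ[k] x := inj (hs.trans hqx)
  rw [h1, actMap_tmul, one_smul] at hs'
  exact hs'

/-- In R ⊗_B X the submodule L becomes a Hopf submodule whose coinvariants, being classes of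
elements 1 ⊗ x of L, are zero. -/
theorem le_relSub (D : IsDescentDatum τ e ρ B) {L : Submodule R (R ⊗[k] X)}
    (hL : IsCostable (tensorCoaction ρ X) L) (hR : relSub B X ≤ L)
    (h1 : ∀ x : X, 1 ⊗ₜ[k] x ∈ L → x = 0) : L ≤ relSub B X := by
  apply D.detects.le_of_coinvariants D.lifts (D.isHopfModule.tensor X) D.isCostable_relSub hL
  intro p hp hpc
  obtain ⟨x, hx⟩ := D.exists_sub_one_tmul_mem hpc
  have h2 : 1 ⊗ₜ[k] x ∈ L := by
    have := L.sub_mem hp (hR hx)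
    rwa [sub_sub_cancel] at this
  rw [h1 x h2, TensorProduct.tmul_zero, sub_zero] at hx
  exact hx

/-- `R` is faithfully flat over the coinvariants. -/
theorem isRightFaithfullyFlat (D : IsDescentDatum τ e ρ B) : IsRightFaithfullyFlat k B R := by
  intro X Y Z _ _ _ _ _ _ _ _ _ _ _ _ f g
  rw [exact_balancedMapRight_iff]
  constructor
  · intro hfg
    apply le_antisymm
    -- Both sides are costable, so the inclusion is tested on coinvariants. Modulo relations these
    -- are 1 ⊗ y, and then g(y) = 0 because 1 ⊗ g(y) is a relation.
    · apply D.detects.le_of_coinvariants D.lifts (D.isHopfModule.tensor Y)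
      · exact (isCostable_range_of_colinear _ (isLeftColinear_freeMap f)).sup D.isCostable_relSub
      · obtain ⟨ρQ, -, hρQ⟩ := IsCostable.exists_coaction_of_surjective
          (D.isHopfModule.tensor Z) (relSub B Z).mkQ (relSub B Z).mkQ_surjective
          (by rw [Submodule.ker_mkQ]; exact D.isCostable_relSub)
        have := isCostable_ker_of_colinear ((relSub B Z).mkQ ∘ₗ freeMap g)
          (IsLeftColinear.comp (g := (relSub B Z).mkQ.restrictScalars k)
            (isLeftColinear_freeMap g) hρQ)
        rwa [LinearMap.ker_comp, Submodule.ker_mkQ] at this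
      · intro p hp hpc
        obtain ⟨y, hy⟩ := D.exists_sub_one_tmul_mem hpc
        have h1 := freeMap_mem_relSub g hy
        rw [map_sub, freeMap_tmul] at h1
        have h2 := (relSub B Z).sub_mem (Submodule.mem_comap.1 hp) h1
        rw [sub_sub_cancel] at h2
        obtain ⟨x, rfl⟩ := (hfg y).1 (D.eq_zero_of_one_tmul_mem h2)
        rw [← add_sub_cancel (1 ⊗ₜ[k] f x) p]
        exact Submodule.add_mem_sup ⟨1 ⊗ₜ[k] x, rfl⟩ hy
    · apply sup_le
      · rintro _ ⟨p, rfl⟩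
        rw [Submodule.mem_comap]
        have : freeMap g (freeMap f p) = 0 := by
          induction p using TensorProduct.induction_on with
          | zero => simp
          | add a b ha hb => rw [map_add, map_add, ha, hb, add_zero]
          | tmul s x => rw [freeMap_tmul, freeMap_tmul, hfg.apply_apply_eq_zero,
              TensorProduct.tmul_zero]
        rw [this]
        exact zero_mem _
      · exact fun p hp => freeMap_mem_relSub g hp
  · intro h y
    constructor
    · intro hy
      have h1 : 1 ⊗ₜ[k] y ∈ LinearMap.range (freeMap f) ⊔ relSub B Y := by
        rw [← h, Submodule.mem_comap, freeMap_tmul, hy, TensorProduct.tmul_zero]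
        exact zero_mem _
      -- Modulo relations, the coinvariant 1 ⊗ y comes from R ⊗ X, hence from a coinvariant of R ⊗
      -- X, that is from some 1 ⊗ x. Then 1 ⊗ (f(x) − y) is a relation, which forces y = f(x).
      obtain ⟨p, hp, hpy⟩ := D.lifts.exists_sub_mem (D.isHopfModule.tensor X)
        (D.isHopfModule.tensor Y) (freeMap f) (isLeftColinear_freeMap f) D.isCostable_relSub _ h1
        (by rw [D.coaction_one_tmul]; rfl)
      obtain ⟨x, hx⟩ := D.exists_sub_one_tmul_mem hp
      have h2 := (relSub B Y).sub_mem hpy (freeMap_mem_relSub f hx)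
      rw [map_sub, freeMap_tmul, sub_sub_sub_cancel_left, ← TensorProduct.tmul_sub] at h2
      exact ⟨x, sub_eq_zero.1 (D.eq_zero_of_one_tmul_mem h2)⟩
    · rintro ⟨x, rfl⟩
      have h1 : 1 ⊗ₜ[k] f x ∈ (relSub B Z).comap (freeMap g) := by
        rw [h]
        exact Submodule.mem_sup_left ⟨1 ⊗ₜ[k] x, rfl⟩
      exact D.eq_zero_of_one_tmul_mem (Submodule.mem_comap.1 h1)

end Modules

theorem canonicalMap_eq_zero_of_mem (D : IsDescentDatum τ e ρ B) {p : R ⊗[k] R}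
    (hp : p ∈ balancedRel k B R R) : canonicalMap ρ p = 0 := by
  rw [← LinearMap.mem_ker]
  refine (?_ : balancedRel k B R R ≤ LinearMap.ker (canonicalMap ρ)) hp
  unfold balancedRel
  rw [Submodule.span_le]
  rintro _ ⟨r, b, x, rfl⟩
  rw [SetLike.mem_coe, LinearMap.mem_ker, map_sub, sub_eq_zero, canonicalMap_tmul,
    canonicalMap_tmul, op_smul_def, Subalgebra.smul_def, smul_eq_mul]
  have h1 : ρ (r * b) = (LinearMap.mulRight k (b : R)).lTensor C (ρ r) :=
    LinearMap.congr_fun (D.isLeftColinear_mulRight b) r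
  rw [h1, ← LinearMap.comp_apply, ← LinearMap.lTensor_comp]
  congr 2
  ext y
  simp [mul_assoc]

/-- The kernel of the canonical map. -/
theorem mem_balancedRel_iff (D : IsDescentDatum τ e ρ B) (p : R ⊗[k] R) :
    p ∈ balancedRel k B R R ↔ canonicalMap ρ p = 0 := by
  refine ⟨D.canonicalMap_eq_zero_of_mem, fun hp => ?_⟩
  let mulLin : R ⊗[k] R →ₗ[R] R :=
    { LinearMap.mul' k R with
      map_smul' := fun r q => by
        change LinearMap.mul' k R (r • q) = r * LinearMap.mul' k R q
        induction q using TensorProduct.induction_on with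
        | zero => simp
        | add a b ha hb => rw [smul_add, map_add, ha, hb, map_add, mul_add]
        | tmul s x => simp [TensorProduct.smul_tmul', mul_assoc] }
  -- The kernel is stable under R because the canonical map is the coaction followed by C ⊗
  -- (multiplication), and multiplication is left R-linear.
  let L : Submodule R (R ⊗[k] R) :=
    { LinearMap.ker (canonicalMap ρ) with
      smul_mem' := fun r q hq => by
        have hq' : (mulLin.restrictScalars k).lTensor C (tensorCoaction ρ R q) = 0 := hq
        change (mulLin.restrictScalars k).lTensor C (tensorCoaction ρ R (r • q)) = 0
        rw [(D.isHopfModule.tensor R).map_smul, tensorAct_lTensor, hq', map_zero] }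
  -- By flatness it suffices that C ⊗ `canonicalMap ρ` kills the coaction of q; by coassociativity
  -- its value is the comultiplication applied to `canonicalMap ρ q` = 0.
  have hL : IsCostable (tensorCoaction ρ R) L := fun q hq => by
    have hq' : (mulLin.restrictScalars k).lTensor C (tensorCoaction ρ R q) = 0 := hq
    have h1 : Function.Exact (L.subtype.restrictScalars k) (canonicalMap ρ) := fun x => by
      simp only [LinearMap.coe_restrictScalars, Submodule.subtype_apply, Set.mem_range,
        Subtype.exists, exists_prop, exists_eq_right]
      rfl
    refine (Module.Flat.lTensor_exact C h1 _).1 ?_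
    have h2 := LinearMap.congr_fun (D.isHopfModule.tensor R).isLeftCoaction.coassoc q
    simp only [LinearMap.comp_apply, LinearEquiv.coe_coe] at h2
    have h3 := lTensor_lTensor_assoc_rTensor_comul (C := C) (mulLin.restrictScalars k)
      (tensorCoaction ρ R q)
    rw [hq', map_zero, map_zero, ← h2, ← LinearMap.comp_apply, ← LinearMap.lTensor_comp] at h3
    exact h3
  rw [← mem_relSub]
  refine D.le_relSub hL (fun q hq => D.canonicalMap_eq_zero_of_mem (mem_relSub.1 hq))
    (fun x hx => ?_) hp
  -- The canonical image of 1 ⊗ x is e ⊗ x, from which the counit recovers x.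
  have h1 : canonicalMap ρ (1 ⊗ₜ[k] x) = 0 := hx
  rw [canonicalMap_tmul, (D.mem_iff 1).1 B.one_mem, LinearMap.lTensor_tmul] at h1
  have h2 := congrArg (fun t => TensorProduct.lid k R
    ((Coalgebra.counit (R := k) (A := C)).rTensor R t)) h1
  simpa [D.counit_eq_one] using h2

end IsDescentDatum

/-! ### Finite dimensional subcomodules -/

section FiniteSubcomodules

variable {k H : Type u} [Field k] [AddCommGroup H] [Module k H] [Coalgebra k H]

/-- Every element of a coalgebra lies in a finite dimensional right subcomodule. -/
theorem exists_finite_subcomodule_mem (w : H) : ∃ D : Submodule k H, Module.Finite k D ∧ w ∈ D ∧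
    ∀ d ∈ D, Coalgebra.comul (R := k) d ∈ LinearMap.range (D.subtype.rTensor H) := by
  classical
  let b := Module.Basis.ofVectorSpace k H
  obtain ⟨c, hc⟩ := TensorProduct.eq_repr_basis_right b (Coalgebra.comul (R := k) w)
  -- Write Δ(w) = Σ cᵢ ⊗ bᵢ with bᵢ in a basis. The counit puts w in the span of the cᵢ. By
  -- coassociativity Δ(cᵢ) is obtained from Δ(w) by a map on the second factor, so its first factors
  -- stay in that span.
  let D : Submodule k H := Submodule.span k (c.support.image c)
  have hcD : ∀ i, c i ∈ D := fun i => by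
    by_cases hi : i ∈ c.support
    · exact Submodule.subset_span (Finset.mem_coe.2 (Finset.mem_image_of_mem c hi))
    · rw [Finsupp.notMem_support_iff.1 hi]; exact zero_mem _
  have hslice : ∀ f : H →ₗ[k] k,
      TensorProduct.rid k H (f.lTensor H (Coalgebra.comul (R := k) w)) =
        c.sum fun i m => f (b i) • m := fun f => by
    rw [← hc, Finsupp.sum, map_sum, map_sum]
    simp [Finsupp.sum]
  have hcomul : ∀ f : H →ₗ[k] H, f.lTensor H (Coalgebra.comul (R := k) w) ∈
      LinearMap.range (D.subtype.rTensor H) := fun f => by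
    rw [← hc, Finsupp.sum, map_sum]
    refine sum_mem fun i _ => ⟨⟨c i, hcD i⟩ ⊗ₜ f (b i), by simp⟩
  refine ⟨D, Module.Finite.span_finset k _, ?_, ?_⟩
  · have h1 := hslice Coalgebra.counit
    rw [Coalgebra.lTensor_counit_comul, TensorProduct.rid_tmul, one_smul] at h1
    rw [h1]
    exact sum_mem fun i _ => D.smul_mem _ (hcD i)
  · intro d hd
    induction hd using Submodule.span_induction with
    | zero => rw [map_zero]; exact zero_mem _
    | add x y _ _ hx hy => rw [map_add]; exact add_mem hx hy
    | smul a x _ hx => rw [map_smul]; exact Submodule.smul_mem _ _ hx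
    | mem x hx =>
      obtain ⟨i, -, rfl⟩ := Finset.mem_image.1 (Finset.mem_coe.1 hx)
      have h1 : c i = TensorProduct.rid k H
          ((b.coord i).lTensor H (Coalgebra.comul (R := k) w)) := by
        rw [← TensorProduct.equivFinsuppOfBasisRight_apply, ← hc,
          ← TensorProduct.equivFinsuppOfBasisRight_symm_apply, LinearEquiv.apply_symm_apply]
      have h2 : ∀ t : H ⊗[k] H, Coalgebra.comul (R := k) (TensorProduct.rid k H
          ((b.coord i).lTensor H t)) = (TensorProduct.rid k H ∘ₗ (b.coord i).lTensor H).lTensor H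
            (TensorProduct.assoc k H H H ((Coalgebra.comul (R := k)).rTensor H t)) := fun t => by
        induction t using TensorProduct.induction_on with
        | zero => simp
        | add x y hx hy => simp only [map_add, hx, hy]
        | tmul x y =>
          simp only [LinearMap.lTensor_tmul, TensorProduct.rid_tmul, map_smul,
            LinearMap.rTensor_tmul]
          induction Coalgebra.comul (R := k) x using TensorProduct.induction_on with
          | zero => simp
          | add x y hx hy => simp only [TensorProduct.add_tmul, smul_add, map_add, hx, hy]
          | tmul x z => simp
      rw [h1, h2, Coalgebra.coassoc_apply, ← LinearMap.comp_apply, ← LinearMap.lTensor_comp]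
      exact hcomul _

theorem exists_finite_subcomodule (s : Finset H) : ∃ D : Submodule k H, Module.Finite k D ∧
    (∀ w ∈ s, w ∈ D) ∧
    ∀ d ∈ D, Coalgebra.comul (R := k) d ∈ LinearMap.range (D.subtype.rTensor H) := by
  classical
  induction s using Finset.induction_on with
  | empty =>
    refine ⟨⊥, inferInstance, by simp, fun d hd => ?_⟩
    rw [(Submodule.mem_bot k).1 hd, map_zero]
    exact zero_mem _
  | insert a s _ ih =>
    obtain ⟨D, hD, hs, hc⟩ := ih
    obtain ⟨D', hD', ha, hc'⟩ := exists_finite_subcomodule_mem (k := k) a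
    have mono : ∀ {N : Submodule k H}, N ≤ D ⊔ D' → LinearMap.range (N.subtype.rTensor H) ≤
        LinearMap.range ((D ⊔ D').subtype.rTensor H) := by
      rintro N hN _ ⟨t, rfl⟩
      refine ⟨(Submodule.inclusion hN).rTensor H t, ?_⟩
      rw [← LinearMap.comp_apply, ← LinearMap.rTensor_comp]
      rfl
    refine ⟨D ⊔ D', inferInstance, ?_, ?_⟩
    · intro w hw
      rcases Finset.mem_insert.1 hw with rfl | hw
      · exact Submodule.mem_sup_right ha
      · exact Submodule.mem_sup_left (hs w hw)
    · intro d hd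
      obtain ⟨x, hx, y, hy, rfl⟩ := Submodule.mem_sup.1 hd
      rw [map_add]
      exact add_mem (mono le_sup_left (hc x hx)) (mono le_sup_right (hc' y hy))

end FiniteSubcomodules

/-! ### Local integrals from faithful flatness -/

section Integrals

variable {k H R : Type u} [Field k] [Ring H] [Bialgebra k H] [Ring R] [Algebra k R]

/-- Elements with one tensor factor in `B` acting trivially. -/
theorem sub_mul_tmul_one_mem {B : Subalgebra k R} (t : R ⊗[k] B) :
    t - LinearMap.mul' k R (B.val.toLinearMap.lTensor R t) ⊗ₜ[k] 1 ∈ balancedRel k B R B := by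
  induction t using TensorProduct.induction_on with
  | zero => simp
  | add x y hx hy =>
    rw [map_add, map_add, TensorProduct.add_tmul, add_sub_add_comm]
    exact add_mem hx hy
  | tmul r b =>
    rw [← neg_mem_iff, neg_sub]
    refine Submodule.subset_span ⟨r, b, 1, ?_⟩
    simp [op_smul_def]

/-- The relations of `R ⊗_B (R ⊗ H)` contain those of `(R ⊗_B R) ⊗ H`. -/
theorem assoc_mem_balancedRel {B : Subalgebra k R} (t : balancedRel k B R R ⊗[k] H) :
    TensorProduct.assoc k R R H ((balancedRel k B R R).subtype.rTensor H t) ∈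
      balancedRel k B R (R ⊗[k] H) := by
  induction t using TensorProduct.induction_on with
  | zero => simp
  | add x y hx hy => rw [map_add, map_add]; exact add_mem hx hy
  | tmul q h =>
    have h1 := freeMap_mem_relSub ((tmulRight k R h).restrictScalars B) (mem_relSub.2 q.2)
    rw [mem_relSub] at h1
    convert h1 using 1
    rw [LinearMap.rTensor_tmul, Submodule.subtype_apply]
    induction (q : R ⊗[k] R) using TensorProduct.induction_on with
    | zero => simp
    | add x y hx hy => rw [TensorProduct.add_tmul, map_add, hx, hy, map_add]
    | tmul x y => rfl

/-- R ⊗_B − commutes with finite products: q is the sum of its components put back into their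
places. -/
theorem mem_balancedRel_pi {B : Subalgebra k R} {n : ℕ} {Z : Type u} [AddCommGroup Z] [Module k Z]
    [Module B Z] [IsScalarTower k B Z] (q : R ⊗[k] (Fin n → Z))
    (hq : ∀ l, (LinearMap.proj (R := k) l).lTensor R q ∈ balancedRel k B R Z) :
    q ∈ balancedRel k B R (Fin n → Z) := by
  have h1 : q = ∑ l, freeMap (LinearMap.single B (fun _ : Fin n => Z) l)
      ((LinearMap.proj (R := k) l).lTensor R q) := by
    clear hq
    induction q using TensorProduct.induction_on with
    | zero => simp
    | add x y hx hy =>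
      simp only [map_add, Finset.sum_add_distrib]
      rw [← hx, ← hy]
    | tmul r z =>
      simp only [LinearMap.lTensor_tmul, freeMap_tmul]
      rw [← TensorProduct.tmul_sum]
      congr 1
      simp [LinearMap.sum_single_apply]
  rw [h1]
  exact sum_mem fun l _ => mem_relSub.1 (freeMap_mem_relSub _ (mem_relSub.2 (hq l)))

/-- The map `x ⊗ y ↦ (x ⊗ 1) δ(y)`. -/
def galoisMap (δ : R →ₗ[k] R ⊗[k] H) : R ⊗[k] R →ₗ[k] R ⊗[k] H :=
  (LinearMap.mul' k R).rTensor H ∘ₗ (TensorProduct.assoc k R R H).symm.toLinearMap ∘ₗ δ.lTensor R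

theorem galoisMap_tmul (δ : R →ₗ[k] R ⊗[k] H) (x y : R) :
    galoisMap δ (x ⊗ₜ[k] y) = (LinearMap.mulLeft k x).rTensor H (δ y) := by
  change (LinearMap.mul' k R).rTensor H ((TensorProduct.assoc k R R H).symm (x ⊗ₜ[k] δ y)) = _
  induction δ y using TensorProduct.induction_on with
  | zero => simp
  | add a b ha hb => rw [TensorProduct.tmul_add, map_add, map_add, ha, hb, map_add]
  | tmul r h => simp

/-- The Galois map is colinear for the coaction on the second factor of R ⊗ R. Consequently h ↦
can⁻¹(1 ⊗ h) is colinear, which is the source of the integrals. -/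
theorem galoisMap_coassoc {δ : R →ₗ[k] R ⊗[k] H} (hδ : IsRightCoaction δ) (T : R ⊗[k] R) :
    TensorProduct.assoc k R H H ((galoisMap δ).rTensor H
      ((TensorProduct.assoc k R R H).symm (δ.lTensor R T))) =
      (Coalgebra.comul (R := k)).lTensor R (galoisMap δ T) := by
  induction T using TensorProduct.induction_on with
  | zero => simp
  | add a b ha hb => simp only [map_add, ha, hb]
  | tmul x y =>
    have h1 := LinearMap.congr_fun hδ.coassoc y
    simp only [LinearMap.comp_apply, LinearEquiv.coe_coe] at h1
    rw [galoisMap_tmul, LinearMap.lTensor_tmul]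
    have h2 : ∀ t : R ⊗[k] H, TensorProduct.assoc k R H H ((galoisMap δ).rTensor H
        ((TensorProduct.assoc k R R H).symm (x ⊗ₜ[k] t))) =
        (LinearMap.mulLeft k x).rTensor (H ⊗[k] H)
          (TensorProduct.assoc k R H H (δ.rTensor H t)) := fun t => by
      induction t using TensorProduct.induction_on with
      | zero => simp
      | add a b ha hb => simp only [TensorProduct.tmul_add, map_add, ha, hb]
      | tmul r h =>
        simp only [TensorProduct.assoc_symm_tmul, LinearMap.rTensor_tmul, galoisMap_tmul]
        induction δ r using TensorProduct.induction_on with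
        | zero => simp
        | add a b ha hb => simp only [TensorProduct.add_tmul, map_add, ha, hb]
        | tmul s g => simp
    rw [h2, h1, ← LinearMap.comp_apply (LinearMap.rTensor _ _), LinearMap.rTensor_comp_lTensor,
      ← LinearMap.lTensor_comp_rTensor, LinearMap.comp_apply]

/-- The counit reduces xy₀ ⊗ y₁ to xy, so a preimage of 1 ⊗ h multiplies out to ε(h); this gives the
normalisation at 1. -/
theorem rid_counit_galoisMap {δ : R →ₗ[k] R ⊗[k] H} (hδ : IsRightCoaction δ) (T : R ⊗[k] R) :
    TensorProduct.rid k R ((Coalgebra.counit (R := k)).lTensor R (galoisMap δ T)) =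
      LinearMap.mul' k R T := by
  induction T using TensorProduct.induction_on with
  | zero => simp
  | add a b ha hb => simp only [map_add, ha, hb]
  | tmul x y =>
    have h1 := LinearMap.congr_fun hδ.counit y
    simp only [LinearMap.comp_apply, LinearEquiv.coe_coe, LinearMap.id_apply] at h1
    rw [galoisMap_tmul, LinearMap.mul'_apply]
    nth_rw 2 [← h1]
    generalize δ y = t
    induction t using TensorProduct.induction_on with
    | zero => simp
    | add a b ha hb => simp only [map_add, ha, hb, mul_add]
    | tmul r h => simp

/-- `φ` is right `H`-colinear at `h`. -/
def IsColinearAt (δ : R →ₗ[k] R ⊗[k] H) (φ : H →ₗ[k] R) (h : H) : Prop :=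
  δ (φ h) = φ.rTensor H (Coalgebra.comul h)

/-- Faithful flatness of a Galois extension yields local integrals. -/
theorem exists_integral {δ : R →ₗ[k] R ⊗[k] H} (hδ : IsRightCoaction δ) {B : Subalgebra k R}
    (hB : ∀ b, b ∈ B ↔ δ b = b ⊗ₜ[k] 1)
    (hmul : ∀ b ∈ B, ∀ r, δ (b * r) = (LinearMap.mulLeft k b).rTensor H (δ r))
    (hsurj : Function.Surjective (galoisMap δ))
    (hker : ∀ t, galoisMap δ t = 0 → t ∈ balancedRel k B R R)
    (hff : IsRightFaithfullyFlat k B R) (s : Finset H) :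
    ∃ φ : H →ₗ[k] R, φ 1 = 1 ∧ ∀ h ∈ s, IsColinearAt δ φ h := by
  classical
  obtain ⟨D, hD, hsD, hcD⟩ := exists_finite_subcomodule (k := k) (insert 1 s)
  obtain ⟨pr, hpr⟩ := D.subtype.exists_leftInverse_of_injective
    (LinearMap.ker_eq_bot.2 D.injective_subtype)
  have hpr' : ∀ d : D, pr d = d := LinearMap.congr_fun hpr
  let d := Module.finBasis k D
  set n := Module.finrank k D
  let ΔD : D →ₗ[k] D ⊗[k] H := pr.rTensor H ∘ₗ Coalgebra.comul ∘ₗ D.subtype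
  have hΔD : ∀ x : D, D.subtype.rTensor H (ΔD x) = Coalgebra.comul (R := k) (x : H) := fun x => by
    obtain ⟨t, ht⟩ := hcD x x.2
    change D.subtype.rTensor H (pr.rTensor H (Coalgebra.comul (R := k) (x : H))) = _
    rw [← ht, ← LinearMap.comp_apply (pr.rTensor H), ← LinearMap.rTensor_comp, hpr,
      LinearMap.rTensor_id, LinearMap.id_apply]
  -- The coefficients of the coaction on D: Δ(x) = Σ dᵢ ⊗ cᵢ(x).
  let c : Fin n → D →ₗ[k] H := fun i =>
    (TensorProduct.lid k H).toLinearMap ∘ₗ (d.coord i).rTensor H ∘ₗ ΔD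
  have hdc : ∀ t : D ⊗[k] H, t = ∑ i, d i ⊗ₜ[k] TensorProduct.lid k H ((d.coord i).rTensor H t) :=
    fun t => by
    induction t using TensorProduct.induction_on with
    | zero => simp
    | add x y hx hy =>
      simp only [map_add, TensorProduct.tmul_add, Finset.sum_add_distrib]
      rw [← hx, ← hy]
    | tmul x h =>
      simp only [LinearMap.rTensor_tmul, TensorProduct.lid_tmul, TensorProduct.tmul_smul]
      simp only [TensorProduct.smul_tmul', ← TensorProduct.sum_tmul, Module.Basis.coord_apply,
        d.sum_repr]
  have hΔ : ∀ x : D, Coalgebra.comul (R := k) (x : H) = ∑ i, (d i : H) ⊗ₜ[k] c i x := fun x => by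
    rw [← hΔD, hdc (ΔD x), map_sum]
    rfl
  let one : D := ⟨1, hsD 1 (Finset.mem_insert_self _ _)⟩
  have hc1 : ∀ i, c i one = d.repr one i • (1 : H) := fun i => by
    have inj : Function.Injective (D.subtype.rTensor H) :=
      Module.Flat.rTensor_preserves_injective_linearMap _ D.injective_subtype
    have h1 : ΔD one = one ⊗ₜ[k] 1 := by
      apply inj
      rw [hΔD]
      exact Bialgebra.comul_one
    change TensorProduct.lid k H ((d.coord i).rTensor H (ΔD one)) = _
    rw [h1]
    simp
  -- A linear map D → R is the tuple of its values on the basis, and the kernel of θ consists of the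
  -- colinear ones. This is B-linear because δ is left B-linear.
  let θ : (Fin n → R) →ₗ[B] (Fin n → R ⊗[k] H) :=
    { toFun := fun a j => δ (a j) - ∑ i, a i ⊗ₜ[k] c i (d j)
      map_add' := fun a b => by
        ext1 j
        simp only [Pi.add_apply, map_add, TensorProduct.add_tmul, Finset.sum_add_distrib]
        abel
      map_smul' := fun b a => by
        ext1 j
        have h1 : δ ((b : R) * a j) = (b : R) • δ (a j) := by
          rw [hmul b b.2]
          induction δ (a j) using TensorProduct.induction_on with
          | zero => simp
          | add x y hx hy => rw [map_add, hx, hy, smul_add]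
          | tmul x y => rfl
        change δ ((b : R) * a j) - ∑ i, ((b : R) * a i) ⊗ₜ[k] c i (d j) =
          (b : R) • (δ (a j) - ∑ i, a i ⊗ₜ[k] c i (d j))
        rw [h1, smul_sub, Finset.smul_sum]
        rfl }
  let E : Submodule B (Fin n → R) := LinearMap.ker θ
  have hE : ∀ a ∈ E, ∀ j, δ (a j) = ∑ i, a i ⊗ₜ[k] c i (d j) := fun a ha j =>
    sub_eq_zero.1 (congrFun (LinearMap.mem_ker.1 ha) j)
  let val : (Fin n → R) →ₗ[k] R := ∑ j, d.repr one j • LinearMap.proj j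
  have hval : ∀ a, val a = ∑ j, d.repr one j • a j := fun a => by simp [val]
  -- Evaluation at 1 in D. As 1 is grouplike, a colinear map sends it to a coinvariant, that is into
  -- B. An integral is a preimage of 1 under p.
  let p : E →ₗ[B] B :=
    { toFun := fun a => ⟨val a, by
        rw [hB, hval, map_sum]
        simp only [map_smul, hE a a.2, Finset.smul_sum]
        rw [Finset.sum_comm, TensorProduct.sum_tmul]
        refine Finset.sum_congr rfl fun i _ => ?_
        simp only [← TensorProduct.tmul_smul, ← TensorProduct.tmul_sum]
        rw [TensorProduct.smul_tmul, ← hc1 i]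
        nth_rw 2 [← d.sum_repr one]
        rw [map_sum]
        simp only [map_smul]⟩
      map_add' := fun a b => Subtype.ext (map_add val _ _)
      map_smul' := fun b a => Subtype.ext (by
        change val ((b : B) • (a : Fin n → R)) = (b : R) * val a
        rw [hval, hval, Finset.mul_sum]
        refine Finset.sum_congr rfl fun j _ => ?_
        rw [mul_smul_comm]
        rfl) }
  have hexact := (hff E (Fin n → R) (Fin n → R ⊗[k] H) E.subtype θ).1
    (LinearMap.exact_subtype_ker_map θ)
  -- The tuple of can⁻¹(1 ⊗ dⱼ) is a colinear map from D to R ⊗_B R. Flatness places it in R ⊗_B E,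
  -- and its evaluation at 1 multiplies out to 1.
  choose T hT using fun j => hsurj ((1 : R) ⊗ₜ[k] (d j : H))
  let z : R ⊗[k] (Fin n → R) := ∑ j, (LinearMap.single k (fun _ => R) j).lTensor R (T j)
  have hz : (θ.restrictScalars k).lTensor R z ∈ balancedRel k B R (Fin n → R ⊗[k] H) := by
    apply mem_balancedRel_pi
    intro l
    have h1 : (LinearMap.proj (R := k) (φ := fun _ : Fin n => R ⊗[k] H) l).lTensor R
        ((θ.restrictScalars k).lTensor R z) = δ.lTensor R (T l) -
        ∑ i, ((TensorProduct.mk k R H).flip (c i (d l))).lTensor R (T i) := by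
      have h2 : LinearMap.proj (R := k) (φ := fun _ : Fin n => R ⊗[k] H) l ∘ₗ θ.restrictScalars k =
          δ ∘ₗ LinearMap.proj l - ∑ i, (TensorProduct.mk k R H).flip (c i (d l)) ∘ₗ
            LinearMap.proj i := by
        apply LinearMap.ext
        intro a
        simp [θ]
      have h3 : ∀ i, (LinearMap.proj (R := k) (φ := fun _ : Fin n => R) i).lTensor R z = T i :=
        fun i => by
        rw [map_sum]
        rw [Finset.sum_eq_single i]
        · rw [← LinearMap.comp_apply, ← LinearMap.lTensor_comp, LinearMap.proj_comp_single_same,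
            LinearMap.lTensor_id, LinearMap.id_apply]
        · intro j _ hj
          rw [← LinearMap.comp_apply, ← LinearMap.lTensor_comp,
            LinearMap.proj_comp_single_ne _ _ _ _ hj.symm, LinearMap.lTensor_zero,
            LinearMap.zero_apply]
        · simp
      rw [← LinearMap.comp_apply, ← LinearMap.lTensor_comp, h2, LinearMap.lTensor_sub,
        LinearMap.sub_apply, LinearMap.lTensor_comp, LinearMap.comp_apply, h3]
      congr 1
      have h4 : (∑ i, (TensorProduct.mk k R H).flip (c i (d l)) ∘ₗ
          LinearMap.proj (R := k) (φ := fun _ : Fin n => R) i).lTensor R =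
          ∑ i, ((TensorProduct.mk k R H).flip (c i (d l)) ∘ₗ LinearMap.proj i).lTensor R :=
        map_sum (LinearMap.lTensorHom R) _ _
      rw [h4, LinearMap.sum_apply]
      refine Finset.sum_congr rfl fun i _ => ?_
      rw [LinearMap.lTensor_comp, LinearMap.comp_apply, h3]
    rw [h1]
    set q := δ.lTensor R (T l) -
        ∑ i, ((TensorProduct.mk k R H).flip (c i (d l))).lTensor R (T i) with hq
    -- Colinearity of the Galois map makes both terms of q have image 1 ⊗ Δ(d_l). Since the kernel
    -- of the Galois map consists of relations, so does the kernel after tensoring with H.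
    have h4 : (galoisMap δ).rTensor H ((TensorProduct.assoc k R R H).symm q) = 0 := by
      apply (TensorProduct.assoc k R H H).injective
      rw [hq, map_sub, map_sub, map_sub, galoisMap_coassoc hδ, hT, LinearMap.lTensor_tmul, hΔ,
        TensorProduct.tmul_sum, map_zero, map_sum, map_sum, map_sum, sub_eq_zero]
      refine Finset.sum_congr rfl fun i _ => ?_
      have h5 : ∀ t : R ⊗[k] R, (galoisMap δ).rTensor H ((TensorProduct.assoc k R R H).symm
          (((TensorProduct.mk k R H).flip (c i (d l))).lTensor R t)) =
          galoisMap δ t ⊗ₜ[k] c i (d l) := fun t => by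
        induction t using TensorProduct.induction_on with
        | zero => simp
        | add x y hx hy => simp only [map_add, hx, hy, TensorProduct.add_tmul]
        | tmul x y => simp
      rw [h5, hT, TensorProduct.assoc_tmul]
    have h6 : Function.Exact (balancedRel k B R R ⊓ LinearMap.ker (galoisMap δ)).subtype
        (galoisMap δ) := fun x => by
      refine ⟨fun hx => ⟨⟨x, hker x hx, hx⟩, rfl⟩, ?_⟩
      rintro ⟨y, rfl⟩
      exact y.2.2
    obtain ⟨t, ht⟩ := (Module.Flat.rTensor_exact H h6 _).1 h4
    have h7 := assoc_mem_balancedRel ((Submodule.inclusion inf_le_left).rTensor H t)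
    rw [← LinearMap.comp_apply (LinearMap.rTensor H _), ← LinearMap.rTensor_comp] at h7
    change TensorProduct.assoc k R R H ((balancedRel k B R R ⊓
      LinearMap.ker (galoisMap δ)).subtype.rTensor H t) ∈ _ at h7
    rwa [ht, LinearEquiv.apply_symm_apply] at h7
  obtain ⟨ζ0, hζ0⟩ := (hexact (Submodule.Quotient.mk z)).1
    ((Submodule.Quotient.mk_eq_zero _).2 hz)
  obtain ⟨ζ, rfl⟩ := Submodule.Quotient.mk_surjective _ ζ0
  have hζ : (E.subtype.restrictScalars k).lTensor R ζ - z ∈ balancedRel k B R (Fin n → R) :=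
    (Submodule.Quotient.eq _).1 hζ0
  let P : R ⊗[k] (Fin n → R) →ₗ[k] R := LinearMap.mul' k R ∘ₗ val.lTensor R
  have hvalB : ∀ (b : B) (a : Fin n → R), val (b • a) = b * val a := fun b a => by
    rw [hval, hval, Finset.mul_sum]
    refine Finset.sum_congr rfl fun j _ => ?_
    rw [mul_smul_comm]
    rfl
  have hP : balancedRel k B R (Fin n → R) ≤ LinearMap.ker P := by
    unfold balancedRel
    rw [Submodule.span_le]
    rintro _ ⟨r, b, a, rfl⟩
    simp [P, op_smul_def, hvalB, mul_assoc]
  have hPz : P z = 1 := by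
    have h1 : ∀ (j) (t : R ⊗[k] R), P ((LinearMap.single k (fun _ => R) j).lTensor R t) =
        d.repr one j • LinearMap.mul' k R t := fun j t => by
      have h2 : val ∘ₗ LinearMap.single k (fun _ => R) j = d.repr one j • LinearMap.id := by
        apply LinearMap.ext
        intro r
        rw [LinearMap.comp_apply, hval, Finset.sum_eq_single j]
        · simp
        · intro i _ hi
          simp [hi]
        · simp
      change LinearMap.mul' k R (val.lTensor R _) = _
      rw [← LinearMap.comp_apply (val.lTensor R), ← LinearMap.lTensor_comp, h2,
        LinearMap.lTensor_smul, LinearMap.lTensor_id, LinearMap.smul_apply, map_smul,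
        LinearMap.id_apply]
    rw [map_sum]
    simp only [h1, ← rid_counit_galoisMap hδ, hT, LinearMap.lTensor_tmul, TensorProduct.rid_tmul]
    simp only [smul_smul, ← Finset.sum_smul]
    have h3 : ∑ j, d.repr one j * Coalgebra.counit (R := k) (d j : H) =
        Coalgebra.counit (R := k) (one : H) := by
      have h4 := congrArg (fun x : D => Coalgebra.counit (R := k) (x : H)) (d.sum_repr one)
      simp only [AddSubmonoidClass.coe_finsetSum, Submodule.coe_smul, map_sum, map_smul,
        smul_eq_mul] at h4
      exact h4
    rw [h3]
    change Coalgebra.counit (R := k) (1 : H) • (1 : R) = 1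
    rw [Bialgebra.counit_one, one_smul]
  have hPζ : LinearMap.mul' k R (B.val.toLinearMap.lTensor R
      ((p.restrictScalars k).lTensor R ζ)) = 1 := by
    have h1 := hP hζ
    rw [LinearMap.mem_ker, map_sub, hPz, sub_eq_zero] at h1
    rw [← h1]
    change _ = LinearMap.mul' k R (val.lTensor R _)
    rw [← LinearMap.comp_apply (val.lTensor R), ← LinearMap.lTensor_comp,
      ← LinearMap.comp_apply (B.val.toLinearMap.lTensor R), ← LinearMap.lTensor_comp]
    rfl
  -- Surjectivity of p is exactness of E → B → 0, which is tested after R ⊗_B −. There R ⊗_B B is R,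
  -- and mζ maps to m because ζ maps to 1.
  have hsurjp : Function.Exact p (0 : B →ₗ[B] PUnit.{u + 1}) := by
    refine (hff E B PUnit.{u + 1} p 0).2 fun q => ⟨fun _ => ?_, ?_⟩
    · obtain ⟨t, rfl⟩ := Submodule.Quotient.mk_surjective _ q
      let m := LinearMap.mul' k R (B.val.toLinearMap.lTensor R t)
      refine ⟨Submodule.Quotient.mk ((LinearMap.mulLeft k m).rTensor E ζ), ?_⟩
      change (Submodule.Quotient.mk ((p.restrictScalars k).lTensor R
        ((LinearMap.mulLeft k m).rTensor E ζ)) : BalancedTensor k B R B) = _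
      rw [← LinearMap.comp_apply, LinearMap.lTensor_comp_rTensor, ← LinearMap.rTensor_comp_lTensor,
        LinearMap.comp_apply]
      have h1 : LinearMap.mul' k R (B.val.toLinearMap.lTensor R ((LinearMap.mulLeft k m).rTensor B
          ((p.restrictScalars k).lTensor R ζ))) = m := by
        have h2 : ∀ t : R ⊗[k] B, LinearMap.mul' k R (B.val.toLinearMap.lTensor R
            ((LinearMap.mulLeft k m).rTensor B t)) =
            m * LinearMap.mul' k R (B.val.toLinearMap.lTensor R t) := fun t => by
          induction t using TensorProduct.induction_on with
          | zero => simp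
          | add x y hx hy => simp only [map_add, hx, hy, mul_add]
          | tmul x y => simp [mul_assoc]
        rw [h2, hPζ, mul_one]
      have h3 := sub_mul_tmul_one_mem ((LinearMap.mulLeft k m).rTensor B
          ((p.restrictScalars k).lTensor R ζ))
      rw [h1, ← Submodule.Quotient.eq] at h3
      rw [h3, eq_comm, Submodule.Quotient.eq]
      exact sub_mul_tmul_one_mem t
    · rintro ⟨q, rfl⟩
      obtain ⟨t, rfl⟩ := Submodule.Quotient.mk_surjective _ q
      refine (Submodule.Quotient.mk_eq_zero _).2 ?_
      have : ((0 : B →ₗ[B] PUnit.{u + 1}).restrictScalars k).lTensor R = 0 := by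
        rw [LinearMap.restrictScalars_zero, LinearMap.lTensor_zero]
      rw [this]
      exact zero_mem _
  obtain ⟨a, ha⟩ := (hsurjp 1).1 rfl
  have hφ : ∀ j, (d.constr k (a : Fin n → R)) (d j) = (a : Fin n → R) j := fun j => by
    rw [Module.Basis.constr_basis]
  refine ⟨d.constr k (a : Fin n → R) ∘ₗ pr, ?_, fun h hh => ?_⟩
  · have h1 : pr 1 = one := hpr' one
    rw [LinearMap.comp_apply, h1, ← d.sum_repr one, map_sum]
    simp only [map_smul, hφ]
    rw [← hval]
    exact congrArg Subtype.val ha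
  · let x : D := ⟨h, hsD h (Finset.mem_insert_of_mem hh)⟩
    have h1 : δ ∘ₗ d.constr k (a : Fin n → R) ∘ₗ pr ∘ₗ D.subtype =
        (d.constr k (a : Fin n → R) ∘ₗ pr).rTensor H ∘ₗ Coalgebra.comul ∘ₗ D.subtype := by
      apply d.ext
      intro j
      simp only [LinearMap.comp_apply, Submodule.subtype_apply, hpr', hφ, hΔ, map_sum,
        LinearMap.rTensor_tmul]
      exact hE a a.2 j
    exact LinearMap.congr_fun h1 x

end Integrals

/-! ### Passing to opposite algebras -/

section Opposite

open MulOpposite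

variable {k A : Type u} [Field k] [Ring A] [Algebra k A] (B : Subalgebra k A)

/-- The identification of `Bᵐᵒᵖ` with the opposite subalgebra. -/
def opSubalgebraEquiv : (↥B)ᵐᵒᵖ ≃+* ↥B.op where
  toFun b := ⟨op (b.unop : A), b.unop.2⟩
  invFun b := op ⟨unop (b : Aᵐᵒᵖ), b.2⟩
  left_inv _ := rfl
  right_inv _ := rfl
  map_mul' _ _ := rfl
  map_add' _ _ := rfl

section Modules

variable {X Y Z : Type u} [AddCommGroup X] [Module k X] [Module (↥B)ᵐᵒᵖ X] [Module B.op X]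
  [AddCommGroup Y] [Module k Y] [Module (↥B)ᵐᵒᵖ Y] [Module B.op Y]

/-- `X ⊗_B A` for a right module agrees with `Aᵐᵒᵖ ⊗ X` over the opposite algebra. -/
noncomputable def balancedOpEquiv (h : ∀ (b : (↥B)ᵐᵒᵖ) (x : X), opSubalgebraEquiv B b • x = b • x) :
    BalancedTensor k B X A ≃ₗ[k] BalancedTensor k B.op Aᵐᵒᵖ X :=
  Submodule.Quotient.equiv _ _ (TensorProduct.comm k X A ≪≫ₗ
    TensorProduct.congr (opLinearEquiv k) (LinearEquiv.refl k X)) (by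
    apply le_antisymm
    · unfold balancedRel
      rw [Submodule.map_span_le]
      rintro _ ⟨x, b, a, rfl⟩
      rw [← neg_mem_iff]
      refine Submodule.subset_span ⟨op a, opSubalgebraEquiv B (op b), x, ?_⟩
      rw [h]
      simp [Subalgebra.smul_def]
      rfl
    · unfold balancedRel
      rw [Submodule.span_le]
      rintro _ ⟨a, b, x, rfl⟩
      obtain ⟨b, rfl⟩ := (opSubalgebraEquiv B).surjective b
      refine ⟨-((b • x) ⊗ₜ[k] unop a - x ⊗ₜ[k] (b.unop • unop a)),
        neg_mem (Submodule.subset_span ⟨x, b.unop, unop a, rfl⟩), ?_⟩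
      rw [h]
      simp [Subalgebra.smul_def]
      rfl)

theorem balancedOpEquiv_mapLeft [IsScalarTower k (↥B)ᵐᵒᵖ X] [IsScalarTower k (↥B)ᵐᵒᵖ Y]
    [IsScalarTower k B.op X] [IsScalarTower k B.op Y]
    (hX : ∀ (b : (↥B)ᵐᵒᵖ) (x : X), opSubalgebraEquiv B b • x = b • x)
    (hY : ∀ (b : (↥B)ᵐᵒᵖ) (x : Y), opSubalgebraEquiv B b • x = b • x)
    (f : X →ₗ[(↥B)ᵐᵒᵖ] Y) (f' : X →ₗ[B.op] Y) (hf : ∀ x, f x = f' x) :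
    balancedMapRight (k := k) Aᵐᵒᵖ f' ∘ₗ (balancedOpEquiv B hX).toLinearMap =
      (balancedOpEquiv B hY).toLinearMap ∘ₗ balancedMapLeft (k := k) A f := by
  apply Submodule.linearMap_qext
  apply TensorProduct.ext'
  intro x a
  change (Submodule.Quotient.mk (op a ⊗ₜ[k] f' x) : BalancedTensor k B.op Aᵐᵒᵖ Y) =
    Submodule.Quotient.mk (op a ⊗ₜ[k] f x)
  rw [hf]

end Modules

/-- Right B-modules are left modules over the opposite subalgebra, and the two balanced tensor
products are naturally isomorphic. Left-handed flatness thereby reduces to the right-handed case. -/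
theorem isLeftFaithfullyFlat_iff_op :
    IsLeftFaithfullyFlat k B A ↔ IsRightFaithfullyFlat k B.op Aᵐᵒᵖ := by
  constructor
  · intro H X Y Z _ _ _ _ _ _ _ _ _ _ _ _ f g
    let : Module (↥B)ᵐᵒᵖ X := Module.compHom X (opSubalgebraEquiv B).toRingHom
    let : Module (↥B)ᵐᵒᵖ Y := Module.compHom Y (opSubalgebraEquiv B).toRingHom
    let : Module (↥B)ᵐᵒᵖ Z := Module.compHom Z (opSubalgebraEquiv B).toRingHom
    have tower : ∀ (W : Type u) [AddCommGroup W] [Module k W] [Module B.op W]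
        [IsScalarTower k B.op W] (c : k) (b : (↥B)ᵐᵒᵖ) (w : W),
        opSubalgebraEquiv B (c • b) • w = c • (opSubalgebraEquiv B b • w) := by
      intro W _ _ _ _ c b w
      rw [← smul_assoc]
      rfl
    have : IsScalarTower k (↥B)ᵐᵒᵖ X := ⟨tower X⟩
    have : IsScalarTower k (↥B)ᵐᵒᵖ Y := ⟨tower Y⟩
    have : IsScalarTower k (↥B)ᵐᵒᵖ Z := ⟨tower Z⟩
    let f' : X →ₗ[(↥B)ᵐᵒᵖ] Y := { f with map_smul' := fun b x => f.map_smul _ x }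
    let g' : Y →ₗ[(↥B)ᵐᵒᵖ] Z := { g with map_smul' := fun b x => g.map_smul _ x }
    refine (H X Y Z f' g').trans ?_
    exact (Function.Exact.iff_of_ladder_linearEquiv
      (balancedOpEquiv_mapLeft B (fun _ _ => rfl) (fun _ _ => rfl) f' f fun _ => rfl)
      (balancedOpEquiv_mapLeft B (fun _ _ => rfl) (fun _ _ => rfl) g' g fun _ => rfl)).symm
  · intro H X Y Z _ _ _ _ _ _ _ _ _ _ _ _ f g
    let : Module B.op X := Module.compHom X (opSubalgebraEquiv B).symm.toRingHom
    let : Module B.op Y := Module.compHom Y (opSubalgebraEquiv B).symm.toRingHom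
    let : Module B.op Z := Module.compHom Z (opSubalgebraEquiv B).symm.toRingHom
    have tower : ∀ (W : Type u) [AddCommGroup W] [Module k W] [Module (↥B)ᵐᵒᵖ W]
        [IsScalarTower k (↥B)ᵐᵒᵖ W] (c : k) (b : B.op) (w : W),
        (opSubalgebraEquiv B).symm (c • b) • w = c • ((opSubalgebraEquiv B).symm b • w) := by
      intro W _ _ _ _ c b w
      rw [← smul_assoc]
      rfl
    have : IsScalarTower k B.op X := ⟨tower X⟩
    have : IsScalarTower k B.op Y := ⟨tower Y⟩
    have : IsScalarTower k B.op Z := ⟨tower Z⟩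
    let f' : X →ₗ[B.op] Y := { f with map_smul' := fun b x => f.map_smul _ x }
    let g' : Y →ₗ[B.op] Z := { g with map_smul' := fun b x => g.map_smul _ x }
    refine (H X Y Z f' g').trans ?_
    exact (Function.Exact.iff_of_ladder_linearEquiv
      (balancedOpEquiv_mapLeft B (fun _ _ => rfl) (fun _ _ => rfl) f f' fun _ => rfl)
      (balancedOpEquiv_mapLeft B (fun _ _ => rfl) (fun _ _ => rfl) g g' fun _ => rfl))

end Opposite

/-! ### Co-opposite coalgebras -/

section Flip

variable {k C : Type u} [Field k] [AddCommGroup C] [Module k C] [Coalgebra k C]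

/-- The flipped comultiplication. -/
noncomputable def flipComul (k C : Type u) [Field k] [AddCommGroup C] [Module k C]
    [Coalgebra k C] : C →ₗ[k] C ⊗[k] C :=
  (TensorProduct.comm k C C).toLinearMap ∘ₗ Coalgebra.comul

theorem assoc_flipComul (x : C) :
    TensorProduct.assoc k C C C ((flipComul k C).rTensor C (flipComul k C x)) =
      (flipComul k C).lTensor C (flipComul k C x) := by
  let P : C ⊗[k] (C ⊗[k] C) →ₗ[k] C ⊗[k] (C ⊗[k] C) :=
    (TensorProduct.assoc k C C C).toLinearMap ∘ₗ
    (TensorProduct.comm k C C).toLinearMap.rTensor C ∘ₗ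
    (TensorProduct.comm k C (C ⊗[k] C)).toLinearMap
  have h1 : ∀ t : C ⊗[k] C, TensorProduct.assoc k C C C ((flipComul k C).rTensor C
      (TensorProduct.comm k C C t)) = P ((Coalgebra.comul (R := k)).lTensor C t) := fun t => by
    induction t using TensorProduct.induction_on with
    | zero => simp
    | add a b ha hb => simp only [map_add, ha, hb]
    | tmul a b => simp [P, flipComul]
  have h2 : ∀ t : C ⊗[k] C, (flipComul k C).lTensor C (TensorProduct.comm k C C t) =
      P (TensorProduct.assoc k C C C ((Coalgebra.comul (R := k)).rTensor C t)) := fun t => by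
    induction t using TensorProduct.induction_on with
    | zero => simp
    | add a b ha hb => simp only [map_add, ha, hb]
    | tmul a b =>
      simp only [TensorProduct.comm_tmul, LinearMap.lTensor_tmul, LinearMap.rTensor_tmul,
        flipComul, LinearMap.comp_apply, LinearEquiv.coe_coe]
      induction Coalgebra.comul (R := k) a using TensorProduct.induction_on with
      | zero => simp
      | add x y hx hy => simp only [TensorProduct.add_tmul, TensorProduct.tmul_add, map_add, hx, hy]
      | tmul x y => simp [P]
  exact (h1 _).trans ((congrArg P (Coalgebra.coassoc_apply x).symm).trans (h2 _).symm)

theorem rTensor_counit_flipComul (x : C) :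
    (Coalgebra.counit (R := k) (A := C)).rTensor C (flipComul k C x) = 1 ⊗ₜ[k] x := by
  have h1 : ∀ t : C ⊗[k] C, (Coalgebra.counit (R := k) (A := C)).rTensor C
      (TensorProduct.comm k C C t) =
      TensorProduct.comm k C k ((Coalgebra.counit (R := k) (A := C)).lTensor C t) := fun t => by
    induction t using TensorProduct.induction_on with
    | zero => simp
    | add a b ha hb => simp only [map_add, ha, hb]
    | tmul a b => simp
  refine (h1 (Coalgebra.comul (R := k) (A := C) x)).trans ?_
  rw [Coalgebra.lTensor_counit_comul, TensorProduct.comm_tmul]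

theorem lTensor_counit_flipComul (x : C) :
    (Coalgebra.counit (R := k) (A := C)).lTensor C (flipComul k C x) = x ⊗ₜ[k] 1 := by
  have h1 : ∀ t : C ⊗[k] C, (Coalgebra.counit (R := k) (A := C)).lTensor C
      (TensorProduct.comm k C C t) =
      TensorProduct.comm k k C ((Coalgebra.counit (R := k) (A := C)).rTensor C t) := fun t => by
    induction t using TensorProduct.induction_on with
    | zero => simp
    | add a b ha hb => simp only [map_add, ha, hb]
    | tmul a b => simp
  refine (h1 (Coalgebra.comul (R := k) (A := C) x)).trans ?_
  rw [Coalgebra.rTensor_counit_comul, TensorProduct.comm_tmul]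

/-- Reversing the three tensor factors carries one coassociativity equation to the other. -/
theorem flip_coassoc_iff {M : Type u} [AddCommGroup M] [Module k M] (ρ : M →ₗ[k] C ⊗[k] M) (m : M) :
    ρ.lTensor C (ρ m) = TensorProduct.assoc k C C M ((flipComul k C).rTensor M (ρ m)) ↔
      TensorProduct.assoc k M C C (((TensorProduct.comm k C M).toLinearMap ∘ₗ ρ).rTensor C
        (TensorProduct.comm k C M (ρ m))) =
      (Coalgebra.comul (R := k) (A := C)).lTensor M (TensorProduct.comm k C M (ρ m)) := by
  let P : C ⊗[k] (C ⊗[k] M) ≃ₗ[k] M ⊗[k] (C ⊗[k] C) :=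
    TensorProduct.comm k C (C ⊗[k] M) ≪≫ₗ
    TensorProduct.congr (TensorProduct.comm k C M) (LinearEquiv.refl k C) ≪≫ₗ
    TensorProduct.assoc k M C C
  have h1 : ∀ t : C ⊗[k] M, TensorProduct.assoc k M C C
      (((TensorProduct.comm k C M).toLinearMap ∘ₗ ρ).rTensor C (TensorProduct.comm k C M t)) =
      P (ρ.lTensor C t) := fun t => by
    induction t using TensorProduct.induction_on with
    | zero => simp
    | add a b ha hb => simp only [map_add, ha, hb]
    | tmul a m => rfl
  have h2 : ∀ t : C ⊗[k] M, (Coalgebra.comul (R := k)).lTensor M (TensorProduct.comm k C M t) =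
      P (TensorProduct.assoc k C C M ((flipComul k C).rTensor M t)) := fun t => by
    induction t using TensorProduct.induction_on with
    | zero => simp
    | add a b ha hb => simp only [map_add, ha, hb]
    | tmul a m =>
      simp only [TensorProduct.comm_tmul, LinearMap.lTensor_tmul, LinearMap.rTensor_tmul,
        flipComul, LinearMap.comp_apply, LinearEquiv.coe_coe]
      induction Coalgebra.comul (R := k) a using TensorProduct.induction_on with
      | zero => simp
      | add x y hx hy => simp only [TensorProduct.add_tmul, TensorProduct.tmul_add, map_add, hx, hy]
      | tmul x y => simp [P]
  rw [h1, h2, P.injective.eq_iff]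

theorem rid_counit_comm {M : Type u} [AddCommGroup M] [Module k M] (t : C ⊗[k] M) :
    TensorProduct.rid k M
      ((Coalgebra.counit (R := k) (A := C)).lTensor M (TensorProduct.comm k C M t)) =
      TensorProduct.lid k M ((Coalgebra.counit (R := k) (A := C)).rTensor M t) := by
  induction t using TensorProduct.induction_on with
  | zero => simp
  | add a b ha hb => simp only [map_add, ha, hb]
  | tmul a m => simp

end Flip

/-- The co-opposite coalgebra of `C`. -/
def Cop (C : Type u) : Type u := C

section Cop

variable {k C : Type u} [Field k] [AddCommGroup C] [Module k C]

instance : AddCommGroup (Cop C) := inferInstanceAs (AddCommGroup C)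

instance : Module k (Cop C) := inferInstanceAs (Module k C)

variable [Coalgebra k C]

noncomputable instance : Coalgebra k (Cop C) where
  comul := flipComul k C
  counit := (Coalgebra.counit (R := k) (A := C))
  coassoc := LinearMap.ext fun x => assoc_flipComul (k := k) (C := C) x
  rTensor_counit_comp_comul := LinearMap.ext fun x => rTensor_counit_flipComul (k := k) (C := C) x
  lTensor_counit_comp_comul := LinearMap.ext fun x => lTensor_counit_flipComul (k := k) (C := C) x

/-- The flip of a coaction of the co-opposite coalgebra. -/
noncomputable def flipCoaction {M : Type u} [AddCommGroup M] [Module k M]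
    (ρ : M →ₗ[k] Cop C ⊗[k] M) : M →ₗ[k] M ⊗[k] C :=
  (TensorProduct.comm k C M).toLinearMap ∘ₗ ρ

theorem isLeftCoaction_cop_iff {M : Type u} [AddCommGroup M] [Module k M]
    (ρ : M →ₗ[k] Cop C ⊗[k] M) : IsLeftCoaction ρ ↔ IsRightCoaction (flipCoaction ρ) := by
  let ρ' : M →ₗ[k] C ⊗[k] M := ρ
  constructor
  · intro h
    exact ⟨LinearMap.ext fun m => (flip_coassoc_iff ρ' m).1 (LinearMap.congr_fun h.coassoc m),
      LinearMap.ext fun m => (rid_counit_comm (ρ' m)).trans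
        (LinearMap.congr_fun h.counit m)⟩
  · intro h
    exact ⟨LinearMap.ext fun m => (flip_coassoc_iff ρ' m).2 (LinearMap.congr_fun h.coassoc m),
      LinearMap.ext fun m => (rid_counit_comm (ρ' m)).symm.trans
        (LinearMap.congr_fun h.counit m)⟩

end Cop

/-! ### Hopf modules and cotensor products -/

section Cotensor

variable {k R C H : Type u} [Field k] [Ring R] [Algebra k R] [AddCommGroup C] [Module k C]
  [AddCommGroup H] [Module k H]

/-- The map `h ⊗ m ↦ ψ(h) m`. -/
def evalMap (M : Type u) [AddCommGroup M] [Module k M] [Module R M] [IsScalarTower k R M]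
    (ψ : H →ₗ[k] R) : H ⊗[k] M →ₗ[k] M :=
  TensorProduct.lift ((Algebra.lsmul k k M : R →ₐ[k] Module.End k M).toLinearMap ∘ₗ ψ)

section Modules

variable {M M' : Type u} [AddCommGroup M] [Module k M] [Module R M] [IsScalarTower k R M]
  [AddCommGroup M'] [Module k M'] [Module R M'] [IsScalarTower k R M']

theorem evalMap_tmul (ψ : H →ₗ[k] R) (h : H) (m : M) : evalMap M ψ (h ⊗ₜ[k] m) = ψ h • m := rfl

theorem map_evalMap (ψ : H →ₗ[k] R) (f : M →ₗ[R] M') (t : H ⊗[k] M) :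
    f (evalMap M ψ t) = evalMap M' ψ ((f.restrictScalars k).lTensor H t) := by
  induction t using TensorProduct.induction_on with
  | zero => simp
  | add a b ha hb => simp only [map_add, ha, hb]
  | tmul h m => simp [evalMap_tmul]

theorem evalMap_zero (t : H ⊗[k] M) : evalMap M (0 : H →ₗ[k] R) t = 0 := by
  induction t using TensorProduct.induction_on with
  | zero => simp
  | add a b ha hb => rw [map_add, ha, hb, add_zero]
  | tmul h m => rw [evalMap_tmul, LinearMap.zero_apply, zero_smul]

theorem evalMap_add (ψ ψ' : H →ₗ[k] R) (t : H ⊗[k] M) :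
    evalMap M (ψ + ψ') t = evalMap M ψ t + evalMap M ψ' t := by
  induction t using TensorProduct.induction_on with
  | zero => simp
  | add a b ha hb => simp only [map_add, ha, hb]; abel
  | tmul h m => rw [evalMap_tmul, LinearMap.add_apply, add_smul]; rfl

theorem evalMap_const_smul (c : k) (ψ : H →ₗ[k] R) (t : H ⊗[k] M) :
    evalMap M (c • ψ) t = c • evalMap M ψ t := by
  induction t using TensorProduct.induction_on with
  | zero => simp
  | add a b ha hb => simp only [map_add, ha, hb, smul_add]
  | tmul h m => rw [evalMap_tmul, LinearMap.smul_apply, smul_assoc]; rfl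

theorem evalMap_smul (r : R) (ψ : H →ₗ[k] R) (t : H ⊗[k] M) :
    evalMap M (LinearMap.mulLeft k r ∘ₗ ψ) t = r • evalMap M ψ t := by
  induction t using TensorProduct.induction_on with
  | zero => simp
  | add a b ha hb => simp only [map_add, ha, hb, smul_add]
  | tmul h m => simp [evalMap_tmul, mul_smul]

end Modules

variable [Coalgebra k C] {τ : R →ₗ[k] R ⊗[k] Module.End k C} {e : C}

/-- `H □_C -` is exact and faithful on Hopf modules, where `H` is coacted on by `r`. -/
structure IsHopfCoflat (τ : R →ₗ[k] R ⊗[k] Module.End k C) (r : H →ₗ[k] H ⊗[k] C) : Prop where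
  lift : ∀ (M M' : Type u) [AddCommGroup M] [Module k M] [Module R M] [IsScalarTower k R M]
    [AddCommGroup M'] [Module k M'] [Module R M'] [IsScalarTower k R M']
    (ρ : M →ₗ[k] C ⊗[k] M) (ρ' : M' →ₗ[k] C ⊗[k] M'),
    IsHopfModule τ ρ → IsHopfModule τ ρ' → ∀ f : M →ₗ[R] M',
    IsLeftColinear ρ ρ' (f.restrictScalars k) → Function.Surjective f →
    ∀ t' ∈ cotensor r ρ', ∃ t ∈ cotensor r ρ, (f.restrictScalars k).lTensor H t = t'
  detect : ∀ (M : Type u) [AddCommGroup M] [Module k M] [Module R M] [IsScalarTower k R M]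
    (ρ : M →ₗ[k] C ⊗[k] M), IsHopfModule τ ρ →
    (∀ t ∈ cotensor r ρ, t = 0) → ∀ m : M, m = 0

/-- A coinvariant m' gives 1 ⊗ m' in H □ M', which lifts to some t in H □ M. Evaluating ψ on t gives
a coinvariant of M with image ψ(1)m' = m'. Which ψ to use depends on t, hence the filter. -/
theorem IsHopfCoflat.liftsCoinvariants {r : H →ₗ[k] H ⊗[k] C} (hr : IsHopfCoflat τ r) {one : H}
    (hone : r one = one ⊗ₜ[k] e) {ι : Type u} {l : Filter ι} [l.NeBot] (ψ : ι → H →ₗ[k] R)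
    (hψ1 : ∀ᶠ i in l, ψ i one = 1)
    (hψ : ∀ (M : Type u) [AddCommGroup M] [Module k M] [Module R M] [IsScalarTower k R M]
      (ρ : M →ₗ[k] C ⊗[k] M), IsHopfModule τ ρ → ∀ t ∈ cotensor r ρ,
      ∀ᶠ i in l, ρ (evalMap M (ψ i) t) = e ⊗ₜ[k] evalMap M (ψ i) t) :
    LiftsCoinvariants τ e := by
  intro M M' _ _ _ _ _ _ _ _ ρ ρ' hρ hρ' f hf hsurj m' hm'
  obtain ⟨t, ht, hft⟩ := hr.lift M M' ρ ρ' hρ hρ' f hf hsurj (one ⊗ₜ[k] m') (by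
    change TensorProduct.assoc k H C M' (r one ⊗ₜ[k] m') = one ⊗ₜ[k] ρ' m'
    rw [hone, hm']
    rfl)
  obtain ⟨i, hi1, hi⟩ := (hψ1.and (hψ M ρ hρ t ht)).exists
  refine ⟨_, hi, ?_⟩
  rw [map_evalMap, hft, evalMap_tmul, hi1, one_smul]

/-- It suffices that H □ M = 0. For t in H □ M the element (Δ ⊗ M)(t) lies in H ⊗ (H □ M), on which
evaluation through κ vanishes. Since κ(h₁)(h₂) = ε(h), this evaluation is also (ε ⊗ M)(t). So ε ⊗ M
is zero on H □ M, and applying it to the last two factors of (Δ ⊗ M)(t) gives t = 0. -/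
theorem IsHopfCoflat.detectsZero {r : H →ₗ[k] H ⊗[k] C} (hr : IsHopfCoflat τ r)
    {Δ : H →ₗ[k] H ⊗[k] H} {ε : H →ₗ[k] k}
    (hΔr : (TensorProduct.assoc k H H C).toLinearMap ∘ₗ Δ.rTensor C ∘ₗ r = r.lTensor H ∘ₗ Δ)
    (hε : ∀ h, ε.lTensor H (Δ h) = h ⊗ₜ[k] 1)
    {ι : Type u} {l : Filter ι} [l.NeBot] (κ : ι → H →ₗ[k] H →ₗ[k] R)
    (hκ1 : ∀ᶠ i in l, ∀ h, TensorProduct.lift (κ i) (Δ h) = algebraMap k R (ε h))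
    (hκ : ∀ (M : Type u) [AddCommGroup M] [Module k M] [Module R M] [IsScalarTower k R M]
      (ρ : M →ₗ[k] C ⊗[k] M), IsHopfModule τ ρ → (∀ m : M, ρ m = e ⊗ₜ[k] m → m = 0) →
      ∀ g, ∀ t ∈ cotensor r ρ, ∀ᶠ i in l, evalMap M (κ i g) t = 0) :
    DetectsZero τ e := by
  intro M _ _ _ _ ρ hρ hM
  refine hr.detect M ρ hρ ?_
  let u : H ⊗[k] M →ₗ[k] H ⊗[k] (C ⊗[k] M) :=
    (TensorProduct.assoc k H C M).toLinearMap ∘ₗ r.rTensor M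
  have hmem : ∀ t, t ∈ cotensor r ρ ↔ (u - ρ.lTensor H) t = 0 := fun t => by
    rw [LinearMap.sub_apply, sub_eq_zero]
    rfl
  have hexact : Function.Exact (cotensor r ρ).subtype (u - ρ.lTensor H) := fun t => by
    rw [← hmem]
    simp
  let D : ∀ (N : Type u) [AddCommGroup N] [Module k N], H ⊗[k] N →ₗ[k] H ⊗[k] (H ⊗[k] N) :=
    fun N _ _ => (TensorProduct.assoc k H H N).toLinearMap ∘ₗ Δ.rTensor N
  have hDt : ∀ (N : Type u) [AddCommGroup N] [Module k N] (h : H) (n : N), D N (h ⊗ₜ[k] n) =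
      ((TensorProduct.mk k H N).flip n).lTensor H (Δ h) := fun N _ _ h n => by
    change TensorProduct.assoc k H H N (Δ h ⊗ₜ[k] n) = _
    induction Δ h using TensorProduct.induction_on with
    | zero => simp
    | add a b ha hb => rw [TensorProduct.add_tmul, map_add, ha, hb, map_add]
    | tmul a b => rfl
  have hD1 : ∀ t : H ⊗[k] M, u.lTensor H (D M t) = D (C ⊗[k] M) (u t) := fun t => by
    induction t using TensorProduct.induction_on with
    | zero => simp
    | add a b ha hb => simp only [map_add, ha, hb]
    | tmul h m =>
      have h1 := LinearMap.congr_fun hΔr h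
      simp only [LinearMap.comp_apply, LinearEquiv.coe_coe] at h1
      have h2 : ∀ s : H ⊗[k] C, D (C ⊗[k] M) (TensorProduct.assoc k H C M (s ⊗ₜ[k] m)) =
          ((TensorProduct.assoc k H C M).toLinearMap ∘ₗ
            (TensorProduct.mk k (H ⊗[k] C) M).flip m).lTensor H
            (TensorProduct.assoc k H H C (Δ.rTensor C s)) := fun s => by
        induction s using TensorProduct.induction_on with
        | zero => simp
        | add a b ha hb => simp only [TensorProduct.add_tmul, map_add, ha, hb]
        | tmul h c =>
          rw [TensorProduct.assoc_tmul, hDt, LinearMap.rTensor_tmul]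
          induction Δ h using TensorProduct.induction_on with
          | zero => simp
          | add a b ha hb => simp only [TensorProduct.add_tmul, map_add, ha, hb]
          | tmul a b => rfl
      change u.lTensor H (D M (h ⊗ₜ[k] m)) =
        D (C ⊗[k] M) (TensorProduct.assoc k H C M (r h ⊗ₜ[k] m))
      rw [h2, h1, hDt, ← LinearMap.lTensor_comp_apply, ← LinearMap.lTensor_comp_apply]
      rfl
  have hD2 : ∀ t : H ⊗[k] M, (ρ.lTensor H).lTensor H (D M t) = D (C ⊗[k] M) (ρ.lTensor H t) :=
    fun t => by
    induction t using TensorProduct.induction_on with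
    | zero => simp
    | add a b ha hb => simp only [map_add, ha, hb]
    | tmul h m =>
      rw [LinearMap.lTensor_tmul, hDt, hDt, ← LinearMap.comp_apply, ← LinearMap.lTensor_comp]
      rfl
  -- Both maps defining the cotensor product commute with D, and H ⊗ − preserves their equalizer.
  have hW : ∀ t ∈ cotensor r ρ, ∃ w, (cotensor r ρ).subtype.lTensor H w = D M t := fun t ht => by
    refine (Module.Flat.lTensor_exact H hexact _).1 ?_
    rw [LinearMap.lTensor_sub, LinearMap.sub_apply, hD1, hD2, ← map_sub, ← LinearMap.sub_apply,
      (hmem t).1 ht, map_zero]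
  let G : ι → H ⊗[k] (H ⊗[k] M) →ₗ[k] M := fun i => TensorProduct.lift
    { toFun := fun g => evalMap M (κ i g)
      map_add' := fun g g' => LinearMap.ext fun t => by rw [map_add, evalMap_add]; rfl
      map_smul' := fun c g => LinearMap.ext fun t => by
        rw [map_smul, evalMap_const_smul]; rfl }
  have hG : ∀ w : H ⊗[k] cotensor r ρ,
      ∀ᶠ i in l, G i ((cotensor r ρ).subtype.lTensor H w) = 0 := fun w => by
    induction w using TensorProduct.induction_on with
    | zero => simp
    | add a b ha hb =>
      filter_upwards [ha, hb] with i h1 h2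
      rw [map_add, map_add, h1, h2, add_zero]
    | tmul g t => exact hκ M ρ hρ hM g t t.2
  let E : H ⊗[k] M →ₗ[k] M := (TensorProduct.lid k M).toLinearMap ∘ₗ ε.rTensor M
  have hGE : ∀ᶠ i in l, ∀ t : H ⊗[k] M, G i (D M t) = E t := by
    filter_upwards [hκ1] with i hi t
    induction t using TensorProduct.induction_on with
    | zero => simp
    | add a b ha hb => simp only [map_add, ha, hb]
    | tmul h m =>
      have h1 : ∀ s : H ⊗[k] H, G i (((TensorProduct.mk k H M).flip m).lTensor H s) =
          TensorProduct.lift (κ i) s • m := fun s => by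
        induction s using TensorProduct.induction_on with
        | zero => simp
        | add a b ha hb => simp only [map_add, ha, hb, add_smul]
        | tmul a b => rfl
      rw [hDt, h1, hi, algebraMap_smul]
      rfl
  have hE : ∀ t ∈ cotensor r ρ, E t = 0 := fun t ht => by
    obtain ⟨w, hw⟩ := hW t ht
    obtain ⟨i, hi, hi'⟩ := (hGE.and (hG w)).exists
    rw [← hi, ← hw, hi']
  intro t ht
  obtain ⟨w, hw⟩ := hW t ht
  have h1 : ∀ t : H ⊗[k] M, E.lTensor H (D M t) = t := fun t => by
    induction t using TensorProduct.induction_on with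
    | zero => simp
    | add a b ha hb => simp only [map_add, ha, hb]
    | tmul h m =>
      have h2 : E ∘ₗ (TensorProduct.mk k H M).flip m =
          (LinearMap.toSpanSingleton k M m) ∘ₗ ε := by
        ext g
        simp [E]
      rw [hDt, ← LinearMap.comp_apply, ← LinearMap.lTensor_comp, h2, LinearMap.lTensor_comp,
        LinearMap.comp_apply, hε]
      simp
  rw [← h1 t, ← hw, ← LinearMap.comp_apply, ← LinearMap.lTensor_comp]
  have h2 : E ∘ₗ (cotensor r ρ).subtype = 0 := LinearMap.ext fun t => hE t t.2
  rw [h2, LinearMap.lTensor_zero, LinearMap.zero_apply]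

end Cotensor

/-! ### Bijective antipodes -/

section Antipode

variable {k H : Type u} [Field k] [Ring H] [Bialgebra k H]

/-- `S` is an antipode of `H`, with inverse `T`. -/
structure IsAntipodePair (S T : H →ₗ[k] H) : Prop where
  left_inv : ∀ h, T (S h) = h
  right_inv : ∀ h, S (T h) = h
  map_mul : ∀ g h, S (g * h) = S h * S g
  map_mul_symm : ∀ g h, T (g * h) = T h * T g
  comul_antipode : ∀ h, Coalgebra.comul (R := k) (S h) =
    TensorProduct.map S S (flipComul k H h)
  comul_symm : ∀ h, Coalgebra.comul (R := k) (T h) = TensorProduct.map T T (flipComul k H h)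
  counit_antipode : ∀ h, Coalgebra.counit (R := k) (S h) = Coalgebra.counit (R := k) h
  counit_symm : ∀ h, Coalgebra.counit (R := k) (T h) = Coalgebra.counit (R := k) h
  antipode_mul : ∀ h, LinearMap.mul' k H (S.rTensor H (Coalgebra.comul h)) =
    algebraMap k H (Coalgebra.counit h)
  mul_antipode : ∀ h, LinearMap.mul' k H (S.lTensor H (Coalgebra.comul h)) =
    algebraMap k H (Coalgebra.counit h)
  -- T(h₂)h₁ = ε(h), and h₂T(h₁) = ε(h) in the next field: T is an antipode for the flipped
  -- comultiplication. This makes the structure symmetric under passage to `Cop H`.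
  symm_mul : ∀ h, LinearMap.mul' k H (T.rTensor H (flipComul k H h)) =
    algebraMap k H (Coalgebra.counit h)
  mul_symm : ∀ h, LinearMap.mul' k H (T.lTensor H (flipComul k H h)) =
    algebraMap k H (Coalgebra.counit h)

namespace IsAntipodePair

variable {S T : H →ₗ[k] H} (h : IsAntipodePair S T)

include h

theorem antipode_one : S 1 = 1 := by
  have h1 := h.antipode_mul 1
  rw [Bialgebra.comul_one, Bialgebra.counit_one, (algebraMap k H).map_one,
    Algebra.TensorProduct.one_def, LinearMap.rTensor_tmul, LinearMap.mul'_apply, mul_one] at h1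
  exact h1

theorem symm_one : T 1 = 1 := by
  simpa only [h.antipode_one] using h.left_inv 1

end IsAntipodePair

end Antipode

section Hopf

open WithConv

variable {k H : Type u} [Field k] [Ring H] [HopfAlgebra k H]

/-- In the convolution algebra of maps H → H ⊗ H, Δ ∘ S is a right inverse of Δ, while h ↦ S(h₂) ⊗
S(h₁) is a left inverse; hence they agree. -/
theorem comul_antipode (h : H) : Coalgebra.comul (R := k) (HopfAlgebra.antipode k h) =
    TensorProduct.map (HopfAlgebra.antipode k) (HopfAlgebra.antipode k) (flipComul k H h) := by
  let S : H →ₗ[k] H := HopfAlgebra.antipode k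
  let i₁ : H →ₐ[k] H ⊗[k] H := Algebra.TensorProduct.includeLeft
  let i₂ : H →ₐ[k] H ⊗[k] H := Algebra.TensorProduct.includeRight
  let D : H →ₐ[k] H ⊗[k] H := Bialgebra.comulAlgHom k H
  let s₁ : WithConv (H →ₗ[k] H ⊗[k] H) := toConv (i₁.toLinearMap ∘ₗ S)
  let s₂ : WithConv (H →ₗ[k] H ⊗[k] H) := toConv (i₂.toLinearMap ∘ₗ S)
  let j₂ : WithConv (H →ₗ[k] H ⊗[k] H) := toConv i₂.toLinearMap
  let d : WithConv (H →ₗ[k] H ⊗[k] H) := toConv D.toLinearMap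
  let dS : WithConv (H →ₗ[k] H ⊗[k] H) := toConv (D.toLinearMap ∘ₗ S)
  have hd : d * dS = 1 := by
    ext x
    rw [LinearMap.convMul_apply, LinearMap.convOne_apply]
    have h1 : ∀ t : H ⊗[k] H, LinearMap.mul' k (H ⊗[k] H) (TensorProduct.map d.ofConv dS.ofConv t) =
        D (LinearMap.mul' k H (S.lTensor H t)) := fun t => by
      induction t using TensorProduct.induction_on with
      | zero => simp
      | add a b ha hb => simp only [map_add, ha, hb]
      | tmul a b => simp [d, dS]
    rw [h1, HopfAlgebra.mul_antipode_lTensor_comul_apply, AlgHom.commutes]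
  have hs₂ : s₂ * j₂ = 1 := by
    ext x
    rw [LinearMap.convMul_apply, LinearMap.convOne_apply]
    have h1 : ∀ t : H ⊗[k] H, LinearMap.mul' k (H ⊗[k] H) (TensorProduct.map s₂.ofConv j₂.ofConv t) =
        i₂ (LinearMap.mul' k H (S.rTensor H t)) := fun t => by
      induction t using TensorProduct.induction_on with
      | zero => simp
      | add a b ha hb => simp only [map_add, ha, hb]
      | tmul a b => simp [s₂, j₂]
    rw [h1, HopfAlgebra.mul_antipode_rTensor_comul_apply, AlgHom.commutes]
  have hs₁ : s₁ * d = j₂ := by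
    ext x
    rw [LinearMap.convMul_apply]
    have h1 : ∀ t : H ⊗[k] H, LinearMap.mul' k (H ⊗[k] H) (TensorProduct.map s₁.ofConv d.ofConv t) =
        (LinearMap.mul' k H ∘ₗ S.rTensor H).rTensor H ((TensorProduct.assoc k H H H).symm
          ((Coalgebra.comul (R := k)).lTensor H t)) := fun t => by
      induction t using TensorProduct.induction_on with
      | zero => simp
      | add a b ha hb => simp only [map_add, ha, hb]
      | tmul a b =>
        have h2 : ∀ w : H ⊗[k] H, (S a ⊗ₜ[k] (1 : H)) * w =
            (LinearMap.mul' k H ∘ₗ S.rTensor H).rTensor H ((TensorProduct.assoc k H H H).symm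
              (a ⊗ₜ[k] w)) := fun w => by
          induction w using TensorProduct.induction_on with
          | zero => simp
          | add a b ha hb => simp only [TensorProduct.tmul_add, mul_add, map_add, ha, hb]
          | tmul a b => simp
        exact h2 _
    have h3 : LinearMap.mul' k H ∘ₗ S.rTensor H ∘ₗ Coalgebra.comul =
        Algebra.linearMap k H ∘ₗ Coalgebra.counit := HopfAlgebra.mul_antipode_rTensor_comul
    rw [h1, Coalgebra.coassoc_symm_apply, ← LinearMap.rTensor_comp_apply, LinearMap.comp_assoc, h3,
      LinearMap.rTensor_comp_apply, Coalgebra.rTensor_counit_comul]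
    simp [j₂, i₂]
  have key : dS = s₂ * s₁ := by
    calc dS = (s₂ * j₂) * dS := by rw [hs₂, one_mul]
      _ = s₂ * (s₁ * (d * dS)) := by rw [← hs₁, mul_assoc, mul_assoc]
      _ = s₂ * s₁ := by rw [hd, mul_one]
  have h4 : ∀ t : H ⊗[k] H, LinearMap.mul' k (H ⊗[k] H) (TensorProduct.map s₂.ofConv s₁.ofConv t) =
      TensorProduct.map S S (TensorProduct.comm k H H t) := fun t => by
    induction t using TensorProduct.induction_on with
    | zero => simp
    | add a b ha hb => simp only [map_add, ha, hb]
    | tmul a b => simp [s₁, s₂, i₁, i₂]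
  have h5 : dS h = (s₂ * s₁) h := by rw [key]
  rw [LinearMap.convMul_apply, h4] at h5
  exact h5

/-- The identities for the inverse come from those of S, by applying the injective map S or by
inverting S ⊗ S. -/
theorem isAntipodePair (hS : Function.Bijective (HopfAlgebra.antipode k : H →ₗ[k] H)) :
    IsAntipodePair (HopfAlgebra.antipode k : H →ₗ[k] H)
      (LinearEquiv.ofBijective (HopfAlgebra.antipode k : H →ₗ[k] H) hS).symm.toLinearMap := by
  set E := LinearEquiv.ofBijective (HopfAlgebra.antipode k : H →ₗ[k] H) hS
  have hE : ∀ h, E h = HopfAlgebra.antipode k h := fun _ => rfl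
  have hEc : E.toLinearMap = HopfAlgebra.antipode k := rfl
  have left_inv : ∀ h, E.symm (HopfAlgebra.antipode k h) = h := E.symm_apply_apply
  have right_inv : ∀ h, HopfAlgebra.antipode k (E.symm h) = h := E.apply_symm_apply
  have comul_symm : ∀ h, Coalgebra.comul (R := k) (E.symm h) =
      TensorProduct.map E.symm.toLinearMap E.symm.toLinearMap (flipComul k H h) := fun h => by
    have h1 := comul_antipode (k := k) (E.symm h)
    rw [right_inv, ← hEc] at h1
    have h2 : ∀ t : H ⊗[k] H, TensorProduct.map E.symm.toLinearMap E.symm.toLinearMap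
        (TensorProduct.comm k H H (TensorProduct.map E.toLinearMap E.toLinearMap
          (TensorProduct.comm k H H t))) = t := fun t => by
      induction t using TensorProduct.induction_on with
      | zero => simp
      | add a b ha hb => simp only [map_add, ha, hb]
      | tmul a b => simp
    change _ = TensorProduct.map E.symm.toLinearMap E.symm.toLinearMap
        (TensorProduct.comm k H H (Coalgebra.comul (R := k) h))
    rw [h1]
    exact (h2 _).symm
  have mul_comm : ∀ t : H ⊗[k] H, HopfAlgebra.antipode k (LinearMap.mul' k H
      (E.symm.toLinearMap.rTensor H (TensorProduct.comm k H H t))) =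
      LinearMap.mul' k H ((HopfAlgebra.antipode k).rTensor H t) := fun t => by
    induction t using TensorProduct.induction_on with
    | zero => simp
    | add a b ha hb => simp only [map_add, ha, hb]
    | tmul a b => simp [HopfAlgebra.antipode_mul_antidistrib, right_inv]
  have mul_comm' : ∀ t : H ⊗[k] H, HopfAlgebra.antipode k (LinearMap.mul' k H
      (E.symm.toLinearMap.lTensor H (TensorProduct.comm k H H t))) =
      LinearMap.mul' k H ((HopfAlgebra.antipode k).lTensor H t) := fun t => by
    induction t using TensorProduct.induction_on with
    | zero => simp
    | add a b ha hb => simp only [map_add, ha, hb]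
    | tmul a b => simp [HopfAlgebra.antipode_mul_antidistrib, right_inv]
  have hmap : ∀ c : k, HopfAlgebra.antipode k (algebraMap k H c) = algebraMap k H c := fun c => by
    rw [Algebra.algebraMap_eq_smul_one, map_smul, HopfAlgebra.antipode_one]
  exact {
    left_inv := left_inv
    right_inv := right_inv
    map_mul := HopfAlgebra.antipode_mul_antidistrib
    map_mul_symm := fun g h => hS.1 (by
      rw [HopfAlgebra.antipode_mul_antidistrib]
      exact (right_inv _).trans (congrArg₂ (· * ·) (right_inv g) (right_inv h)).symm)
    comul_antipode := comul_antipode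
    comul_symm := comul_symm
    counit_antipode := HopfAlgebra.counit_antipode
    counit_symm := fun h => by
      rw [← HopfAlgebra.counit_antipode (R := k) (E.symm.toLinearMap h)]
      exact congrArg _ (right_inv h)
    antipode_mul := HopfAlgebra.mul_antipode_rTensor_comul_apply
    mul_antipode := HopfAlgebra.mul_antipode_lTensor_comul_apply
    symm_mul := fun h => hS.1 (by
      rw [hmap, ← HopfAlgebra.mul_antipode_rTensor_comul_apply]
      exact mul_comm _)
    mul_symm := fun h => hS.1 (by
      rw [hmap, ← HopfAlgebra.mul_antipode_lTensor_comul_apply]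
      exact mul_comm' _) }

end Hopf

/-! ### Co-opposite bialgebras -/

section CopBialgebra

variable {k H : Type u} [Field k] [Ring H]

instance : Ring (Cop H) := inferInstanceAs (Ring H)

instance [Algebra k H] : Algebra k (Cop H) := inferInstanceAs (Algebra k H)

variable [Bialgebra k H]

theorem flipComul_mul (g h : H) :
    flipComul k H (g * h) = flipComul k H g * flipComul k H h := by
  change Algebra.TensorProduct.comm k H H (Coalgebra.comul (R := k) (g * h)) =
    Algebra.TensorProduct.comm k H H (Coalgebra.comul (R := k) g) *
      Algebra.TensorProduct.comm k H H (Coalgebra.comul (R := k) h)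
  rw [Bialgebra.comul_mul, map_mul]

theorem flipComul_one : flipComul k H 1 = 1 := by
  change Algebra.TensorProduct.comm k H H (Coalgebra.comul (R := k) 1) = 1
  rw [Bialgebra.comul_one, map_one]

noncomputable instance : Bialgebra k (Cop H) :=
  Bialgebra.mk' k (Cop H) (Bialgebra.counit_one (R := k) (A := H))
    (fun {a b} => Bialgebra.counit_mul (R := k) (A := H) a b)
    (flipComul_one (k := k) (H := H)) (fun {a b} => flipComul_mul (k := k) (H := H) a b)

theorem flipComul_cop (h : H) : flipComul k (Cop H) h = Coalgebra.comul (R := k) (A := H) h :=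
  TensorProduct.comm_comm k H H (Coalgebra.comul (R := k) (A := H) h)

/-- Passing to the co-opposite bialgebra exchanges the antipode and its inverse. -/
theorem IsAntipodePair.cop {S T : H →ₗ[k] H} (h : IsAntipodePair S T) :
    IsAntipodePair (k := k) (H := Cop H) T S where
  left_inv := h.right_inv
  right_inv := h.left_inv
  map_mul := h.map_mul_symm
  map_mul_symm := h.map_mul
  comul_antipode x := by
    refine ((congrArg (TensorProduct.comm k H H) (h.comul_symm x)).trans ?_).trans
      (congrArg (TensorProduct.map T T) (flipComul_cop (H := H) x)).symm
    have h2 : ∀ t : H ⊗[k] H, TensorProduct.comm k H H (TensorProduct.map T T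
        (TensorProduct.comm k H H t)) = TensorProduct.map T T t := fun t => by
      rw [TensorProduct.map_comm, TensorProduct.comm_comm]
    exact h2 _
  comul_symm x := by
    refine ((congrArg (TensorProduct.comm k H H) (h.comul_antipode x)).trans ?_).trans
      (congrArg (TensorProduct.map S S) (flipComul_cop (H := H) x)).symm
    have h2 : ∀ t : H ⊗[k] H, TensorProduct.comm k H H (TensorProduct.map S S
        (TensorProduct.comm k H H t)) = TensorProduct.map S S t := fun t => by
      rw [TensorProduct.map_comm, TensorProduct.comm_comm]
    exact h2 _
  counit_antipode := h.counit_symm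
  counit_symm := h.counit_antipode
  antipode_mul := h.symm_mul
  mul_antipode := h.mul_symm
  symm_mul x := (congrArg (fun t => LinearMap.mul' k H (S.rTensor H t)) (flipComul_cop (H := H) x)).trans
    (h.antipode_mul x)
  mul_symm x := (congrArg (fun t => LinearMap.mul' k H (S.lTensor H t)) (flipComul_cop (H := H) x)).trans
    (h.mul_antipode x)

end CopBialgebra

/-! ### Coactions of bialgebras with bijective antipode -/

section Coaction

variable {k R H : Type u} [Field k] [Ring R] [Algebra k R] [Ring H] [Bialgebra k H]
  {S T : H →ₗ[k] H} {δ : R →ₐ[k] R ⊗[k] H}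

theorem IsRightCoaction.coassoc_apply {M C : Type u} [AddCommGroup M] [Module k M]
    [AddCommGroup C] [Module k C] [Coalgebra k C] {ρ : M →ₗ[k] M ⊗[k] C} (h : IsRightCoaction ρ)
    (m : M) : TensorProduct.assoc k M C C (ρ.rTensor C (ρ m)) =
      (Coalgebra.comul (R := k)).lTensor M (ρ m) :=
  LinearMap.congr_fun h.coassoc m

theorem IsRightCoaction.counit_apply {M C : Type u} [AddCommGroup M] [Module k M]
    [AddCommGroup C] [Module k C] [Coalgebra k C] {ρ : M →ₗ[k] M ⊗[k] C} (h : IsRightCoaction ρ)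
    (m : M) : (Coalgebra.counit (R := k)).lTensor M (ρ m) = m ⊗ₜ[k] 1 := by
  have h1 := LinearMap.congr_fun h.counit m
  simp only [LinearMap.comp_apply, LinearEquiv.coe_coe, LinearMap.id_apply] at h1
  rw [← (TensorProduct.rid k M).symm_apply_apply ((Coalgebra.counit (R := k)).lTensor M (ρ m)), h1,
    TensorProduct.rid_symm_apply]

/-- By coassociativity a₀ ⊗ m(a₁ ⊗ a₂) is a₀ ⊗ m(Δ(a₁)), and the counit collapses it. Antipode
cancellations inside a coaction go through this. -/
theorem lTensor_assoc_coaction (hδ : IsRightCoaction δ.toLinearMap) {X : Type u} [AddCommGroup X]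
    [Module k X] (m : H ⊗[k] H →ₗ[k] X) (x : X)
    (hm : ∀ h : H, m (Coalgebra.comul h) = Coalgebra.counit (R := k) h • x) (a : R) :
    m.lTensor R (TensorProduct.assoc k R H H (δ.toLinearMap.rTensor H (δ a))) = a ⊗ₜ[k] x := by
  have h1 : m ∘ₗ Coalgebra.comul = LinearMap.toSpanSingleton k X x ∘ₗ Coalgebra.counit :=
    LinearMap.ext fun h => hm h
  refine (congrArg _ (hδ.coassoc_apply a)).trans ?_
  rw [← LinearMap.lTensor_comp_apply, h1, LinearMap.lTensor_comp_apply, hδ.counit_apply]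
  simp

/-- The map `a ⊗ h ↦ δ(a) (1 ⊗ S(h))`. -/
def galoisTwist (δ : R →ₐ[k] R ⊗[k] H) (S : H →ₗ[k] H) : R ⊗[k] H →ₗ[k] R ⊗[k] H :=
  LinearMap.mul' k (R ⊗[k] H) ∘ₗ TensorProduct.map δ.toLinearMap
    ((Algebra.TensorProduct.includeRight : H →ₐ[k] R ⊗[k] H).toLinearMap ∘ₗ S)

theorem galoisTwist_tmul (a : R) (h : H) :
    galoisTwist δ S (a ⊗ₜ[k] h) = δ a * (1 ⊗ₜ[k] S h) := rfl

/-- The map `x ⊗ y ↦ δ(x) (y ⊗ 1)`. -/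
def twistedGaloisMap (δ : R →ₐ[k] R ⊗[k] H) : R ⊗[k] R →ₗ[k] R ⊗[k] H :=
  LinearMap.mul' k (R ⊗[k] H) ∘ₗ TensorProduct.map δ.toLinearMap
    (Algebra.TensorProduct.includeLeft : R →ₐ[k] R ⊗[k] H).toLinearMap

theorem twistedGaloisMap_tmul (x y : R) : twistedGaloisMap δ (x ⊗ₜ[k] y) = δ x * (y ⊗ₜ[k] 1) := rfl

theorem galoisTwist_coaction (hS : IsAntipodePair S T) (hδ : IsRightCoaction δ.toLinearMap)
    (a : R) : galoisTwist δ S (δ a) = a ⊗ₜ[k] 1 := by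
  rw [← lTensor_assoc_coaction hδ (LinearMap.mul' k H ∘ₗ S.lTensor H) 1 (fun h => by
    rw [LinearMap.comp_apply, hS.mul_antipode, Algebra.algebraMap_eq_smul_one])]
  generalize δ a = t
  induction t using TensorProduct.induction_on with
  | zero => simp
  | add a b ha hb => simp only [map_add, ha, hb]
  | tmul a h =>
    rw [galoisTwist_tmul, LinearMap.rTensor_tmul, AlgHom.toLinearMap_apply]
    induction δ a using TensorProduct.induction_on with
    | zero => simp
    | add a b ha hb => simp only [TensorProduct.add_tmul, add_mul, map_add, ha, hb]
    | tmul a g => simp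

theorem galoisTwist_mulLeft (x : R) (t : R ⊗[k] H) :
    galoisTwist δ S ((LinearMap.mulLeft k x).rTensor H t) = δ x * galoisTwist δ S t := by
  induction t using TensorProduct.induction_on with
  | zero => simp
  | add a b ha hb => simp only [map_add, ha, hb, mul_add]
  | tmul a h => simp [galoisTwist_tmul, mul_assoc]

/-- The twist sends δ(y) to y ⊗ 1, since a₁S(a₂) cancels, and turns left multiplication by x into
multiplication by δ(x). So the two forms of the Galois map differ by a bijection. -/
theorem galoisTwist_galoisMap (hS : IsAntipodePair S T) (hδ : IsRightCoaction δ.toLinearMap)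
    (t : R ⊗[k] R) : galoisTwist δ S (galoisMap δ.toLinearMap t) = twistedGaloisMap δ t := by
  induction t using TensorProduct.induction_on with
  | zero => simp
  | add a b ha hb => simp only [map_add, ha, hb]
  | tmul x y =>
    rw [galoisMap_tmul, galoisTwist_mulLeft, AlgHom.toLinearMap_apply, galoisTwist_coaction hS hδ,
      twistedGaloisMap_tmul]

/-- The inverse is a ⊗ h ↦ (1 ⊗ T(h))δ(a), which is where the inverse of the antipode is needed. -/
theorem galoisTwist_bijective (hS : IsAntipodePair S T) (hδ : IsRightCoaction δ.toLinearMap) :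
    Function.Bijective (galoisTwist δ S) := by
  let Φ' : R ⊗[k] H →ₗ[k] R ⊗[k] H := LinearMap.mul' k (R ⊗[k] H) ∘ₗ
    TensorProduct.map ((Algebra.TensorProduct.includeRight : H →ₐ[k] R ⊗[k] H).toLinearMap ∘ₗ T)
      δ.toLinearMap ∘ₗ (TensorProduct.comm k R H).toLinearMap
  have hΦ' : ∀ (a : R) (h : H), Φ' (a ⊗ₜ[k] h) = (1 ⊗ₜ[k] T h) * δ a := fun _ _ => rfl
  have h1 : ∀ (x : H) (t : R ⊗[k] H), galoisTwist δ S ((1 ⊗ₜ[k] x) * t) =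
      galoisTwist δ S t * (1 ⊗ₜ[k] S x) := fun x t => by
    induction t using TensorProduct.induction_on with
    | zero => simp
    | add a b ha hb => simp only [map_add, ha, hb, mul_add, add_mul]
    | tmul a h =>
      rw [Algebra.TensorProduct.tmul_mul_tmul, one_mul, galoisTwist_tmul, galoisTwist_tmul,
        mul_assoc, Algebra.TensorProduct.tmul_mul_tmul, one_mul, hS.map_mul]
  have h2 : ∀ (x : H) (t : R ⊗[k] H), Φ' (t * (1 ⊗ₜ[k] x)) = (1 ⊗ₜ[k] T x) * Φ' t := fun x t => by
    induction t using TensorProduct.induction_on with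
    | zero => simp
    | add a b ha hb => simp only [map_add, ha, hb, mul_add, add_mul]
    | tmul a h =>
      rw [Algebra.TensorProduct.tmul_mul_tmul, mul_one, hΦ', hΦ', ← mul_assoc,
        Algebra.TensorProduct.tmul_mul_tmul, one_mul, hS.map_mul_symm]
  have h3 : ∀ a : R, Φ' (δ a) = a ⊗ₜ[k] 1 := fun a => by
    rw [← lTensor_assoc_coaction hδ (LinearMap.mul' k H ∘ₗ T.rTensor H ∘ₗ
      (TensorProduct.comm k H H).toLinearMap) 1 (fun h =>
        (hS.symm_mul h).trans (Algebra.algebraMap_eq_smul_one _))]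
    generalize δ a = t
    induction t using TensorProduct.induction_on with
    | zero => simp
    | add a b ha hb => simp only [map_add, ha, hb]
    | tmul a h =>
      rw [hΦ', LinearMap.rTensor_tmul, AlgHom.toLinearMap_apply]
      induction δ a using TensorProduct.induction_on with
      | zero => simp
      | add a b ha hb => simp only [TensorProduct.add_tmul, mul_add, map_add, ha, hb]
      | tmul a g => simp
  refine Function.bijective_iff_has_inverse.2 ⟨Φ', fun t => ?_, fun t => ?_⟩
  · induction t using TensorProduct.induction_on with
    | zero => simp
    | add a b ha hb => simp only [map_add, ha, hb]
    | tmul a h =>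
      rw [galoisTwist_tmul, h2, h3, hS.left_inv]
      simp
  · induction t using TensorProduct.induction_on with
    | zero => simp
    | add a b ha hb => simp only [map_add, ha, hb]
    | tmul a h =>
      rw [hΦ', h1, galoisTwist_coaction hS hδ, hS.right_inv]
      simp

/-- `(1 ⊗ g₁) Δ(S(g₂)) = S(g) ⊗ 1`. -/
theorem mul_comul_antipode (hS : IsAntipodePair S T) (g : H) :
    LinearMap.mul' k (H ⊗[k] H) (TensorProduct.map
      (Algebra.TensorProduct.includeRight : H →ₐ[k] H ⊗[k] H).toLinearMap
      (Coalgebra.comul ∘ₗ S) (Coalgebra.comul (R := k) g)) = S g ⊗ₜ[k] 1 := by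
  let J : H ⊗[k] (H ⊗[k] H) →ₗ[k] H ⊗[k] H :=
    TensorProduct.map S (LinearMap.mul' k H ∘ₗ S.lTensor H) ∘ₗ
      (TensorProduct.comm k (H ⊗[k] H) H).toLinearMap ∘ₗ
      (TensorProduct.assoc k H H H).symm.toLinearMap
  have h1 : ∀ t : H ⊗[k] H, LinearMap.mul' k (H ⊗[k] H) (TensorProduct.map
      (Algebra.TensorProduct.includeRight : H →ₐ[k] H ⊗[k] H).toLinearMap
      (Coalgebra.comul ∘ₗ S) t) = J ((Coalgebra.comul (R := k)).lTensor H t) := fun t => by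
    induction t using TensorProduct.induction_on with
    | zero => simp
    | add a b ha hb => simp only [map_add, ha, hb]
    | tmul x y =>
      have h2 : ∀ w : H ⊗[k] H, ((1 : H) ⊗ₜ[k] x) * TensorProduct.map S S
          (TensorProduct.comm k H H w) = J (x ⊗ₜ[k] w) := fun w => by
        induction w using TensorProduct.induction_on with
        | zero => simp
        | add a b ha hb => simp only [TensorProduct.tmul_add, mul_add, map_add, ha, hb]
        | tmul a b => simp [J]
      rw [TensorProduct.map_tmul, LinearMap.comp_apply, hS.comul_antipode]
      exact h2 _
  have h3 : ∀ t : H ⊗[k] H, J (TensorProduct.assoc k H H H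
      ((Coalgebra.comul (R := k)).rTensor H t)) =
      TensorProduct.map S (Algebra.linearMap k H) (TensorProduct.comm k k H
        ((Coalgebra.counit (R := k)).rTensor H t)) := fun t => by
    induction t using TensorProduct.induction_on with
    | zero => simp
    | add a b ha hb => simp only [map_add, ha, hb]
    | tmul x y =>
      have h2 : ∀ w : H ⊗[k] H, J (TensorProduct.assoc k H H H (w ⊗ₜ[k] y)) =
          S y ⊗ₜ[k] LinearMap.mul' k H (S.lTensor H w) := fun w => by simp [J]
      rw [LinearMap.rTensor_tmul, h2, hS.mul_antipode]
      simp
  rw [h1, ← Coalgebra.coassoc_apply, h3, Coalgebra.rTensor_counit_comul]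
  simp

end Coaction

/-! ### Hopf modules over a quotient -/

section Quotient

variable {k R H C : Type u} [Field k] [Ring R] [Algebra k R] [Ring H] [Bialgebra k H]
  [AddCommGroup C] [Module k C] [Coalgebra k C]

/-- `π : H → C` is a map of coalgebras and of right `H`-modules for the action `act`. -/
structure IsModuleQuotient (π : H →ₗ[k] C) (act : H →ₗ[k] Module.End k C) : Prop where
  comul_apply : ∀ h, Coalgebra.comul (R := k) (π h) =
    TensorProduct.map π π (Coalgebra.comul (R := k) h)
  counit_apply : ∀ h, Coalgebra.counit (R := k) (π h) = Coalgebra.counit (R := k) h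
  act_apply : ∀ g h, act g (π h) = π (h * g)

/-- The map `a ↦ a₀ ⊗ T(a₁)`, where the second factor acts on the quotient. -/
def quotAct (δ : R →ₐ[k] R ⊗[k] H) (T : H →ₗ[k] H) (act : H →ₗ[k] Module.End k C) :
    R →ₗ[k] R ⊗[k] Module.End k C :=
  (act ∘ₗ T).lTensor R ∘ₗ δ.toLinearMap

/-- The coaction `a ↦ π(T(a₁)) ⊗ a₀`. -/
def quotCoact (δ : R →ₐ[k] R ⊗[k] H) (T : H →ₗ[k] H) (π : H →ₗ[k] C) : R →ₗ[k] C ⊗[k] R :=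
  (TensorProduct.comm k R C).toLinearMap ∘ₗ (π ∘ₗ T).lTensor R ∘ₗ δ.toLinearMap

/-- The coaction `h ↦ h₁ ⊗ π(h₂)`. -/
def regularCoact (π : H →ₗ[k] C) : H →ₗ[k] H ⊗[k] C := π.lTensor H ∘ₗ Coalgebra.comul

variable {S T : H →ₗ[k] H} {δ : R →ₐ[k] R ⊗[k] H} {π : H →ₗ[k] C} {act : H →ₗ[k] Module.End k C}

/-- T reverses comultiplication, so a right coaction becomes a left one. It also reverses products,
so ρ(ab) = π(T(b₁)T(a₁)) ⊗ a₀b₀ involves only the right action of H on C. -/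
theorem isHopfModule_quotCoact (hS : IsAntipodePair S T) (hδ : IsRightCoaction δ.toLinearMap)
    (hπ : IsModuleQuotient π act) : IsHopfModule (quotAct δ T act) (quotCoact δ T π) where
  isLeftCoaction := by
    refine ⟨LinearMap.ext fun a => ?_, LinearMap.ext fun a => ?_⟩
    · let P : R ⊗[k] (H ⊗[k] H) →ₗ[k] C ⊗[k] (C ⊗[k] R) :=
        (TensorProduct.assoc k C C R).toLinearMap ∘ₗ
        (TensorProduct.comm k R (C ⊗[k] C)).toLinearMap ∘ₗ
        (TensorProduct.map (π ∘ₗ T) (π ∘ₗ T) ∘ₗ (TensorProduct.comm k H H).toLinearMap).lTensor R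
      have h1 : ∀ t : R ⊗[k] H, (quotCoact δ T π).lTensor C
          (TensorProduct.comm k R C ((π ∘ₗ T).lTensor R t)) =
          P (TensorProduct.assoc k R H H (δ.toLinearMap.rTensor H t)) := fun t => by
        induction t using TensorProduct.induction_on with
        | zero => simp
        | add a b ha hb => simp only [map_add, ha, hb]
        | tmul a h =>
          simp only [LinearMap.lTensor_tmul, TensorProduct.comm_tmul, LinearMap.rTensor_tmul,
            quotCoact, LinearMap.comp_apply, LinearEquiv.coe_coe]
          induction δ.toLinearMap a using TensorProduct.induction_on with
          | zero => simp
          | add a b ha hb =>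
            simp only [TensorProduct.add_tmul, TensorProduct.tmul_add, map_add, ha, hb]
          | tmul a g => simp [P]
      have h2 : ∀ t : R ⊗[k] H, TensorProduct.assoc k C C R
          ((Coalgebra.comul (R := k)).rTensor R (TensorProduct.comm k R C
            ((π ∘ₗ T).lTensor R t))) = P ((Coalgebra.comul (R := k)).lTensor R t) := fun t => by
        induction t using TensorProduct.induction_on with
        | zero => simp
        | add a b ha hb => simp only [map_add, ha, hb]
        | tmul a h =>
          simp only [LinearMap.lTensor_tmul, TensorProduct.comm_tmul, LinearMap.rTensor_tmul,
            LinearMap.comp_apply, hπ.comul_apply, hS.comul_symm, LinearEquiv.coe_coe, P,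
            flipComul, ← TensorProduct.map_map]
      exact (h1 _).trans ((congrArg P (hδ.coassoc_apply a)).trans (h2 _).symm)
    · have h1 : ∀ t : R ⊗[k] H, TensorProduct.lid k R ((Coalgebra.counit (R := k)).rTensor R
          (TensorProduct.comm k R C ((π ∘ₗ T).lTensor R t))) =
          TensorProduct.rid k R ((Coalgebra.counit (R := k)).lTensor R t) := fun t => by
        induction t using TensorProduct.induction_on with
        | zero => simp
        | add a b ha hb => simp only [map_add, ha, hb]
        | tmul a h => simp [hπ.counit_apply, hS.counit_symm]
      exact (h1 _).trans (LinearMap.congr_fun hδ.counit a)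
  map_smul a b := by
    have h1 : ∀ s t : R ⊗[k] H, TensorProduct.comm k R C ((π ∘ₗ T).lTensor R (s * t)) =
        tensorAct R ((act ∘ₗ T).lTensor R s)
          (TensorProduct.comm k R C ((π ∘ₗ T).lTensor R t)) := fun s t => by
      induction s using TensorProduct.induction_on with
      | zero => simp
      | add a b ha hb => simp only [add_mul, map_add, ha, hb, LinearMap.add_apply]
      | tmul a g =>
        induction t using TensorProduct.induction_on with
        | zero => simp
        | add a b ha hb => simp only [mul_add, map_add, ha, hb]
        | tmul b h =>
          simp [tensorAct_tmul_apply, hπ.act_apply, hS.map_mul_symm]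
    change TensorProduct.comm k R C ((π ∘ₗ T).lTensor R (δ (a * b))) = _
    rw [map_mul, h1]
    rfl

/-- The assumption gives a₀ ⊗ a₁ ⊗ π(V(a₂)) = a₀ ⊗ a₁ ⊗ π(1). Acting by U(a₁) on the last factor,
the left side collapses through V(a₂)U(a₁), and the right side becomes a₀ ⊗ π(U(a₁)). -/
theorem lTensor_coaction_of_eq (hδ : IsRightCoaction δ.toLinearMap)
    (hπ : IsModuleQuotient π act) {U V : H →ₗ[k] H}
    (hUV : ∀ h, LinearMap.mul' k H (TensorProduct.map V U (flipComul k H h)) =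
      algebraMap k H (Coalgebra.counit h)) {a : R}
    (ha : (π ∘ₗ V).lTensor R (δ a) = a ⊗ₜ[k] π 1) :
    (π ∘ₗ U).lTensor R (δ a) = a ⊗ₜ[k] π 1 := by
  let m : H ⊗[k] H →ₗ[k] C := TensorProduct.lift (act ∘ₗ U) ∘ₗ (π ∘ₗ V).lTensor H
  have hm : ∀ t, m t = π (LinearMap.mul' k H (TensorProduct.map V U
      (TensorProduct.comm k H H t))) := fun t => by
    induction t using TensorProduct.induction_on with
    | zero => simp
    | add a b ha hb => simp only [map_add, ha, hb]
    | tmul g h => simp [m, hπ.act_apply]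
  rw [← lTensor_assoc_coaction hδ m (π 1) (fun h => by
    rw [hm]
    refine (congrArg π (hUV h)).trans ?_
    rw [Algebra.algebraMap_eq_smul_one, map_smul])]
  have h1 : ∀ t : R ⊗[k] H, m.lTensor R (TensorProduct.assoc k R H H
      (δ.toLinearMap.rTensor H t)) = (TensorProduct.lift (act ∘ₗ U)).lTensor R
        (TensorProduct.assoc k R H C (δ.toLinearMap.rTensor C ((π ∘ₗ V).lTensor R t))) :=
      fun t => by
    induction t using TensorProduct.induction_on with
    | zero => simp
    | add a b ha hb => simp only [map_add, ha, hb]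
    | tmul b h =>
      simp only [LinearMap.lTensor_tmul, LinearMap.rTensor_tmul]
      induction δ.toLinearMap b using TensorProduct.induction_on with
      | zero => simp
      | add a b ha hb => simp only [TensorProduct.add_tmul, map_add, ha, hb]
      | tmul b g => simp [m]
  rw [h1, ha, LinearMap.rTensor_tmul, AlgHom.toLinearMap_apply]
  induction δ a using TensorProduct.induction_on with
  | zero => simp
  | add a b ha hb => simp only [TensorProduct.add_tmul, map_add, ha, hb]
  | tmul b g => simp [hπ.act_apply]

theorem quotCoact_eq_iff (hS : IsAntipodePair S T) (hδ : IsRightCoaction δ.toLinearMap)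
    (hπ : IsModuleQuotient π act) (a : R) :
    quotCoact δ T π a = π 1 ⊗ₜ[k] a ↔ π.lTensor R (δ a) = a ⊗ₜ[k] π 1 := by
  have h1 : quotCoact δ T π a = π 1 ⊗ₜ[k] a ↔ (π ∘ₗ T).lTensor R (δ a) = a ⊗ₜ[k] π 1 :=
    ((TensorProduct.comm k R C).injective.eq_iff (a := (π ∘ₗ T).lTensor R (δ a))
      (b := a ⊗ₜ[k] π 1))
  rw [h1]
  constructor
  · intro h
    exact lTensor_coaction_of_eq hδ hπ (U := LinearMap.id) (V := T)
      (fun h => hS.symm_mul h) h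
  · intro h
    exact lTensor_coaction_of_eq hδ hπ (U := T) (V := LinearMap.id)
      (fun h => hS.mul_symm h) h

end Quotient

/-! ### From Galois extensions and integrals to descent data -/

section Descent

variable {k R H C : Type u} [Field k] [Ring R] [Algebra k R] [Ring H] [Bialgebra k H]
  [AddCommGroup C] [Module k C] [Coalgebra k C]
  {S T : H →ₗ[k] H} {δ : R →ₐ[k] R ⊗[k] H} {π : H →ₗ[k] C} {act : H →ₗ[k] Module.End k C}

/-! ### Coinvariants from colinear maps -/

section Eval

variable {M : Type u} [AddCommGroup M] [Module k M] [Module R M] [IsScalarTower k R M]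

/-- The map `h ⊗ c ⊗ m ↦ c T(h₂) ⊗ ψ(h₁) m`. -/
def twistedEval (M : Type u) [AddCommGroup M] [Module k M] [Module R M] [IsScalarTower k R M]
    (T : H →ₗ[k] H) (act : H →ₗ[k] Module.End k C) (ψ : H →ₗ[k] R) :
    H ⊗[k] (C ⊗[k] M) →ₗ[k] C ⊗[k] M :=
  TensorProduct.lift (tensorAct M ∘ₗ TensorProduct.map ψ (act ∘ₗ T) ∘ₗ Coalgebra.comul)

/-- On h₁ ⊗ π(h₂) ⊗ m the value is π(h₃T(h₂)) ⊗ ψ(h₁)m, where h₃T(h₂) cancels. -/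
theorem twistedEval_cotensor (hS : IsAntipodePair S T) (hπ : IsModuleQuotient π act)
    (ψ : H →ₗ[k] R) (t : H ⊗[k] M) :
    twistedEval M T act ψ (TensorProduct.assoc k H C M ((regularCoact π).rTensor M t)) =
      π 1 ⊗ₜ[k] evalMap M ψ t := by
  induction t using TensorProduct.induction_on with
  | zero => simp
  | add a b ha hb => simp only [map_add, ha, hb, TensorProduct.tmul_add]
  | tmul h m =>
    let G : H ⊗[k] (H ⊗[k] H) →ₗ[k] C ⊗[k] M := (TensorProduct.comm k M C).toLinearMap ∘ₗ
      TensorProduct.map ((LinearMap.toSpanSingleton R M m).restrictScalars k ∘ₗ ψ)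
        (π ∘ₗ LinearMap.mul' k H ∘ₗ T.lTensor H ∘ₗ (TensorProduct.comm k H H).toLinearMap)
    have h1 : ∀ s : H ⊗[k] H, twistedEval M T act ψ
        (TensorProduct.assoc k H C M (π.lTensor H s ⊗ₜ[k] m)) =
        G (TensorProduct.assoc k H H H ((Coalgebra.comul (R := k)).rTensor H s)) := fun s => by
      induction s using TensorProduct.induction_on with
      | zero => simp
      | add a b ha hb => simp only [TensorProduct.add_tmul, map_add, ha, hb]
      | tmul g h =>
        rw [LinearMap.lTensor_tmul, TensorProduct.assoc_tmul, LinearMap.rTensor_tmul]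
        change tensorAct M (TensorProduct.map ψ (act ∘ₗ T) (Coalgebra.comul (R := k) g))
          (π h ⊗ₜ[k] m) = _
        induction Coalgebra.comul (R := k) g using TensorProduct.induction_on with
        | zero => simp
        | add a b ha hb =>
          simp only [TensorProduct.add_tmul, map_add, ha, hb, LinearMap.add_apply]
        | tmul a b => simp [G, tensorAct_tmul_apply, hπ.act_apply]
    have h2 : ∀ s : H ⊗[k] H, G ((Coalgebra.comul (R := k)).lTensor H s) =
        TensorProduct.comm k M C (TensorProduct.map
          ((LinearMap.toSpanSingleton R M m).restrictScalars k ∘ₗ ψ)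
          (π ∘ₗ Algebra.linearMap k H) ((Coalgebra.counit (R := k)).lTensor H s)) := fun s => by
      induction s using TensorProduct.induction_on with
      | zero => simp
      | add a b ha hb => simp only [map_add, ha, hb]
      | tmul g h =>
        have h3 := hS.mul_symm h
        simp only [flipComul, LinearMap.comp_apply, LinearEquiv.coe_coe] at h3
        simp [G, h3]
    rw [LinearMap.rTensor_tmul, evalMap_tmul]
    refine (h1 _).trans ?_
    rw [Coalgebra.coassoc_apply, h2, Coalgebra.lTensor_counit_comul]
    simp

theorem coaction_evalMap_tmul {ρ : M →ₗ[k] C ⊗[k] M} (hρ : IsHopfModule (quotAct δ T act) ρ)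
    {ψ : H →ₗ[k] R} {h : H} (hψ : IsColinearAt δ.toLinearMap ψ h) (m : M) :
    ρ (evalMap M ψ (h ⊗ₜ[k] m)) = twistedEval M T act ψ (ρ.lTensor H (h ⊗ₜ[k] m)) := by
  rw [evalMap_tmul, hρ.map_smul]
  change tensorAct M ((act ∘ₗ T).lTensor R (δ.toLinearMap (ψ h))) (ρ m) =
    tensorAct M (TensorProduct.map ψ (act ∘ₗ T) (Coalgebra.comul (R := k) h)) (ρ m)
  rw [hψ, ← LinearMap.comp_apply (LinearMap.lTensor _ _), LinearMap.lTensor_comp_rTensor]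

/-- If ψ is colinear at the elements of H occurring in t, then ρ(ψ(h)m) is `twistedEval` of h ⊗
ρ(m). On the cotensor product this may be computed from h₁ ⊗ π(h₂) ⊗ m instead, which gives π(1) ⊗
ψ(h)m. -/
theorem eventually_coinvariant (hS : IsAntipodePair S T) (hπ : IsModuleQuotient π act)
    {ρ : M →ₗ[k] C ⊗[k] M} (hρ : IsHopfModule (quotAct δ T act) ρ) {ι : Type*} {l : Filter ι}
    {ψ : ι → H →ₗ[k] R} (hψ : ∀ h, ∀ᶠ i in l, IsColinearAt δ.toLinearMap (ψ i) h)
    {t : H ⊗[k] M} (ht : t ∈ cotensor (regularCoact π) ρ) :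
    ∀ᶠ i in l, ρ (evalMap M (ψ i) t) = π 1 ⊗ₜ[k] evalMap M (ψ i) t := by
  have h1 : ∀ t : H ⊗[k] M, ∀ᶠ i in l,
      ρ (evalMap M (ψ i) t) = twistedEval M T act (ψ i) (ρ.lTensor H t) := fun t => by
    induction t using TensorProduct.induction_on with
    | zero => simp
    | add a b ha hb =>
      filter_upwards [ha, hb] with i h1 h2
      simp only [map_add, h1, h2]
    | tmul h m =>
      filter_upwards [hψ h] with i hi
      exact coaction_evalMap_tmul hρ hi m
  filter_upwards [h1 t] with i hi
  rw [hi, ← twistedEval_cotensor hS hπ]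
  exact congrArg _ (show _ = _ from ht).symm

end Eval

/-! ### Twisting colinear maps by the antipode -/

/-- The map `a ⊗ g ↦ (h ↦ a φ(S(g) h))`. -/
def antipodeTwist (S : H →ₗ[k] H) (φ : H →ₗ[k] R) : R ⊗[k] H →ₗ[k] (H →ₗ[k] R) :=
  TensorProduct.lift (LinearMap.mk₂ k
    (fun a g => LinearMap.mulLeft k a ∘ₗ φ ∘ₗ LinearMap.mulLeft k (S g))
    (fun a b g => by ext; simp [add_mul]) (fun c a g => by ext; simp)
    (fun a g h => by ext; simp [add_mul, mul_add]) (fun c a g => by ext; simp))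

theorem antipodeTwist_tmul (φ : H →ₗ[k] R) (a : R) (g h : H) :
    antipodeTwist S φ (a ⊗ₜ[k] g) h = a * φ (S g * h) := rfl

theorem antipodeTwist_mulLeft (φ : H →ₗ[k] R) (x : R) (t : R ⊗[k] H) :
    antipodeTwist S φ ((LinearMap.mulLeft k x).rTensor H t) =
      LinearMap.mulLeft k x ∘ₗ antipodeTwist S φ t := by
  induction t using TensorProduct.induction_on with
  | zero => simp
  | add a b ha hb => simp only [map_add, ha, hb, LinearMap.comp_add]
  | tmul a g =>
    ext h
    simp [antipodeTwist_tmul, mul_assoc]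

/-- The coaction of y₀φ(S(y₁)h) is y₀φ(S(y₃)h₁) ⊗ y₁S(y₂)h₂, and y₁S(y₂) cancels. Colinearity of φ
is used at S(g)h for the finitely many g occurring in δ(y). -/
theorem eventually_isColinearAt_antipodeTwist (hS : IsAntipodePair S T)
    (hδ : IsRightCoaction δ.toLinearMap) {ι : Type*} {l : Filter ι}
    {φ : ι → H →ₗ[k] R} (hφ : ∀ h, ∀ᶠ i in l, IsColinearAt δ.toLinearMap (φ i) h) (y : R) (h : H) :
    ∀ᶠ i in l, IsColinearAt δ.toLinearMap (antipodeTwist S (φ i) (δ y)) h := by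
  let N : (H →ₗ[k] R) → (R ⊗[k] H) ⊗[k] H →ₗ[k] R ⊗[k] H := fun φ =>
    LinearMap.mul' k (R ⊗[k] H) ∘ₗ
      (φ.rTensor H ∘ₗ Coalgebra.comul ∘ₗ LinearMap.mulRight k h ∘ₗ S).lTensor (R ⊗[k] H)
  have hN : ∀ φ w g, N φ (w ⊗ₜ[k] g) =
      w * φ.rTensor H (Coalgebra.comul (R := k) (S g) * Coalgebra.comul (R := k) h) :=
    fun φ w g => by
      rw [← Bialgebra.comul_mul]
      rfl
  have h1 : ∀ t : R ⊗[k] H, ∀ᶠ i in l, δ (antipodeTwist S (φ i) t h) =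
      N (φ i) (δ.toLinearMap.rTensor H t) := fun t => by
    induction t using TensorProduct.induction_on with
    | zero => simp
    | add a b ha hb =>
      filter_upwards [ha, hb] with i h1 h2
      simp only [map_add, h1, h2, LinearMap.add_apply]
    | tmul a g =>
      filter_upwards [hφ (S g * h)] with i hi
      rw [antipodeTwist_tmul, map_mul, LinearMap.rTensor_tmul, hN, ← Bialgebra.comul_mul]
      exact congrArg _ hi
  have h2 : ∀ (φ : H →ₗ[k] R) (t : R ⊗[k] H), N φ ((TensorProduct.assoc k R H H).symm
      ((Coalgebra.comul (R := k)).lTensor R t)) =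
      (antipodeTwist S φ t).rTensor H (Coalgebra.comul (R := k) h) := fun φ t => by
    induction t using TensorProduct.induction_on with
    | zero => simp
    | add a b ha hb => simp only [map_add, ha, hb, LinearMap.rTensor_add, LinearMap.add_apply]
    | tmul a g =>
      have h3 : ∀ s : H ⊗[k] H, N φ ((TensorProduct.assoc k R H H).symm (a ⊗ₜ[k] s)) =
          (LinearMap.mulLeft k a ∘ₗ φ).rTensor H (LinearMap.mul' k (H ⊗[k] H) (TensorProduct.map
            (Algebra.TensorProduct.includeRight : H →ₐ[k] H ⊗[k] H).toLinearMap
            (Coalgebra.comul ∘ₗ S) s) * Coalgebra.comul (R := k) h) := fun s => by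
        induction s using TensorProduct.induction_on with
        | zero => simp
        | add a b ha hb => simp only [TensorProduct.tmul_add, map_add, ha, hb, add_mul]
        | tmul x y =>
          rw [TensorProduct.assoc_symm_tmul, hN, TensorProduct.map_tmul, LinearMap.mul'_apply,
            mul_assoc, LinearMap.comp_apply]
          generalize Coalgebra.comul (R := k) (S y) * Coalgebra.comul (R := k) h = w
          induction w using TensorProduct.induction_on with
          | zero => simp
          | add a b ha hb => simp only [map_add, mul_add, ha, hb]
          | tmul b g => simp
      rw [LinearMap.lTensor_tmul, h3, mul_comul_antipode hS]
      generalize Coalgebra.comul (R := k) h = w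
      induction w using TensorProduct.induction_on with
      | zero => simp
      | add a b ha hb => simp only [map_add, mul_add, ha, hb]
      | tmul b g' => simp [antipodeTwist_tmul]
  filter_upwards [h1 (δ y)] with i hi
  refine hi.trans ?_
  rw [← h2, ← AlgHom.toLinearMap_apply δ y, ← hδ.coassoc_apply, LinearEquiv.symm_apply_apply]

/-! ### The descent datum of an admissible quotient -/

/-- The filter of normalised maps that are colinear on larger and larger finite sets. -/
def colinearFilter (δ : R →ₐ[k] R ⊗[k] H) : Filter (H →ₗ[k] R) :=
  ⨅ h : H, Filter.principal {φ | φ 1 = 1 ∧ IsColinearAt δ.toLinearMap φ h}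

theorem colinearFilter_neBot (hint : ∀ s : Finset H, ∃ φ : H →ₗ[k] R,
    φ 1 = 1 ∧ ∀ h ∈ s, IsColinearAt δ.toLinearMap φ h) : (colinearFilter δ).NeBot := by
  refine (Filter.hasBasis_iInf_principal_finite _).neBot_iff.2 fun {s} hs => ?_
  obtain ⟨φ, h1, h2⟩ := hint hs.toFinset
  exact ⟨φ, Set.mem_iInter₂.2 fun h hh => ⟨h1, h2 h (hs.mem_toFinset.2 hh)⟩⟩

theorem eventually_colinearFilter (h : H) :
    ∀ᶠ φ in colinearFilter δ, φ 1 = 1 ∧ IsColinearAt δ.toLinearMap φ h :=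
  Filter.mem_iInf_of_mem h (Filter.mem_principal_self _)

theorem isDescentDatum_quotCoact (hS : IsAntipodePair S T) (hδ : IsRightCoaction δ.toLinearMap)
    (hsurj : Function.Surjective (galoisMap δ.toLinearMap))
    (hint : ∀ s : Finset H, ∃ φ : H →ₗ[k] R,
      φ 1 = 1 ∧ ∀ h ∈ s, IsColinearAt δ.toLinearMap φ h)
    (hπ : IsModuleQuotient π act)
    (hr : IsHopfCoflat (quotAct δ T act) (regularCoact π)) {B : Subalgebra k R}
    (hB : ∀ b, b ∈ B ↔ π.lTensor R (δ b) = b ⊗ₜ[k] π 1) :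
    IsDescentDatum (quotAct δ T act) (π 1) (quotCoact δ T π) B := by
  have := colinearFilter_neBot hint
  have hcol : ∀ h, ∀ᶠ φ in colinearFilter δ, IsColinearAt δ.toLinearMap φ h :=
    fun h => (eventually_colinearFilter h).mono fun _ h => h.2
  have hone : ∀ᶠ φ in colinearFilter δ, φ 1 = 1 :=
    (eventually_colinearFilter 1).mono fun _ h => h.1
  refine
    { isHopfModule := isHopfModule_quotCoact hS hδ hπ
      mem_iff := fun r => (hB r).trans (quotCoact_eq_iff hS hδ hπ r).symm
      counit_eq_one := by rw [hπ.counit_apply, Bialgebra.counit_one]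
      lifts := hr.liftsCoinvariants (one := 1) (l := colinearFilter δ) ?_ id hone
        fun M _ _ _ _ ρ hρ t ht => eventually_coinvariant hS hπ hρ hcol ht
      detects := hr.detectsZero (Δ := Coalgebra.comul) (ε := Coalgebra.counit)
        (l := colinearFilter δ) ?_ Coalgebra.lTensor_counit_comul
        (fun φ => antipodeTwist S φ ∘ₗ TensorProduct.mk k R H 1) ?_ ?_ }
  · change π.lTensor H (Coalgebra.comul (R := k) 1) = _
    rw [Bialgebra.comul_one, Algebra.TensorProduct.one_def, LinearMap.lTensor_tmul]
  · ext h
    have h1 : ∀ t : H ⊗[k] H, TensorProduct.assoc k H H C ((Coalgebra.comul (R := k)).rTensor C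
        (π.lTensor H t)) = (π.lTensor H).lTensor H (TensorProduct.assoc k H H H
          ((Coalgebra.comul (R := k)).rTensor H t)) := fun t => by
      induction t using TensorProduct.induction_on with
      | zero => simp
      | add a b ha hb => simp only [map_add, ha, hb]
      | tmul a b =>
        simp only [LinearMap.lTensor_tmul, LinearMap.rTensor_tmul]
        induction Coalgebra.comul (R := k) a using TensorProduct.induction_on with
        | zero => simp
        | add a b ha hb => simp only [TensorProduct.add_tmul, map_add, ha, hb]
        | tmul x y => simp
    refine (h1 _).trans ?_
    rw [Coalgebra.coassoc_apply, ← LinearMap.lTensor_comp_apply]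
    rfl
  -- Here κ(g) is h ↦ φ(S(g)h), so κ(h₁)(h₂) = φ(S(h₁)h₂) = ε(h)φ(1).
  · filter_upwards [hone] with φ hφ h
    have h1 : ∀ t : H ⊗[k] H, TensorProduct.lift (antipodeTwist S φ ∘ₗ TensorProduct.mk k R H 1) t =
        φ (LinearMap.mul' k H (S.rTensor H t)) := fun t => by
      induction t using TensorProduct.induction_on with
      | zero => simp
      | add a b ha hb => simp only [map_add, ha, hb]
      | tmul a b => simp [antipodeTwist_tmul]
    rw [h1, hS.antipode_mul, Algebra.algebraMap_eq_smul_one, map_smul, hφ,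
      Algebra.algebraMap_eq_smul_one]
  -- Write 1 ⊗ g = Σ xy₀ ⊗ y₁. Then φ(S(g)h) is the sum of x·y₀φ(S(y₁)h), and each map h ↦
  -- y₀φ(S(y₁)h) is eventually colinear at the relevant elements, so it evaluates t to a coinvariant
  -- of M, which is zero.
  · intro M _ _ _ _ ρ hρ hM g t ht
    have h1 : ∀ z : R ⊗[k] R, ∀ᶠ φ in colinearFilter δ,
        evalMap M (antipodeTwist S φ (galoisMap δ.toLinearMap z)) t = 0 := fun z => by
      induction z using TensorProduct.induction_on with
      | zero => simp [evalMap_zero]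
      | add a b ha hb =>
        filter_upwards [ha, hb] with φ h1 h2
        rw [map_add, map_add, evalMap_add, h1, h2, add_zero]
      | tmul x y =>
        filter_upwards [eventually_coinvariant hS hπ hρ
          (eventually_isColinearAt_antipodeTwist hS hδ hcol y) ht] with φ hφ
        rw [galoisMap_tmul, antipodeTwist_mulLeft, evalMap_smul, AlgHom.toLinearMap_apply,
          hM _ hφ, smul_zero]
    obtain ⟨z, hz⟩ := hsurj (1 ⊗ₜ[k] g)
    filter_upwards [h1 z] with φ hφ
    rw [hz] at hφ
    exact hφ

/-- The coinvariants determine the kernel of the quotient. -/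
theorem apply_eq_zero_of_coinvariants [Nontrivial R] {C' : Type u} [AddCommGroup C'] [Module k C']
    [Coalgebra k C'] {π' : H →ₗ[k] C'} {act' : H →ₗ[k] Module.End k C'}
    (hS : IsAntipodePair S T) (hδ : IsRightCoaction δ.toLinearMap)
    (hsurj : Function.Surjective (galoisMap δ.toLinearMap)) {B : Subalgebra k R}
    (D : IsDescentDatum (quotAct δ T act) (π 1) (quotCoact δ T π) B)
    (D' : IsDescentDatum (quotAct δ T act') (π' 1) (quotCoact δ T π') B) {h : H} (hh : π h = 0) :
    π' h = 0 := by
  -- The canonical map depends on the quotient only through the final map p ∘ T.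
  have key : ∀ {E : Type u} [AddCommGroup E] [Module k E] (p : H →ₗ[k] E) (z : R ⊗[k] R),
      canonicalMap (quotCoact δ T p) z =
        TensorProduct.comm k R E ((p ∘ₗ T).lTensor R (twistedGaloisMap δ z)) := fun p z => by
    induction z using TensorProduct.induction_on with
    | zero => simp
    | add a b ha hb => simp only [map_add, ha, hb]
    | tmul x y =>
      rw [canonicalMap_tmul, twistedGaloisMap_tmul]
      simp only [quotCoact, LinearMap.comp_apply, LinearEquiv.coe_coe, AlgHom.toLinearMap_apply]
      induction δ x using TensorProduct.induction_on with
      | zero => simp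
      | add a b ha hb => simp only [map_add, add_mul, ha, hb]
      | tmul a g => simp
  -- An element z over 1 ⊗ S(h) has canonical images π(h) ⊗ 1 and π'(h) ⊗ 1. Each vanishes exactly
  -- when z is a relation over B, a condition common to both quotients.
  obtain ⟨w, hw⟩ := (galoisTwist_bijective hS hδ).2 (1 ⊗ₜ[k] S h)
  obtain ⟨z, rfl⟩ := hsurj w
  rw [galoisTwist_galoisMap hS hδ] at hw
  have h1 := (D.mem_balancedRel_iff z).2 (by rw [key, hw]; simp [hS.left_inv, hh])
  have h2 := (D'.mem_balancedRel_iff z).1 h1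
  rw [key, hw, LinearEquiv.map_eq_zero_iff, LinearMap.lTensor_tmul, LinearMap.comp_apply,
    hS.left_inv] at h2
  obtain ⟨f, hf⟩ := (LinearMap.toSpanSingleton k R 1).exists_leftInverse_of_injective
    (LinearMap.ker_toSpanSingleton k one_ne_zero)
  have hf1 : f 1 = 1 := by simpa using LinearMap.congr_fun hf 1
  simpa [hf1] using congrArg (fun t => TensorProduct.lid k C' (f.rTensor C' t)) h2

end Descent

/-! ### Coflatness and Hopf modules -/

section Coflat

theorem isRightColinear_flip {k C : Type u} [Field k] [AddCommGroup C] [Module k C] {M M' : Type u} [AddCommGroup M] [Module k M] [AddCommGroup M']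
    [Module k M'] {ρ : M →ₗ[k] C ⊗[k] M} {ρ' : M' →ₗ[k] C ⊗[k] M'} {f : M →ₗ[k] M'}
    (hf : IsLeftColinear ρ ρ' f) : IsRightColinear ((TensorProduct.comm k C M).toLinearMap ∘ₗ ρ)
      ((TensorProduct.comm k C M').toLinearMap ∘ₗ ρ') f := by
  have h1 : ∀ t : C ⊗[k] M, TensorProduct.comm k C M' (f.lTensor C t) =
      f.rTensor C (TensorProduct.comm k C M t) := fun t => by
    induction t using TensorProduct.induction_on with
    | zero => simp
    | add a b ha hb => simp only [map_add, ha, hb]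
    | tmul c m => rfl
  exact LinearMap.ext fun m => (congrArg (TensorProduct.comm k C M')
    (LinearMap.congr_fun hf m)).trans (h1 _)

theorem mem_cotensor_comm_iff {k C H M : Type u} [Field k] [AddCommGroup C] [Module k C]
    [AddCommGroup H] [Module k H] [AddCommGroup M] [Module k M] (l : H →ₗ[k] C ⊗[k] H)
    (ρ : M →ₗ[k] C ⊗[k] M) (t : H ⊗[k] M) :
    t ∈ cotensor ((TensorProduct.comm k C H).toLinearMap ∘ₗ l) ρ ↔
      TensorProduct.comm k H M t ∈ cotensor ((TensorProduct.comm k C M).toLinearMap ∘ₗ ρ) l := by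
  let J : H ⊗[k] (C ⊗[k] M) ≃ₗ[k] M ⊗[k] (C ⊗[k] H) :=
    TensorProduct.comm k H (C ⊗[k] M) ≪≫ₗ
    TensorProduct.congr (TensorProduct.comm k C M) (LinearEquiv.refl k H) ≪≫ₗ
    TensorProduct.assoc k M C H
  have h1 : J (ρ.lTensor H t) = TensorProduct.assoc k M C H
      (((TensorProduct.comm k C M).toLinearMap ∘ₗ ρ).rTensor H (TensorProduct.comm k H M t)) := by
    induction t using TensorProduct.induction_on with
    | zero => simp
    | add a b ha hb => simp only [map_add, ha, hb]
    | tmul h m => rfl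
  have h2 : J (TensorProduct.assoc k H C M
      (((TensorProduct.comm k C H).toLinearMap ∘ₗ l).rTensor M t)) =
      l.lTensor M (TensorProduct.comm k H M t) := by
    clear h1
    induction t using TensorProduct.induction_on with
    | zero => simp
    | add a b ha hb => simp only [map_add, ha, hb]
    | tmul h m =>
      simp only [LinearMap.rTensor_tmul, TensorProduct.comm_tmul, LinearMap.lTensor_tmul,
        LinearMap.comp_apply, LinearEquiv.coe_coe]
      induction l h using TensorProduct.induction_on with
      | zero => simp
      | add a b ha hb => simp only [TensorProduct.add_tmul, TensorProduct.tmul_add, map_add, ha, hb]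
      | tmul c g => rfl
  change TensorProduct.assoc k H C M
      (((TensorProduct.comm k C H).toLinearMap ∘ₗ l).rTensor M t) = ρ.lTensor H t ↔
    TensorProduct.assoc k M C H (((TensorProduct.comm k C M).toLinearMap ∘ₗ ρ).rTensor H
      (TensorProduct.comm k H M t)) = l.lTensor M (TensorProduct.comm k H M t)
  rw [← h1, ← h2, J.injective.eq_iff, eq_comm]

/-- A left coaction, as a right coaction of the co-opposite coalgebra. -/
noncomputable def copFlip {k C H : Type u} [Field k] [AddCommGroup C] [Module k C]
    [AddCommGroup H] [Module k H] (l : H →ₗ[k] C ⊗[k] H) : H →ₗ[k] H ⊗[k] Cop C :=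
  (TensorProduct.comm k C H).toLinearMap ∘ₗ l

theorem mem_cotensor_copFlip_iff {k C H M : Type u} [Field k] [AddCommGroup C] [Module k C]
    [AddCommGroup H] [Module k H] [AddCommGroup M] [Module k M]
    (l : H →ₗ[k] C ⊗[k] H) (ρ : M →ₗ[k] Cop C ⊗[k] M) (t : H ⊗[k] M) :
    t ∈ cotensor (copFlip l) ρ ↔ TensorProduct.comm k H M t ∈ cotensor (flipCoaction ρ) l :=
  let ρ' : M →ₗ[k] C ⊗[k] M := ρ
  mem_cotensor_comm_iff l ρ' t

variable {k R C H : Type u} [Field k] [Ring R] [Algebra k R] [AddCommGroup C] [Module k C]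
  [Coalgebra k C] [AddCommGroup H] [Module k H]

theorem isLeftCoaction_punit : IsLeftCoaction (0 : PUnit.{u + 1} →ₗ[k] C ⊗[k] PUnit.{u + 1}) :=
  ⟨by ext; simp, Subsingleton.elim _ _⟩

theorem isRightCoaction_punit : IsRightCoaction (0 : PUnit.{u + 1} →ₗ[k] PUnit.{u + 1} ⊗[k] C) :=
  ⟨by ext; simp, Subsingleton.elim _ _⟩

/-- Lifting is preservation of exactness of M → M' → 0, and detection of zero is reflection of
exactness of 0 → M → 0. -/
theorem IsRightFaithfullyCoflat.isHopfCoflat {r : H →ₗ[k] H ⊗[k] C}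
    (hr : IsRightFaithfullyCoflat r) (τ : R →ₗ[k] R ⊗[k] Module.End k C) : IsHopfCoflat τ r where
  lift M M' _ _ _ _ _ _ _ _ ρ ρ' hρ hρ' f hf hsurj t' ht' := by
    have h1 := (hr M M' PUnit.{u + 1} ρ ρ' 0 hρ.isLeftCoaction hρ'.isLeftCoaction
      isLeftCoaction_punit (f.restrictScalars k) 0 hf (by ext; simp)).1
      (fun m' => ⟨fun _ => hsurj m', fun _ => rfl⟩)
    obtain ⟨t, ht⟩ := (h1 ⟨t', ht'⟩).1 (Subtype.ext (by simp [cotensorMapRight]))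
    exact ⟨t, t.2, congrArg Subtype.val ht⟩
  detect M _ _ _ _ ρ hρ ht m := by
    have h1 := (hr PUnit.{u + 1} M PUnit.{u + 1} 0 ρ 0 isLeftCoaction_punit hρ.isLeftCoaction
      isLeftCoaction_punit 0 0 (by ext; simp) (by ext; simp)).2
      (fun t => ⟨fun _ => ⟨0, by rw [map_zero]; exact (Subtype.ext (ht t t.2)).symm⟩,
        fun _ => Subtype.ext (by simp [cotensorMapRight])⟩)
    obtain ⟨x, hx⟩ := (h1 m).1 rfl
    exact hx.symm

theorem IsLeftFaithfullyCoflat.isHopfCoflat {l : H →ₗ[k] C ⊗[k] H}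
    (hl : IsLeftFaithfullyCoflat l) (τ : R →ₗ[k] R ⊗[k] Module.End k (Cop C)) :
    IsHopfCoflat τ (copFlip l) where
  lift M M' _ _ _ _ _ _ _ _ ρ ρ' hρ hρ' f hf hsurj t' ht' := by
    let ρ₁ : M →ₗ[k] C ⊗[k] M := ρ
    let ρ₁' : M' →ₗ[k] C ⊗[k] M' := ρ'
    have hf' : IsLeftColinear ρ₁ ρ₁' (f.restrictScalars k) := hf
    have h1 := (hl M M' PUnit.{u + 1} (flipCoaction ρ) (flipCoaction ρ') 0
      ((isLeftCoaction_cop_iff ρ).1 hρ.isLeftCoaction)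
      ((isLeftCoaction_cop_iff ρ').1 hρ'.isLeftCoaction)
      isRightCoaction_punit (f.restrictScalars k) 0 (isRightColinear_flip hf') (by ext; simp)).1
      (fun m' => ⟨fun _ => hsurj m', fun _ => rfl⟩)
    obtain ⟨t, ht⟩ := (h1 ⟨_, (mem_cotensor_copFlip_iff l ρ' t').1 ht'⟩).1
      (Subtype.ext (by simp [cotensorMapLeft]))
    refine ⟨TensorProduct.comm k M H t, (mem_cotensor_copFlip_iff l ρ _).2 ?_, ?_⟩
    · rw [TensorProduct.comm_comm]
      exact t.2
    · have h2 : (f.restrictScalars k).rTensor H t = TensorProduct.comm k H M' t' :=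
        congrArg Subtype.val ht
      rw [← TensorProduct.comm_comm k M' H t', ← h2]
      generalize (t : M ⊗[k] H) = s
      induction s using TensorProduct.induction_on with
      | zero => simp
      | add a b ha hb => simp only [map_add, ha, hb]
      | tmul m h => rfl
  detect M _ _ _ _ ρ hρ ht m := by
    have h1 := (hl PUnit.{u + 1} M PUnit.{u + 1} 0 (flipCoaction ρ) 0 isRightCoaction_punit
      ((isLeftCoaction_cop_iff ρ).1 hρ.isLeftCoaction)
      isRightCoaction_punit 0 0 (by ext; simp) (by ext; simp)).2
      (fun t => ⟨fun _ => ⟨0, by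
        rw [map_zero]
        refine (Subtype.ext ?_).symm
        refine (TensorProduct.comm k M H).injective ?_
        refine (ht _ ((mem_cotensor_copFlip_iff l ρ _).2 ?_)).trans (map_zero _).symm
        rw [TensorProduct.comm_comm]
        exact t.2⟩,
        fun _ => Subtype.ext (by simp [cotensorMapLeft])⟩)
    obtain ⟨x, hx⟩ := (h1 m).1 rfl
    exact hx.symm

end Coflat

/-! ### The opposite coaction -/

section OppositeCoaction

open MulOpposite

variable {k R H : Type u} [Field k] [Ring R] [Algebra k R] [Ring H] [Bialgebra k H]
  {S T : H →ₗ[k] H} {δ : R →ₐ[k] R ⊗[k] H}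

/-- The map `a ⊗ h ↦ op(a) ⊗ T(h)`. -/
noncomputable def opTensor (R : Type u) [Ring R] [Algebra k R] (T : H →ₗ[k] H) :
    R ⊗[k] H →ₗ[k] Rᵐᵒᵖ ⊗[k] H :=
  TensorProduct.map (opLinearEquiv k).toLinearMap T

theorem opTensor_mul (hS : IsAntipodePair S T) (s t : R ⊗[k] H) :
    opTensor R T (s * t) = opTensor R T t * opTensor R T s := by
  induction s using TensorProduct.induction_on with
  | zero => simp
  | add a b ha hb => simp only [add_mul, mul_add, map_add, ha, hb]
  | tmul a g =>
    induction t using TensorProduct.induction_on with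
    | zero => simp
    | add a b ha hb => simp only [add_mul, mul_add, map_add, ha, hb]
    | tmul b h => simp [opTensor, hS.map_mul_symm]

theorem opTensor_bijective (hS : IsAntipodePair S T) : Function.Bijective (opTensor R T) := by
  let E : H ≃ₗ[k] H := LinearEquiv.ofLinearMap T S (LinearMap.ext hS.left_inv)
    (LinearMap.ext hS.right_inv)
  exact (TensorProduct.congr (opLinearEquiv k : R ≃ₗ[k] Rᵐᵒᵖ) E).bijective

/-- The coaction `op(a) ↦ op(a₀) ⊗ T(a₁)` of the co-opposite bialgebra on the opposite algebra. -/
noncomputable def opCoaction (δ : R →ₐ[k] R ⊗[k] H) (hS : IsAntipodePair S T) :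
    Rᵐᵒᵖ →ₐ[k] Rᵐᵒᵖ ⊗[k] H :=
  AlgHom.ofLinearMap (opTensor R T ∘ₗ δ.toLinearMap ∘ₗ (opLinearEquiv k).symm.toLinearMap)
    (by
      change opTensor R T (δ 1) = 1
      rw [map_one, Algebra.TensorProduct.one_def]
      change op 1 ⊗ₜ[k] T 1 = _
      rw [hS.symm_one]
      rfl)
    (fun x y => by
      change opTensor R T (δ (unop y * unop x)) = opTensor R T (δ (unop x)) *
        opTensor R T (δ (unop y))
      rw [map_mul, opTensor_mul hS])

/-- The opposite coaction, with values in the co-opposite bialgebra. -/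
noncomputable def copCoaction (δ : R →ₐ[k] R ⊗[k] H) (hS : IsAntipodePair S T) :
    Rᵐᵒᵖ →ₐ[k] Rᵐᵒᵖ ⊗[k] Cop H :=
  (opCoaction δ hS : Rᵐᵒᵖ →ₐ[k] Rᵐᵒᵖ ⊗[k] H)

theorem isRightCoaction_copCoaction (hS : IsAntipodePair S T)
    (hδ : IsRightCoaction δ.toLinearMap) : IsRightCoaction (copCoaction δ hS).toLinearMap := by
  let P : R ⊗[k] (H ⊗[k] H) →ₗ[k] Rᵐᵒᵖ ⊗[k] (H ⊗[k] H) :=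
    TensorProduct.map (opLinearEquiv k).toLinearMap (TensorProduct.map T T)
  have h1 : ∀ t : R ⊗[k] H, TensorProduct.assoc k Rᵐᵒᵖ H H
      ((opCoaction δ hS).toLinearMap.rTensor H (opTensor R T t)) =
      P (TensorProduct.assoc k R H H (δ.toLinearMap.rTensor H t)) := fun t => by
    induction t using TensorProduct.induction_on with
    | zero => simp
    | add a b ha hb => simp only [map_add, ha, hb]
    | tmul a h =>
      change TensorProduct.assoc k Rᵐᵒᵖ H H (opTensor R T (δ a) ⊗ₜ[k] T h) =
        P (TensorProduct.assoc k R H H (δ a ⊗ₜ[k] h))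
      induction δ a using TensorProduct.induction_on with
      | zero => simp
      | add a b ha hb => simp only [TensorProduct.add_tmul, map_add, ha, hb]
      | tmul a g => simp [P, opTensor]
  have h2 : ∀ t : R ⊗[k] H, (flipComul k H).lTensor Rᵐᵒᵖ (opTensor R T t) =
      P ((Coalgebra.comul (R := k)).lTensor R t) := fun t => by
    induction t using TensorProduct.induction_on with
    | zero => simp
    | add a b ha hb => simp only [map_add, ha, hb]
    | tmul a h =>
      change op a ⊗ₜ[k] flipComul k H (T h) =
        op a ⊗ₜ[k] TensorProduct.map T T (Coalgebra.comul (R := k) h)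
      simp only [flipComul, LinearMap.comp_apply, LinearEquiv.coe_coe, hS.comul_symm]
      rw [TensorProduct.map_comm, TensorProduct.comm_comm]
  have h3 : ∀ t : R ⊗[k] H, TensorProduct.rid k Rᵐᵒᵖ
      ((Coalgebra.counit (R := k)).lTensor Rᵐᵒᵖ (opTensor R T t)) =
      op (TensorProduct.rid k R ((Coalgebra.counit (R := k)).lTensor R t)) := fun t => by
    induction t using TensorProduct.induction_on with
    | zero => simp
    | add a b ha hb => simp only [map_add, ha, hb, op_add]
    | tmul a h => simp [opTensor, hS.counit_symm]
  refine ⟨LinearMap.ext fun x => ?_, LinearMap.ext fun x => ?_⟩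
  · exact (h1 (δ (unop x))).trans ((congrArg P (hδ.coassoc_apply (unop x))).trans
      (h2 (δ (unop x))).symm)
  · exact (h3 (δ (unop x))).trans (congrArg op (LinearMap.congr_fun hδ.counit (unop x)))

/-- The equivalence `y ⊗ x ↦ op(x) ⊗ op(y)`. -/
noncomputable def opSwap (k R : Type u) [Field k] [Ring R] [Algebra k R] :
    R ⊗[k] R ≃ₗ[k] Rᵐᵒᵖ ⊗[k] Rᵐᵒᵖ :=
  TensorProduct.comm k R R ≪≫ₗ TensorProduct.congr (opLinearEquiv k) (opLinearEquiv k)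

theorem opSwap_mem_balancedRel {B : Subalgebra k R} {t : R ⊗[k] R}
    (ht : t ∈ balancedRel k B R R) : opSwap k R t ∈ balancedRel k B.op Rᵐᵒᵖ Rᵐᵒᵖ := by
  suffices h : balancedRel k B R R ≤
      (balancedRel k B.op Rᵐᵒᵖ Rᵐᵒᵖ).comap (opSwap k R).toLinearMap from h ht
  conv_lhs => unfold balancedRel
  rw [Submodule.span_le]
  rintro _ ⟨x, b, y, rfl⟩
  rw [SetLike.mem_coe, Submodule.mem_comap, ← neg_mem_iff]
  refine Submodule.subset_span ⟨op y, ⟨op (b : R), b.2⟩, op x, ?_⟩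
  change -(opSwap k R ((op b • x) ⊗ₜ[k] y - x ⊗ₜ[k] (b • y))) = _
  rw [map_sub, neg_sub]
  rfl

/-- Left multiplication by op(x) is right multiplication by x, so the Galois map of the opposite
coaction is x ⊗ y ↦ δ(x)(y ⊗ 1) up to bijections. Surjectivity and the kernel therefore transfer
from δ. -/
theorem galoisMap_opCoaction (hS : IsAntipodePair S T) (t : R ⊗[k] R) :
    galoisMap (opCoaction δ hS).toLinearMap (opSwap k R t) = opTensor R T (twistedGaloisMap δ t) := by
  induction t using TensorProduct.induction_on with
  | zero => simp
  | add a b ha hb => simp only [map_add, ha, hb]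
  | tmul y x =>
    refine (galoisMap_tmul (opCoaction δ hS).toLinearMap (op x) (op y)).trans ?_
    rw [twistedGaloisMap_tmul]
    change (LinearMap.mulLeft k (op x)).rTensor H (opTensor R T (δ y)) = _
    induction δ y using TensorProduct.induction_on with
    | zero => simp
    | add a b ha hb => simp only [add_mul, map_add, ha, hb]
    | tmul a g => simp [opTensor]

theorem galoisMap_copCoaction (hS : IsAntipodePair S T) (t : R ⊗[k] R) :
    galoisMap (copCoaction δ hS).toLinearMap (opSwap k R t) = opTensor R T (twistedGaloisMap δ t) :=
  galoisMap_opCoaction hS t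

theorem galoisMap_copCoaction_surjective (hS : IsAntipodePair S T)
    (hδ : IsRightCoaction δ.toLinearMap)
    (hsurj : Function.Surjective (galoisMap δ.toLinearMap)) :
    Function.Surjective (galoisMap (copCoaction δ hS).toLinearMap) := fun w => by
  obtain ⟨w, rfl⟩ := (opTensor_bijective (R := R) hS).2 w
  obtain ⟨w, rfl⟩ := (galoisTwist_bijective hS hδ).2 w
  obtain ⟨w, rfl⟩ := hsurj w
  exact ⟨opSwap k R w, by rw [galoisTwist_galoisMap hS hδ, galoisMap_copCoaction]⟩

theorem mem_balancedRel_of_galoisMap_copCoaction (hS : IsAntipodePair S T)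
    (hδ : IsRightCoaction δ.toLinearMap) {B : Subalgebra k R}
    (hker : ∀ t, galoisMap δ.toLinearMap t = 0 → t ∈ balancedRel k B R R) (t : Rᵐᵒᵖ ⊗[k] Rᵐᵒᵖ)
    (ht : galoisMap (copCoaction δ hS).toLinearMap t = 0) :
    t ∈ balancedRel k B.op Rᵐᵒᵖ Rᵐᵒᵖ := by
  obtain ⟨t, rfl⟩ := (opSwap k R).surjective t
  rw [galoisMap_copCoaction] at ht
  refine opSwap_mem_balancedRel (hker t ((galoisTwist_bijective hS hδ).1 ?_))
  rw [galoisTwist_galoisMap hS hδ, map_zero]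
  exact (opTensor_bijective (R := R) hS).1 (ht.trans (map_zero _).symm)

/-- Integrals are carried to the opposite side by precomposition with S, whose reversal of Δ matches
the co-opposite and cancels the T in the coaction. -/
theorem isColinearAt_copCoaction (hS : IsAntipodePair S T) {φ : H →ₗ[k] R} {h : H}
    (hφ : IsColinearAt δ.toLinearMap φ (S h)) :
    IsColinearAt (H := Cop H) (copCoaction δ hS).toLinearMap
      ((opLinearEquiv k).toLinearMap ∘ₗ φ ∘ₗ S) h := by
  have h1 : ∀ t : H ⊗[k] H, opTensor R T (φ.rTensor H (TensorProduct.map S S t)) =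
      ((opLinearEquiv k).toLinearMap ∘ₗ φ ∘ₗ S).rTensor H t := fun t => by
    induction t using TensorProduct.induction_on with
    | zero => simp
    | add a b ha hb => simp only [map_add, ha, hb]
    | tmul a b => simp [opTensor, hS.left_inv]
  refine Eq.trans (congrArg (opTensor R T) hφ) ?_
  rw [hS.comul_antipode]
  exact h1 _

theorem isColinearAt_of_copCoaction (hS : IsAntipodePair S T) {φ : Cop H →ₗ[k] Rᵐᵒᵖ} {h : H}
    (hφ : IsColinearAt (H := Cop H) (copCoaction δ hS).toLinearMap φ (T h)) :
    IsColinearAt δ.toLinearMap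
      ((opLinearEquiv k).symm.toLinearMap ∘ₗ (show H →ₗ[k] Rᵐᵒᵖ from φ) ∘ₗ T) h := by
  let φ' : H →ₗ[k] Rᵐᵒᵖ := φ
  have h1 : ∀ t : H ⊗[k] H, φ'.rTensor H (TensorProduct.map T T t) =
      opTensor R T (((opLinearEquiv k).symm.toLinearMap ∘ₗ φ' ∘ₗ T).rTensor H t) := fun t => by
    induction t using TensorProduct.induction_on with
    | zero => simp
    | add a b ha hb => simp only [map_add, ha, hb]
    | tmul a b => simp [opTensor]
  have h2 : flipComul k H (T h) = TensorProduct.map T T (Coalgebra.comul (R := k) h) := by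
    simp only [flipComul, LinearMap.comp_apply, LinearEquiv.coe_coe, hS.comul_symm]
    rw [TensorProduct.map_comm, TensorProduct.comm_comm]
  refine (opTensor_bijective (R := R) hS).1 (Eq.trans ?_ (h1 _))
  rw [← h2]
  exact hφ

end OppositeCoaction

/-! ### Integrals, both descent data and injectivity for A -/

section Main

open MulOpposite

variable {k H A : Type u} [Field k] [Ring H] [HopfAlgebra k H] [Ring A] [Algebra k A]
  {S T : H →ₗ[k] H} {δ : A →ₐ[k] A ⊗[k] H}

/-! ### Integrals of faithfully flat Galois extensions -/

theorem can_mk (δ : A →ₐ[k] A ⊗[k] H) (t : A ⊗[k] A) :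
    can δ (Submodule.Quotient.mk t) = galoisMap δ.toLinearMap t := by
  induction t using TensorProduct.induction_on with
  | zero => simp
  | add a b ha hb => rw [Submodule.Quotient.mk_add, map_add, map_add, ha, hb]
  | tmul x y =>
    rw [galoisMap_tmul]
    change (x ⊗ₜ[k] (1 : H)) * δ y = _
    rw [AlgHom.toLinearMap_apply]
    induction δ y using TensorProduct.induction_on with
    | zero => simp
    | add a b ha hb => simp only [mul_add, map_add, ha, hb]
    | tmul a h => simp

theorem IsHopfGalois.galoisMap_surjective (hδ : IsHopfGalois δ) :
    Function.Surjective (galoisMap δ.toLinearMap) := fun w => by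
  obtain ⟨q, rfl⟩ := hδ.bijective_can.2 w
  obtain ⟨t, rfl⟩ := Submodule.Quotient.mk_surjective _ q
  exact ⟨t, (can_mk δ t).symm⟩

theorem IsHopfGalois.mem_balancedRel (hδ : IsHopfGalois δ) (t : A ⊗[k] A)
    (ht : galoisMap δ.toLinearMap t = 0) : t ∈ balancedRel k (coinvariants δ) A A := by
  rw [← can_mk, map_eq_zero_iff _ hδ.bijective_can.1] at ht
  exact (Submodule.Quotient.mk_eq_zero _).1 ht

theorem coaction_mul_of_coinvariant {R K : Type u} [Ring R] [Algebra k R] [Ring K] [Algebra k K]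
    (δ : R →ₐ[k] R ⊗[k] K) {b : R} (hb : δ b = b ⊗ₜ[k] 1) (r : R) :
    δ (b * r) = (LinearMap.mulLeft k b).rTensor K (δ r) := by
  rw [map_mul, hb]
  induction δ r using TensorProduct.induction_on with
  | zero => simp
  | add a b ha hb => simp only [mul_add, map_add, ha, hb]
  | tmul a h => simp

/-- Under left flatness the integral is constructed for the opposite coaction and brought back by
composing with T, so colinearity is requested there on the image of s under T. Thus either kind of
flatness serves both sides of the theorem. -/
theorem IsHopfGalois.exists_integral (hS : IsAntipodePair S T) (hδ : IsHopfGalois δ)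
    (hflat : IsLeftFaithfullyFlat k (coinvariants δ) A ∨
      IsRightFaithfullyFlat k (coinvariants δ) A) (s : Finset H) :
    ∃ φ : H →ₗ[k] A, φ 1 = 1 ∧ ∀ h ∈ s, IsColinearAt δ.toLinearMap φ h := by
  classical
  rcases hflat with hflat | hflat
  · have hmem : ∀ b, b ∈ (coinvariants δ).op ↔ copCoaction δ hS b = b ⊗ₜ[k] 1 := fun b => by
      have h1 : opTensor A T (unop b ⊗ₜ[k] 1) = b ⊗ₜ[k] 1 := by
        change b ⊗ₜ[k] T 1 = _
        rw [hS.symm_one]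
      change δ (unop b) = unop b ⊗ₜ[k] 1 ↔ opTensor A T (δ (unop b)) = b ⊗ₜ[k] 1
      rw [← h1, (opTensor_bijective (R := A) hS).1.eq_iff]
    obtain ⟨φ, h1, h2⟩ := HopfGal.exists_integral (H := Cop H)
      (isRightCoaction_copCoaction hS hδ.isCoaction) (B := (coinvariants δ).op) hmem
      (fun b hb r => coaction_mul_of_coinvariant (copCoaction δ hS) ((hmem b).1 hb) r)
      (galoisMap_copCoaction_surjective hS hδ.isCoaction hδ.galoisMap_surjective)
      (mem_balancedRel_of_galoisMap_copCoaction hS hδ.isCoaction hδ.mem_balancedRel)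
      ((isLeftFaithfullyFlat_iff_op _).1 hflat) (s.image T)
    refine ⟨_, ?_, fun h hh => isColinearAt_of_copCoaction hS
      (h2 (T h) (Finset.mem_image_of_mem T hh))⟩
    change unop (φ (T 1)) = 1
    rw [hS.symm_one]
    exact congrArg unop h1
  · exact HopfGal.exists_integral hδ.isCoaction (fun _ => mem_coinvariants)
      (fun b hb r => coaction_mul_of_coinvariant δ (mem_coinvariants.1 hb) r)
      hδ.galoisMap_surjective hδ.mem_balancedRel hflat s

/-! ### Generalised quotients -/

namespace GenQuot

/-- The right action of `H` on a generalised quotient. -/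
def act (Q : GenQuot k H) : H →ₗ[k] Module.End k Q.carrier where
  toFun h := Q.I.mapQ Q.I (LinearMap.mulRight k h) fun x hx => Q.mul_mem x hx h
  map_add' g h := by
    ext x
    exact congrArg Q.proj (mul_add x g h)
  map_smul' c h := by
    ext x
    exact congrArg Q.proj (mul_smul_comm c x h)

theorem isModuleQuotient (Q : GenQuot k H) : IsModuleQuotient Q.proj Q.act where
  comul_apply _ := rfl
  counit_apply _ := rfl
  act_apply _ _ := rfl

/-- The projection, as a map of co-opposite coalgebras. -/
def copProj (Q : GenQuot k H) : Cop H →ₗ[k] Cop Q.carrier := Q.proj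

/-- The right action of `H` on the co-opposite coalgebra of a generalised quotient. -/
def copAct (Q : GenQuot k H) : Cop H →ₗ[k] Module.End k (Cop Q.carrier) := Q.act

theorem isModuleQuotient_cop (Q : GenQuot k H) : IsModuleQuotient Q.copProj Q.copAct where
  comul_apply h := by
    have h1 : TensorProduct.comm k Q.carrier Q.carrier (TensorProduct.map Q.proj Q.proj
        (Coalgebra.comul (R := k) (A := H) h)) =
        TensorProduct.map Q.proj Q.proj (flipComul k H h) := (TensorProduct.map_comm _ _ _).symm
    exact h1
  counit_apply _ := rfl
  act_apply _ _ := rfl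

theorem regularCoact_copProj (Q : GenQuot k H) :
    regularCoact Q.copProj = copFlip Q.leftCoaction := by
  have h1 : ∀ t : H ⊗[k] H, Q.proj.lTensor H (TensorProduct.comm k H H t) =
      TensorProduct.comm k Q.carrier H (Q.proj.rTensor H t) := fun t => by
    induction t using TensorProduct.induction_on with
    | zero => simp
    | add a b ha hb => simp only [map_add, ha, hb]
    | tmul g h => rfl
  exact LinearMap.ext fun h => h1 (Coalgebra.comul (R := k) (A := H) h)

end GenQuot

theorem isDescentDatum_right (hS : IsAntipodePair S T) (hδ : IsHopfGalois δ)
    (hint : ∀ s : Finset H, ∃ φ : H →ₗ[k] A,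
      φ 1 = 1 ∧ ∀ h ∈ s, IsColinearAt δ.toLinearMap φ h)
    {Q : GenQuot k H} (hQ : Q.IsRightAdmissible) :
    IsDescentDatum (quotAct δ T Q.act) (Q.proj 1) (quotCoact δ T Q.proj)
      (quotCoinvariants δ Q) :=
  isDescentDatum_quotCoact hS hδ.isCoaction hδ.galoisMap_surjective hint Q.isModuleQuotient
    (hQ.2.isHopfCoflat _) fun _ => Iff.rfl

/-- This is the right-handed construction for the opposite algebra and co-opposite coalgebras. The
antipode pair there is (T, S), so the twist by S undoes the T in `copCoaction` and the resulting
coaction is op(a) ↦ π(a₁) ⊗ op(a₀). -/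
theorem isDescentDatum_left (hS : IsAntipodePair S T) (hδ : IsHopfGalois δ)
    (hint : ∀ s : Finset H, ∃ φ : H →ₗ[k] A,
      φ 1 = 1 ∧ ∀ h ∈ s, IsColinearAt δ.toLinearMap φ h)
    {Q : GenQuot k H} (hQ : Q.IsLeftAdmissible) :
    IsDescentDatum (quotAct (H := Cop H) (copCoaction δ hS) S Q.copAct)
      (Q.copProj 1) (quotCoact (H := Cop H) (copCoaction δ hS) S Q.copProj)
      (quotCoinvariants δ Q).op := by
  classical
  refine isDescentDatum_quotCoact hS.cop (isRightCoaction_copCoaction hS hδ.isCoaction)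
    (galoisMap_copCoaction_surjective hS hδ.isCoaction hδ.galoisMap_surjective) (fun s => ?_)
    Q.isModuleQuotient_cop ?_ fun b => ?_
  · obtain ⟨φ, h1, h2⟩ := hint (s.image S)
    refine ⟨_, ?_, fun h hh => isColinearAt_copCoaction hS
      (h2 (S h) (Finset.mem_image_of_mem S hh))⟩
    change op (φ (S 1)) = 1
    rw [hS.antipode_one, h1, op_one]
  · rw [Q.regularCoact_copProj]
    exact hQ.2.isHopfCoflat _
  -- Coinvariance for the opposite coaction reads a₀ ⊗ π(T(a₁)) = a ⊗ π(1), which by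
  -- `quotCoact_eq_iff` is the condition defining A^{co Q}.
  · have h1 : ∀ t : A ⊗[k] H, Q.proj.lTensor Aᵐᵒᵖ (opTensor A T t) =
        (opLinearEquiv k).toLinearMap.rTensor Q.carrier ((Q.proj ∘ₗ T).lTensor A t) := fun t => by
      induction t using TensorProduct.induction_on with
      | zero => simp
      | add a b ha hb => simp only [map_add, ha, hb]
      | tmul a h => rfl
    have h2 : Function.Injective ((opLinearEquiv k : A ≃ₗ[k] Aᵐᵒᵖ).toLinearMap.rTensor Q.carrier) :=
      Module.Flat.rTensor_preserves_injective_linearMap _ (opLinearEquiv k).injective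
    change Q.proj.lTensor A (δ (unop b)) = unop b ⊗ₜ[k] Q.proj 1 ↔
      Q.proj.lTensor Aᵐᵒᵖ (opTensor A T (δ (unop b))) = b ⊗ₜ[k] Q.proj 1
    rw [← quotCoact_eq_iff hS hδ.isCoaction Q.isModuleQuotient, h1]
    have h3 : b ⊗ₜ[k] Q.proj 1 = (opLinearEquiv k).toLinearMap.rTensor Q.carrier
        (unop b ⊗ₜ[k] Q.proj 1) := rfl
    rw [h3, h2.eq_iff]
    exact (TensorProduct.comm k A Q.carrier).injective.eq_iff
      (a := (Q.proj ∘ₗ T).lTensor A (δ (unop b))) (b := unop b ⊗ₜ[k] Q.proj 1)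

theorem GenQuot.eq_of_proj_eq_zero_iff {Q Q' : GenQuot k H}
    (h : ∀ x, Q.proj x = 0 ↔ Q'.proj x = 0) : Q = Q' :=
  GenQuot.ext (Submodule.ext fun x => by
    rw [← Submodule.Quotient.mk_eq_zero Q.I, ← Submodule.Quotient.mk_eq_zero Q'.I]
    exact h x)

theorem injOn_right [Nontrivial A] (hS : IsAntipodePair S T) (hδ : IsHopfGalois δ)
    (hint : ∀ s : Finset H, ∃ φ : H →ₗ[k] A,
      φ 1 = 1 ∧ ∀ h ∈ s, IsColinearAt δ.toLinearMap φ h) :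
    Set.InjOn (quotToSub δ) {Q | Q.IsRightAdmissible} := by
  intro Q hQ Q' hQ' h
  have hB : quotCoinvariants δ Q = quotCoinvariants δ Q' := congrArg Subtype.val h
  have D := isDescentDatum_right hS hδ hint hQ
  have D' := isDescentDatum_right hS hδ hint hQ'
  rw [hB] at D
  exact GenQuot.eq_of_proj_eq_zero_iff fun x =>
    ⟨apply_eq_zero_of_coinvariants hS hδ.isCoaction hδ.galoisMap_surjective D D',
      apply_eq_zero_of_coinvariants hS hδ.isCoaction hδ.galoisMap_surjective D' D⟩

theorem injOn_left [Nontrivial A] (hS : IsAntipodePair S T) (hδ : IsHopfGalois δ)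
    (hint : ∀ s : Finset H, ∃ φ : H →ₗ[k] A,
      φ 1 = 1 ∧ ∀ h ∈ s, IsColinearAt δ.toLinearMap φ h) :
    Set.InjOn (quotToSub δ) {Q | Q.IsLeftAdmissible} := by
  intro Q hQ Q' hQ' h
  have hB : quotCoinvariants δ Q = quotCoinvariants δ Q' := congrArg Subtype.val h
  have D := isDescentDatum_left hS hδ hint hQ
  have D' := isDescentDatum_left hS hδ hint hQ'
  rw [hB] at D
  have hδ' := isRightCoaction_copCoaction hS hδ.isCoaction
  have hsurj := galoisMap_copCoaction_surjective hS hδ.isCoaction hδ.galoisMap_surjective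
  exact GenQuot.eq_of_proj_eq_zero_iff fun x =>
    ⟨apply_eq_zero_of_coinvariants (h := (show Cop H from x)) hS.cop hδ' hsurj D D',
      apply_eq_zero_of_coinvariants (h := (show Cop H from x)) hS.cop hδ' hsurj D' D⟩

end Main

end HopfGal

open HopfGal in
theorem mainTheorem9 {k H A : Type u} [Field k] [Ring H] [HopfAlgebra k H]
    [Ring A] [Nontrivial A] [Algebra k A]
    (hS : Function.Bijective (HopfAlgebra.antipode k : H →ₗ[k] H))
    (δ : A →ₐ[k] A ⊗[k] H) (hδ : IsHopfGalois δ)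
    (hflat : IsLeftFaithfullyFlat k (coinvariants δ) A ∨
      IsRightFaithfullyFlat k (coinvariants δ) A) :
    (Set.InjOn (quotToSub δ) {Q | Q.IsRightAdmissible} ∧
      ∀ Q : GenQuot k H, Q.IsRightAdmissible →
        IsRightAdmissibleSubalgebra (quotToSub δ Q).1) ∧
    (Set.InjOn (quotToSub δ) {Q | Q.IsLeftAdmissible} ∧
      ∀ Q : GenQuot k H, Q.IsLeftAdmissible →
        IsLeftAdmissibleSubalgebra (quotToSub δ Q).1) ∧
    (Set.InjOn (quotToSub δ) {Q | Q.IsLeftAdmissible ∧ Q.IsRightAdmissible} ∧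
      ∀ Q : GenQuot k H, Q.IsLeftAdmissible ∧ Q.IsRightAdmissible →
        IsLeftAdmissibleSubalgebra (quotToSub δ Q).1 ∧
          IsRightAdmissibleSubalgebra (quotToSub δ Q).1) := by
  have hST := isAntipodePair hS
  have hint := hδ.exists_integral hST hflat
  have hright : ∀ Q : GenQuot k H, Q.IsRightAdmissible →
      IsRightAdmissibleSubalgebra (quotToSub δ Q).1 := fun Q hQ =>
    (isDescentDatum_right hST hδ hint hQ).isRightFaithfullyFlat
  have hleft : ∀ Q : GenQuot k H, Q.IsLeftAdmissible →
      IsLeftAdmissibleSubalgebra (quotToSub δ Q).1 := fun Q hQ =>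
    (isLeftFaithfullyFlat_iff_op _).2 (isDescentDatum_left hST hδ hint hQ).isRightFaithfullyFlat
  exact ⟨⟨injOn_right hST hδ hint, hright⟩, ⟨injOn_left hST hδ hint, hleft⟩,
    (injOn_right hST hδ hint).mono fun _ hQ => hQ.2, fun Q hQ => ⟨hleft Q hQ.1, hright Q hQ.2⟩⟩
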